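/- Let $\mathbb H=\{X=x^0e_0+x^1e_1+x^2e_2+x^3e_3\}$ be the quaternions with units $e_0=1,e_1=i,e_2=j,e_3=k$, conjugation $X\mapsto X^+$ and $N(X)=XX^+$. Embed $\mathbb H$ into the $2\times2$ complex matrices by $e_1\mapsto\begin{pmatrix}0&-i\\-i&0\end{pmatrix}$, $e_2\mapsto\begin{pmatrix}0&-1\\1&0\end{pmatrix}$, $e_3\mapsto\begin{pmatrix}-i&0\\0&i\end{pmatrix}$, so that $\mathbb H$ acts from the left on the space $\mathbb S$ of columns and from the right on the space $\mathbb S'$ of rows of two complex numbers. Put $$\nabla f=e_0\partial_0f-e_1\partial_1f-e_2\partial_2f-e_3\partial_3f,\qquad g\overleftarrow\nabla=(\partial_0g)e_0-(\partial_1g)e_1-(\partial_2g)e_2-(\partial_3g)e_3,\qquad \square=\partial_0^2+\partial_1^2+\partial_2^2+\partial_3^2 .$$ On an open set $V\subset\mathbb H$, a $\mathcal C^3$-function $f:V\to\mathbb S$ is called quasi left anti regular if $\nabla\square f=0$ on $V$, and a $\mathcal C^3$-function $g:V\to\mathbb S'$ is called quasi right anti regular if $(\square g)\overleftarrow\nabla=0$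 on $V$. Let $$(Dx)^+=e_0\,dx^1\wedge dx^2\wedge dx^3+e_1\,dx^0\wedge dx^2\wedge dx^3-e_2\,dx^0\wedge dx^1\wedge dx^3+e_3\,dx^0\wedge dx^1\wedge dx^2 .$$ **Theorem.** Let $U\subset\mathbb H$ be a bounded open set with piecewise $\mathcal C^1$ boundary, in the following sense: $\partial U$ has finite $3$-dimensional Hausdorff measure, and outside a subset of $3$-dimensional Hausdorff measure zero it is a $\mathcal C^1$ hypersurface with $U$ lying locally on one side of it. Let $\overrightarrow n$ be the outward unit normal, $dS$ the surface measure on $\partial U$ (the $3$-dimensional Hausdorff measure, normalised to agree with Lebesgue measure on $\mathbb R^3$), and give $\partial U$ the boundary orientation. If $f$ is quasi left anti regular on a neighborhood of $\overline U$, then for every $X_0\in\mathbb H\setminus\partial U$ the following integrals converge absolutely and $$\frac1{2\pi^2}\int_{\partial U}\frac{X-X_0}{N(X-X_0)^2}\cdot(Dx)^+\cdot f(X)+\frac1{8\pi^2}\int_{\partial U}\frac{\partial}{\partial\overrightarrow n}\frac{X-X_0}{N(X-X_0)}\cdot\nabla f(X)\,dS-\frac1{8\pi^2}\int_{\partial U}\frac{X-X_0}{N(X-X_0)}\cdot\frac{\partial}{\partial\overrightarrow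 n}\nabla f(X)\,dS=\begin{cases}f(X_0)&\text{if }X_0\in U,\\0&\text{if }X_0\notin\overline U.\end{cases}$$ If $g$ is quasi right anti regular on a neighborhood of $\overline U$, then for every $X_0\in\mathbb H\setminus\partial U$ the following integrals converge absolutely and $$\frac1{2\pi^2}\int_{\partial U}g(X)\cdot(Dx)^+\cdot\frac{X-X_0}{N(X-X_0)^2}+\frac1{8\pi^2}\int_{\partial U}(g\overleftarrow\nabla)(X)\cdot\frac{\partial}{\partial\overrightarrow n}\frac{X-X_0}{N(X-X_0)}\,dS-\frac1{8\pi^2}\int_{\partial U}\frac{\partial}{\partial\overrightarrow n}(g\overleftarrow\nabla)(X)\cdot\frac{X-X_0}{N(X-X_0)}\,dS=\begin{cases}g(X_0)&\text{if }X_0\in U,\\0&\text{if }X_0\notin\overline U.\end{cases}$$ -/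

import Mathlib

open MeasureTheory Topology Set
open scoped Quaternion Matrix

noncomputable section

namespace QuasiRegular

/-! ### Quaternions and the spinor modules -/

/-- The quaternions carry their Borel sigma-algebra. -/
instance instMeasurableSpaceQuaternion : MeasurableSpace ℍ[ℝ] := borel ℍ[ℝ]

instance instBorelSpaceQuaternion : BorelSpace ℍ[ℝ] := ⟨rfl⟩

/-- The units `e₀ = 1, e₁ = i, e₂ = j, e₃ = k`. -/
def e : Fin 4 → ℍ[ℝ] := ![⟨1, 0, 0, 0⟩, ⟨0, 1, 0, 0⟩, ⟨0, 0, 1, 0⟩, ⟨0, 0, 0, 1⟩]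

/-- The real coordinates `x⁰, x¹, x², x³` of a quaternion. -/
def coord (i : Fin 4) (q : ℍ[ℝ]) : ℝ := ![q.re, q.imI, q.imJ, q.imK] i

/-- The standard embedding of the quaternions into the complex `2 × 2` matrices (which are the
complexified quaternions), an embedding of real algebras:
`e₁ ↦ (0 -i; -i 0)`, `e₂ ↦ (0 -1; 1 0)`, `e₃ ↦ (-i 0; 0 i)`. -/
def toMat : ℍ[ℝ] →ₐ[ℝ] Matrix (Fin 2) (Fin 2) ℂ where
  toFun q := !![(q.re : ℂ) - Complex.I * q.imK, -Complex.I * q.imI - q.imJ;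
                -Complex.I * q.imI + q.imJ, (q.re : ℂ) + Complex.I * q.imK]
  map_one' := by
    ext a b; fin_cases a <;> fin_cases b <;> simp
  map_mul' p q := by
    ext a b
    fin_cases a <;> fin_cases b <;> simp [Matrix.mul_apply, Fin.sum_univ_two, Complex.ext_iff] <;>
      constructor <;> ring
  map_zero' := by
    ext a b; fin_cases a <;> fin_cases b <;> simp
  map_add' p q := by
    ext a b; fin_cases a <;> fin_cases b <;> simp <;> ring
  commutes' r := by
    ext a b
    fin_cases a <;> fin_cases b <;>
      simp [Matrix.algebraMap_matrix_apply]

/-- The left module `𝕊`: columns of two complex numbers. -/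
abbrev Spinor : Type := Fin 2 → ℂ

/-- The right module `𝕊'`: rows of two complex numbers. -/
abbrev CoSpinor : Type := Fin 2 → ℂ

/-- Left multiplication of a column by a quaternion. -/
def lact (q : ℍ[ℝ]) (s : Spinor) : Spinor := toMat q *ᵥ s

/-- Right multiplication of a row by a quaternion. -/
def ract (s : CoSpinor) (q : ℍ[ℝ]) : CoSpinor := s ᵥ* toMat q

/-! ### Differential operators -/

/-- The partial derivative `∂f/∂xⁱ`. -/
def pd {E : Type*} [NormedAddCommGroup E] [NormedSpace ℝ E] (i : Fin 4) (f : ℍ[ℝ] → E)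
    (x : ℍ[ℝ]) : E :=
  fderiv ℝ f x (e i)

/-- The Laplacian `□ = ∂₀² + ∂₁² + ∂₂² + ∂₃²`. -/
def box {E : Type*} [NormedAddCommGroup E] [NormedSpace ℝ E] (f : ℍ[ℝ] → E) (x : ℍ[ℝ]) : E :=
  ∑ i : Fin 4, pd i (pd i f) x

/-- `∇f = e₀ ∂₀f - e₁ ∂₁f - e₂ ∂₂f - e₃ ∂₃f`. -/
def nablaLeft (f : ℍ[ℝ] → Spinor) (x : ℍ[ℝ]) : Spinor :=
  lact (e 0) (pd 0 f x) - lact (e 1) (pd 1 f x) - lact (e 2) (pd 2 f x) - lact (e 3) (pd 3 f x)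

/-- `g∇ = ∂₀g e₀ - ∂₁g e₁ - ∂₂g e₂ - ∂₃g e₃`, the operator acting from the right. -/
def nablaRight (g : ℍ[ℝ] → CoSpinor) (x : ℍ[ℝ]) : CoSpinor :=
  ract (pd 0 g x) (e 0) - ract (pd 1 g x) (e 1) - ract (pd 2 g x) (e 2) - ract (pd 3 g x) (e 3)

/-- Quasi left anti regular functions on an open set `V`. -/
def IsQLAR (V : Set ℍ[ℝ]) (f : ℍ[ℝ] → Spinor) : Prop :=
  ContDiffOn ℝ 3 f V ∧ ∀ x ∈ V, nablaLeft (box f) x = 0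

/-- Quasi right anti regular functions on an open set `V`. -/
def IsQRAR (V : Set ℍ[ℝ]) (g : ℍ[ℝ] → CoSpinor) : Prop :=
  ContDiffOn ℝ 3 g V ∧ ∀ x ∈ V, nablaRight (box g) x = 0

/-! ### The boundary: regular points, normal, surface measure -/

/-- `n` is the outward unit normal to `U` at the boundary point `x`, and the boundary of `U` is a
`C¹` hypersurface near `x` with `U` lying locally on one side of it: near `x`, the set `U` is
`{ψ < 0}` for a `C¹` function `ψ` that vanishes at `x` and has gradient `n` there. (A local defining
function with nonzero gradient can always be rescaled to have a unit gradient at `x`.) -/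
def IsOutwardUnitNormal (U : Set ℍ[ℝ]) (x n : ℍ[ℝ]) : Prop :=
  ‖n‖ = 1 ∧ ∃ (V : Set ℍ[ℝ]) (ψ : ℍ[ℝ] → ℝ), IsOpen V ∧ x ∈ V ∧ ContDiffOn ℝ 1 ψ V ∧
    ψ x = 0 ∧ U ∩ V = {y ∈ V | ψ y < 0} ∧ HasGradientAt ψ n x

/-- The boundary of `U` is `C¹` near `x`. -/
def IsRegularBoundaryPoint (U : Set ℍ[ℝ]) (x : ℍ[ℝ]) : Prop :=
  ∃ n, IsOutwardUnitNormal U x n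

/-- Surface measure `dS` on the boundary of `U`: the three-dimensional Hausdorff measure, normalised
to agree with Lebesgue measure on three-dimensional Euclidean space. -/
def surfaceMeasure (U : Set ℍ[ℝ]) : Measure ℍ[ℝ] := μHE[3].restrict (frontier U)

/-- Piecewise `C¹` boundary: the boundary has finite area, and it is a `C¹` hypersurface outside a
set (the edges, corners and other singular points where the `C¹` pieces meet) of zero area. -/
def HasPiecewiseC1Boundary (U : Set ℍ[ℝ]) : Prop :=
  μHE[3] (frontier U) < ⊤ ∧ μHE[3] {x ∈ frontier U | ¬ IsRegularBoundaryPoint U x} = 0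

open Classical in
/-- The outward pointing unit normal (it is unique at a regular boundary point; the value `0` at the
other points plays no role). -/
def outwardNormal (U : Set ℍ[ℝ]) (x : ℍ[ℝ]) : ℍ[ℝ] :=
  if h : IsRegularBoundaryPoint U x then h.choose else 0

/-- The derivative `∂F/∂n` in the direction of the outward normal. -/
def normalDeriv {E : Type*} [NormedAddCommGroup E] [NormedSpace ℝ E] (U : Set ℍ[ℝ])
    (F : ℍ[ℝ] → E) (x : ℍ[ℝ]) : E :=
  fderiv ℝ F x (outwardNormal U x)

/-! ### Three-forms and their boundary integrals -/

/-- The form `dxⁱ ∧ dxʲ ∧ dxᵏ` evaluated on three tangent vectors. -/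
def dx (i j k : Fin 4) (v : Fin 3 → ℍ[ℝ]) : ℝ :=
  Matrix.det (Matrix.of fun a b => coord (![i, j, k] a) (v b))

/-- The quaternion-valued three-form `Dx = e₀ dx¹∧dx²∧dx³ - e₁ dx⁰∧dx²∧dx³ + e₂ dx⁰∧dx¹∧dx³
- e₃ dx⁰∧dx¹∧dx²`. -/
def Dx (v : Fin 3 → ℍ[ℝ]) : ℍ[ℝ] :=
  dx 1 2 3 v • e 0 - dx 0 2 3 v • e 1 + dx 0 1 3 v • e 2 - dx 0 1 2 v • e 3

/-- The quaternionic conjugate `(Dx)⁺` of the form `Dx`. -/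
def DxPlus (v : Fin 3 → ℍ[ℝ]) : ℍ[ℝ] := star (Dx v)

/-- The tangent frame `(n e₁, n e₂, n e₃)` at a boundary point with outward unit normal `n`. It is
orthonormal, and `(n, n e₁, n e₂, n e₃)` is a positively oriented basis of `ℝ⁴`, being the image of
`(e₀, e₁, e₂, e₃)` under a rotation; so it is positive for the boundary orientation. -/
def tangentFrame (n : ℍ[ℝ]) : Fin 3 → ℍ[ℝ] := ![n * e 1, n * e 2, n * e 3]

/-- A vector-valued three-form `ω` evaluated on a positively oriented orthonormal frame of the
tangent space to the boundary: the density of `ω` with respect to surface measure. -/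
def formDensity {E : Type*} (U : Set ℍ[ℝ]) (ω : ℍ[ℝ] → (Fin 3 → ℍ[ℝ]) → E) (x : ℍ[ℝ]) : E :=
  ω x (tangentFrame (outwardNormal U x))

/-- The integral of a three-form over the boundary of `U` (with the boundary orientation). -/
def formIntegral {E : Type*} [NormedAddCommGroup E] [NormedSpace ℝ E] (U : Set ℍ[ℝ])
    (ω : ℍ[ℝ] → (Fin 3 → ℍ[ℝ]) → E) : E :=
  ∫ x, formDensity U ω x ∂(surfaceMeasure U)

/-! ### The kernels and the integrands -/

/-- `(X - X₀) / N(X - X₀)`. -/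
def kerOne (X₀ X : ℍ[ℝ]) : ℍ[ℝ] := (Quaternion.normSq (X - X₀))⁻¹ • (X - X₀)

/-- `(X - X₀) / N(X - X₀)²`. -/
def kerTwo (X₀ X : ℍ[ℝ]) : ℍ[ℝ] := (Quaternion.normSq (X - X₀) ^ 2)⁻¹ • (X - X₀)

/-- The three-form `(X - X₀) / N(X - X₀)² · (Dx)⁺ · f(X)`. -/
def leftForm (f : ℍ[ℝ] → Spinor) (X₀ : ℍ[ℝ]) : ℍ[ℝ] → (Fin 3 → ℍ[ℝ]) → Spinor :=
  fun X v => lact (kerTwo X₀ X) (lact (DxPlus v) (f X))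

/-- `∂/∂n ((X - X₀) / N(X - X₀)) · ∇f(X)`. -/
def leftTermA (U : Set ℍ[ℝ]) (f : ℍ[ℝ] → Spinor) (X₀ X : ℍ[ℝ]) : Spinor :=
  lact (normalDeriv U (kerOne X₀) X) (nablaLeft f X)

/-- `(X - X₀) / N(X - X₀) · ∂/∂n ∇f(X)`. -/
def leftTermB (U : Set ℍ[ℝ]) (f : ℍ[ℝ] → Spinor) (X₀ X : ℍ[ℝ]) : Spinor :=
  lact (kerOne X₀ X) (normalDeriv U (nablaLeft f) X)

/-- The three-form `g(X) · (Dx)⁺ · (X - X₀) / N(X - X₀)²`. -/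
def rightForm (g : ℍ[ℝ] → CoSpinor) (X₀ : ℍ[ℝ]) : ℍ[ℝ] → (Fin 3 → ℍ[ℝ]) → CoSpinor :=
  fun X v => ract (ract (g X) (DxPlus v)) (kerTwo X₀ X)

/-- `(g∇)(X) · ∂/∂n ((X - X₀) / N(X - X₀))`. -/
def rightTermA (U : Set ℍ[ℝ]) (g : ℍ[ℝ] → CoSpinor) (X₀ X : ℍ[ℝ]) : CoSpinor :=
  ract (nablaRight g X) (normalDeriv U (kerOne X₀) X)

/-- `∂/∂n (g∇)(X) · (X - X₀) / N(X - X₀)`. -/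
def rightTermB (U : Set ℍ[ℝ]) (g : ℍ[ℝ] → CoSpinor) (X₀ X : ℍ[ℝ]) : CoSpinor :=
  ract (normalDeriv U (nablaRight g) X) (kerOne X₀ X)

end QuasiRegular

end

namespace QuasiRegular

open Filter

/-! ### Integrals of derivatives over sublevel sets, one line at a time -/

/-! Put u = X - X₀ and N = N(u). The formula is the divergence theorem for the field with components
F_i = (1/2π²) (u/N²) ē_i f + (1/8π²) (∂_i(u/N) ∇f - (u/N) ∂_i∇f). On the boundary (Dx)⁺ restricts to
n̄ dS, so the normal flux of F is the sum of the three integrands. Off X₀ the divergence is zero: Σ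
∂_i(u/N²) ē_i = 0 leaves (1/2π²) (u/N²) ∇f from the first term, and □(u/N) = -4 u/N² makes the
second term contribute the opposite, because □∇f = ∇□f = 0. Left and right modules are treated
together through a bilinear action `m`, of which only m q (m q⁺ v) = N(q) v is used.

No ball around X₀ is cut out. The denominators N are replaced by N + s, which makes the field
regular at X₀, with divergence (2/π²) s (N + s)⁻³ (f - ½ u ∇f) (`sum_pd_fluxField`). The scalar
factor has mass one on ℝ⁴ and is an approximate identity as s → 0, and the bracket equals f(X₀) at
X₀. The solid integral thus tends to f(X₀) or to 0, while the flux converges because X₀ is off the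
boundary.

Most of the work is the Gauss-Green formula when the boundary is C¹ only up to a null set
(`setIntegral_fderiv_eq_integral_surfaceMeasure`). It is proved without parametrisations or an area
formula. Near a regular point with normal n, take φ ≥ 0 and let ℓ(u) be the integral of ∂φ/∂u over
U, and h the integral of φ over the boundary. Slicing by lines parallel to a unit vector v writes
ℓ(v) as an integral over the projection of the boundary along v. Projections do not increase area,
so ℓ(v) ≤ h for all v in a cone around n; along n itself the projection is almost isometric on the
boundary, so ℓ(n) is almost h. A linear functional with these two properties is close to h⟨n, ·⟩
(`abs_sub_inner_mul_le`). The error is a small multiple of h, hence additive in φ: a partition of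
unity transports it from the charts to U, where it is made to vanish. Finally, cutoffs whose
gradients have small integral remove the singular set (`exists_cutoff`). -/

theorem setIntegral_deriv_eq_of_root {f ψ : ℝ → ℝ} {I A : Set ℝ} {τ : ℝ} (hf : ContDiff ℝ 1 f)
    (hc : HasCompactSupport f) (hfI : tsupport f ⊆ I) (hA : IsOpen A) (hψ : StrictMonoOn ψ I)
    (hAI : ∀ t ∈ I, t ∈ A ↔ ψ t < 0) (hτ : τ ∈ I) (h0 : ψ τ = 0) :
    ∫ t in A, deriv f t = f τ := by
  -- On `I` monotonicity identifies `A` with the ray ending at `τ`, and off `I` the derivative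
  -- vanishes, so the fundamental theorem of calculus on the ray applies.
  have key : A.indicator (deriv f) = (Iio τ).indicator (deriv f) := by
    ext t
    by_cases ht : t ∈ I
    · have : t ∈ A ↔ t ∈ Iio τ := by
        rw [hAI t ht, ← h0, hψ.lt_iff_lt ht hτ, mem_Iio]
      by_cases h : t ∈ A
      · rw [indicator_of_mem h, indicator_of_mem (this.1 h)]
      · rw [indicator_of_notMem h, indicator_of_notMem (fun h' => h (this.2 h'))]
    · have : deriv f t = 0 := by
        by_contra h
        exact ht (hfI (tsupport_deriv_subset (subset_tsupport _ h)))
      simp [indicator, this]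
  rw [← integral_indicator hA.measurableSet, key, integral_indicator measurableSet_Iio,
    ← integral_Iic_eq_integral_Iio, hc.integral_Iic_deriv_eq hf]

/-- Without a root `ψ` keeps one sign on the connected set `I`, so `A` contains `I` or misses it. In
the first case the integral is that of the derivative of a compactly supported function over the
whole line. -/
theorem setIntegral_deriv_eq_zero_of_no_root {f ψ : ℝ → ℝ} {I A : Set ℝ} (hf : ContDiff ℝ 1 f)
    (hc : HasCompactSupport f) (hfI : tsupport f ⊆ I) (hA : IsOpen A) (hI : IsPreconnected I)
    (hψ : ContinuousOn ψ I) (hAI : ∀ t ∈ I, t ∈ A ↔ ψ t < 0) (h0 : ∀ t ∈ I, ψ t ≠ 0) :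
    ∫ t in A, deriv f t = 0 := by
  have hout : ∀ t ∉ I, deriv f t = 0 := by
    intro t ht
    by_contra h
    exact ht (hfI (tsupport_deriv_subset (subset_tsupport _ h)))
  rw [← integral_indicator hA.measurableSet]
  have hsign : (∀ t ∈ I, ψ t < 0) ∨ (∀ t ∈ I, 0 < ψ t) := by
    by_contra! h
    obtain ⟨⟨a, ha, ha'⟩, b, hb, hb'⟩ := h
    obtain ⟨c, hc, hc'⟩ := hI.intermediate_value hb ha hψ ⟨hb', ha'⟩
    exact h0 c hc hc'
  rcases hsign with h | h
  · have key : A.indicator (deriv f) = deriv f := by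
      ext t
      by_cases ht : t ∈ I
      · exact indicator_of_mem ((hAI t ht).2 (h t ht)) _
      · simp [indicator, hout t ht]
    rw [key]
    exact integral_eq_zero_of_hasDerivAt_of_integrable
      (fun x => (hf.differentiable one_ne_zero x).hasDerivAt)
      ((hf.continuous_deriv le_rfl).integrable_of_hasCompactSupport hc.deriv)
      (hf.continuous.integrable_of_hasCompactSupport hc)
  · have key : A.indicator (deriv f) = 0 := by
      ext t
      by_cases ht : t ∈ I
      · exact indicator_of_notMem (fun h' => lt_asymm (h t ht) ((hAI t ht).1 h')) _
      · simp [indicator, hout t ht]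
    simp [key]

section Slices

variable {H : Type*} [NormedAddCommGroup H] [InnerProductSpace ℝ H] [FiniteDimensional ℝ H]
  [MeasurableSpace H] [BorelSpace H]

/-- Fubini's theorem along the lines parallel to a unit vector. -/
theorem exists_measurePreserving_orthogonal {v : H} (hv : ‖v‖ = 1) :
    ∃ e : ((ℝ ∙ v)ᗮ : Submodule ℝ H) × ℝ ≃ᵐ H,
      MeasurePreserving e (volume.prod volume) volume ∧ ∀ p t, e (p, t) = (p : H) + t • v := by
  let L := LinearIsometryEquiv.toSpanUnitSingleton (𝕜 := ℝ) v hv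
  let e₁ : ((ℝ ∙ v)ᗮ : Submodule ℝ H) × ℝ ≃ᵐ (ℝ ∙ v) × ((ℝ ∙ v)ᗮ : Submodule ℝ H) :=
    MeasurableEquiv.prodComm.trans
      (MeasurableEquiv.prodCongr L.toHomeomorph.toMeasurableEquiv (MeasurableEquiv.refl _))
  let e₂ : (ℝ ∙ v) × ((ℝ ∙ v)ᗮ : Submodule ℝ H) ≃ᵐ H :=
    (MeasurableEquiv.toLp 2 _).trans
      (ℝ ∙ v).orthogonalDecomposition.symm.toHomeomorph.toMeasurableEquiv
  have h₁ : MeasurePreserving e₁ (volume.prod volume) (volume.prod volume) :=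
    Measure.measurePreserving_swap.trans (L.measurePreserving.prod (MeasurePreserving.id _))
  have h₂ : MeasurePreserving e₂ (volume.prod volume) volume :=
    (WithLp.volume_preserving_toLp _ _).trans
      (ℝ ∙ v).orthogonalDecomposition.symm.measurePreserving
  refine ⟨e₁.trans e₂, h₁.trans h₂, fun p t => ?_⟩
  have : (e₁.trans e₂) (p, t) = t • v + (p : H) := by
    simp only [MeasurableEquiv.trans_apply, e₁, e₂]
    change (ℝ ∙ v).orthogonalDecomposition.symm (WithLp.toLp 2 (L t, p)) = _
    simp [L]
  rw [this, add_comm]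

end Slices

section Slices

variable {H : Type*} [NormedAddCommGroup H] [InnerProductSpace ℝ H] [FiniteDimensional ℝ H]
  [MeasurableSpace H] [BorelSpace H]

omit [FiniteDimensional ℝ H] [MeasurableSpace H] [BorelSpace H] in
theorem orthogonalProjectionOnto_add_inner_smul {v : H} (hv : ‖v‖ = 1) (z : H) :
    ((ℝ ∙ v)ᗮ.orthogonalProjectionOnto z : H) + inner ℝ v z • v = z := by
  have h := (ℝ ∙ v).starProjection_add_starProjection_orthogonal z
  rw [Submodule.starProjection_unit_singleton ℝ hv] at h
  rw [add_comm]
  exact h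

theorem integrable_fderiv_apply {φ : H → ℝ} (hφ : ContDiff ℝ 1 φ) (hc : HasCompactSupport φ)
    (v : H) : Integrable (fun x => fderiv ℝ φ x v) := by
  refine Continuous.integrable_of_hasCompactSupport ?_ (hc.fderiv_apply (𝕜 := ℝ) v)
  exact (hφ.continuous_fderiv one_ne_zero).clm_apply continuous_const

/-- The integral of `∂φ/∂v` over a domain that is locally a sublevel set of a function increasing
in the direction `v`, as an integral over the projection of the level set along `v`. -/
theorem exists_slice_function {v : H} (hv : ‖v‖ = 1) {U W : Set H} (hU : IsOpen U)
    (hW : Convex ℝ W) {ψ : H → ℝ} (hψ : ContinuousOn ψ W)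
    (hmono : ∀ z ∈ W, ∀ t : ℝ, 0 < t → z + t • v ∈ W → ψ z < ψ (z + t • v))
    (hUW : ∀ z ∈ W, z ∈ U ↔ ψ z < 0) {φ : H → ℝ} (hφ : ContDiff ℝ 1 φ)
    (hc : HasCompactSupport φ) (hφW : tsupport φ ⊆ W) :
    ∃ g : ((ℝ ∙ v)ᗮ : Submodule ℝ H) → ℝ, StronglyMeasurable g ∧ Integrable g ∧
      ∫ x in U, fderiv ℝ φ x v = ∫ p, g p ∧
      (∀ z ∈ W, ψ z = 0 → g ((ℝ ∙ v)ᗮ.orthogonalProjectionOnto z) = φ z) ∧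
      ∀ p, g p ≠ 0 → ∃ z ∈ W, ψ z = 0 ∧ (ℝ ∙ v)ᗮ.orthogonalProjectionOnto z = p := by
  obtain ⟨e, he, hev⟩ := exists_measurePreserving_orthogonal hv
  let F : H → ℝ := U.indicator fun x => fderiv ℝ φ x v
  have hFm : StronglyMeasurable F := by
    refine StronglyMeasurable.indicator ?_ hU.measurableSet
    exact ((hφ.continuous_fderiv one_ne_zero).clm_apply continuous_const).stronglyMeasurable
  have hFi : Integrable F := (integrable_fderiv_apply hφ hc v).indicator hU.measurableSet
  have hFe : Integrable (fun q : ((ℝ ∙ v)ᗮ : Submodule ℝ H) × ℝ => F (e q)) (volume.prod volume) :=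
    he.integrable_comp_of_integrable hFi
  -- By the two one-dimensional lemmas `g p` is the value of `φ` where the line through `p` crosses
  -- the level set, and `0` if there is no crossing in `W`. Convexity of `W` makes its trace on each
  -- line an interval.
  let g : ((ℝ ∙ v)ᗮ : Submodule ℝ H) → ℝ := fun p => ∫ t, F (e (p, t))
  have hline : ∀ p : ((ℝ ∙ v)ᗮ : Submodule ℝ H), Continuous fun t : ℝ => (p : H) + t • v := fun p => by fun_prop
  have hiso : ∀ p : ((ℝ ∙ v)ᗮ : Submodule ℝ H), Isometry fun t : ℝ => (p : H) + t • v := by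
    intro p
    refine Isometry.of_dist_eq fun s t => ?_
    rw [dist_add_left, dist_eq_norm, ← sub_smul, norm_smul, hv, mul_one, dist_eq_norm]
  have hg : ∀ p, g p = ∫ t in (fun t : ℝ => (p : H) + t • v) ⁻¹' U,
      deriv (fun t : ℝ => φ (p + t • v)) t := by
    intro p
    rw [← integral_indicator (hU.preimage (hline p)).measurableSet]
    refine integral_congr_ae (Eventually.of_forall fun t => ?_)
    have hd : HasDerivAt (fun t : ℝ => φ (p + t • v)) (fderiv ℝ φ (p + t • v) v) t := by
      have h1 : HasDerivAt (fun t : ℝ => (p : H) + t • v) v t := by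
        simpa using ((hasDerivAt_id t).smul_const v).const_add (p : H)
      exact ((hφ.differentiable one_ne_zero _).hasFDerivAt).comp_hasDerivAt t h1
    simp [F, hev, indicator, hd.deriv]
    rfl
  have hf : ∀ p : ((ℝ ∙ v)ᗮ : Submodule ℝ H), ContDiff ℝ 1 fun t : ℝ => φ (p + t • v) := fun p => by fun_prop
  have hfc : ∀ p : ((ℝ ∙ v)ᗮ : Submodule ℝ H), HasCompactSupport fun t : ℝ => φ (p + t • v) := fun p =>
    hc.comp_isClosedEmbedding (hiso p).isClosedEmbedding
  have hfs : ∀ p : ((ℝ ∙ v)ᗮ : Submodule ℝ H), tsupport (fun t : ℝ => φ (p + t • v)) ⊆ {t | (p : H) + t • v ∈ W} :=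
    fun p => (tsupport_comp_subset_preimage φ (hline p)).trans (preimage_mono hφW)
  have hconv : ∀ p : ((ℝ ∙ v)ᗮ : Submodule ℝ H), Convex ℝ {t : ℝ | (p : H) + t • v ∈ W} := by
    intro p s hs t ht a b ha hb hab
    have := hW hs ht ha hb hab
    have h2 : a • ((p : H) + s • v) + b • ((p : H) + t • v) = p + (a • s + b • t) • v := by
      have : (p : H) = (a + b) • (p : H) := by rw [hab, one_smul]
      simp only [smul_add, smul_smul, add_smul]
      nth_rewrite 3 [this]
      module
    simpa only [mem_ofPred_eq, ← h2] using! this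
  refine ⟨g, ?_, ?_, ?_, ?_, ?_⟩
  · exact (hFm.comp_measurable e.measurable).integral_prod_right'
  · exact hFe.integral_prod_left
  · rw [← integral_indicator hU.measurableSet, ← he.integral_comp e.measurableEmbedding,
      integral_prod _ hFe]
  · intro z hz hz0
    have hz' := orthogonalProjectionOnto_add_inner_smul hv z
    rw [hg, setIntegral_deriv_eq_of_root (hf _) (hfc _) (hfs _) (hU.preimage (hline _))
      (ψ := fun t => ψ (((ℝ ∙ v)ᗮ.orthogonalProjectionOnto z : H) + t • v)) (τ := inner ℝ v z) ?_
      (fun t ht => hUW _ ht) (by rw [mem_ofPred_eq, hz']; exact hz)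
      (by rw [hz', hz0])]
    · rw [hz']
    · intro s hs t ht hst
      have := hmono _ hs (t - s) (sub_pos.2 hst)
      have h2 : ((ℝ ∙ v)ᗮ.orthogonalProjectionOnto z : H) + s • v + (t - s) • v
          = ((ℝ ∙ v)ᗮ.orthogonalProjectionOnto z : H) + t • v := by module
      rw [h2] at this
      exact this ht
  · intro p hp
    by_contra! h
    refine hp ?_
    rw [hg]
    refine setIntegral_deriv_eq_zero_of_no_root (hf p) (hfc p) (hfs p) (hU.preimage (hline p))
      (hconv p).isPreconnected (ψ := fun t => ψ ((p : H) + t • v))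
      (hψ.comp (hline p).continuousOn fun t ht => ht) (fun t ht => hUW _ ht) fun t ht h0 => ?_
    refine h _ ht h0 ?_
    have h1 : (ℝ ∙ v)ᗮ.orthogonalProjectionOnto (p : H) = p :=
      Submodule.orthogonalProjectionOnto_mem_subspace_eq_self p
    have h2 : (ℝ ∙ v)ᗮ.orthogonalProjectionOnto v = 0 :=
      Submodule.orthogonalProjectionOnto_orthogonal_apply_eq_zero
        (Submodule.mem_span_singleton_self v)
    rw [map_add, map_smul, h1, h2, smul_zero, add_zero]

end Slices

open scoped NNReal ENNReal

/-! ### Hausdorff measure under projections -/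

section Hausdorff

variable {X Y : Type*} [MetricSpace X] [MeasurableSpace X] [BorelSpace X]
  [MetricSpace Y] [MeasurableSpace Y] [BorelSpace Y]

theorem euclideanHausdorffMeasure_image_le {f : X → Y} {s : Set X} {K : ℝ≥0}
    (h : LipschitzOnWith K f s) (d : ℕ) :
    (μHE[d] : Measure Y) (f '' s) ≤ (K : ℝ≥0∞) ^ d * (μHE[d] : Measure X) s := by
  simp only [Measure.euclideanHausdorffMeasure_def, Measure.smul_apply, ENNReal.smul_def,
    smul_eq_mul]
  rw [mul_left_comm]
  gcongr
  simpa using h.hausdorffMeasure_image_le (d := d) (by positivity)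

/-- A 1-Lipschitz map does not increase Hausdorff measure; applied to the part of `S` over each
Borel set, this becomes an inequality of measures, so that integrals of functions can be compared
and not only total areas. -/
theorem euclideanHausdorffMeasure_restrict_le_map {P : X → Y} (hP : LipschitzWith 1 P) (d : ℕ)
    {S : Set X} {A : Set Y} (hA : A ⊆ P '' S) :
    (μHE[d] : Measure Y).restrict A ≤ ((μHE[d] : Measure X).restrict S).map P := by
  refine Measure.le_iff.2 fun B hB => ?_
  rw [Measure.map_apply hP.continuous.measurable hB,
    Measure.restrict_apply (hP.continuous.measurable hB), Measure.restrict_apply hB]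
  calc (μHE[d] : Measure Y) (B ∩ A) ≤ (μHE[d] : Measure Y) (P '' (P ⁻¹' B ∩ S)) := by
        refine measure_mono ?_
        rintro y ⟨hyB, hyA⟩
        obtain ⟨x, hx, rfl⟩ := hA hyA
        exact ⟨x, ⟨hyB, hx⟩, rfl⟩
    _ ≤ _ := by simpa using euclideanHausdorffMeasure_image_le (hP.lipschitzOnWith (s := _)) d

/-- The bound `hK` makes `P` injective on `S` with a `K`-Lipschitz inverse, and that inverse expands
`d`-dimensional measure at most by `K ^ d`. -/
theorem map_euclideanHausdorffMeasure_restrict_le {P : X → Y} (hP : Measurable P) (d : ℕ)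
    {S : Set X} {K : ℝ≥0} (hK : ∀ x ∈ S, ∀ y ∈ S, dist x y ≤ K * dist (P x) (P y)) :
    ((μHE[d] : Measure X).restrict S).map P ≤ (K : ℝ≥0∞) ^ d • (μHE[d] : Measure Y) := by
  have hinj : InjOn P S := by
    intro x hx y hy hxy
    have := hK x hx y hy
    rw [hxy, dist_self, mul_zero] at this
    exact dist_le_zero.1 this
  refine Measure.le_iff.2 fun B hB => ?_
  rw [Measure.map_apply hP hB, Measure.restrict_apply (hP hB)]
  rcases isEmpty_or_nonempty X with hX | hX
  · simp [Set.eq_empty_of_isEmpty]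
  have hlip : LipschitzOnWith K (Function.invFunOn P S) (P '' (P ⁻¹' B ∩ S)) := by
    refine LipschitzOnWith.of_dist_le_mul ?_
    rintro _ ⟨x, hx, rfl⟩ _ ⟨y, hy, rfl⟩
    rw [hinj.leftInvOn_invFunOn hx.2, hinj.leftInvOn_invFunOn hy.2]
    exact hK x hx.2 y hy.2
  have himg : Function.invFunOn P S '' (P '' (P ⁻¹' B ∩ S)) = P ⁻¹' B ∩ S := by
    rw [image_image]
    ext x
    constructor
    · rintro ⟨y, hy, rfl⟩
      change Function.invFunOn P S (P y) ∈ _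
      rwa [hinj.leftInvOn_invFunOn hy.2]
    · intro hx
      exact ⟨x, hx, hinj.leftInvOn_invFunOn hx.2⟩
  calc (μHE[d] : Measure X) (P ⁻¹' B ∩ S)
      ≤ (K : ℝ≥0∞) ^ d * (μHE[d] : Measure Y) (P '' (P ⁻¹' B ∩ S)) := by
        simpa only [himg] using euclideanHausdorffMeasure_image_le hlip d
    _ ≤ _ := by
        rw [Measure.smul_apply, smul_eq_mul]
        gcongr
        rintro _ ⟨x, hx, rfl⟩
        exact hx.1

end Hausdorff

/-! ### Derivative integrals against boundary area -/

section Slices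

variable {H : Type*} [NormedAddCommGroup H] [InnerProductSpace ℝ H] [FiniteDimensional ℝ H]
  [MeasurableSpace H] [BorelSpace H]

theorem volume_orthogonal_eq {d : ℕ} (hd : Module.finrank ℝ H = d + 1) {v : H} (hv : ‖v‖ = 1) :
    (volume : Measure ((ℝ ∙ v)ᗮ : Submodule ℝ H)) = μHE[d] := by
  have hv0 : v ≠ 0 := by
    rintro rfl
    simp at hv
  have : Module.finrank ℝ ((ℝ ∙ v)ᗮ : Submodule ℝ H) = d := by
    have : Fact (Module.finrank ℝ H = d + 1) := ⟨hd⟩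
    exact Submodule.finrank_orthogonal_span_singleton hv0
  rw [← InnerProductSpace.euclideanHausdorffMeasure_eq_volume, this]

section

variable {d : ℕ} (hd : Module.finrank ℝ H = d + 1) {v : H} (hv : ‖v‖ = 1) {U W : Set H}
  (hU : IsOpen U) (hW : Convex ℝ W) {ψ : H → ℝ} (hψ : ContinuousOn ψ W)
  (hmono : ∀ z ∈ W, ∀ t : ℝ, 0 < t → z + t • v ∈ W → ψ z < ψ (z + t • v))
  (hUW : ∀ z ∈ W, z ∈ U ↔ ψ z < 0) {φ : H → ℝ} (hφ : ContDiff ℝ 1 φ)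
  (hc : HasCompactSupport φ) (hφW : tsupport φ ⊆ W) (hφ0 : ∀ x, 0 ≤ φ x)
  (hS : MeasurableSet {z ∈ W | ψ z = 0})
include hd hv hU hW hψ hmono hUW hφ hc hφW hφ0 hS

/-- The slice function lives on the projection of the level set and takes there the values of `φ`;
the projection along `v` does not increase area. -/
theorem ofReal_setIntegral_fderiv_le :
    ENNReal.ofReal (∫ x in U, fderiv ℝ φ x v) ≤
      ∫⁻ x in {z ∈ W | ψ z = 0}, ENNReal.ofReal (φ x) ∂μHE[d] := by
  obtain ⟨g, hgm, hgi, hgU, hgS, hg0⟩ := exists_slice_function hv hU hW hψ hmono hUW hφ hc hφW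
  set S := {z ∈ W | ψ z = 0}
  let P := (ℝ ∙ v)ᗮ.orthogonalProjectionOnto
  have hgnn : ∀ p, 0 ≤ g p := by
    intro p
    by_cases h : g p = 0
    · exact h.ge
    · obtain ⟨z, hz, hz0, rfl⟩ := hg0 p h
      rw [hgS z hz hz0]
      exact hφ0 z
  have hP : LipschitzWith 1 P :=
    P.lipschitz.weaken (Submodule.orthogonalProjectionOnto_norm_le _)
  have hA : MeasurableSet {p | g p ≠ 0} := hgm.measurable (measurableSet_singleton 0).compl
  rw [hgU, ofReal_integral_eq_lintegral_ofReal hgi (Eventually.of_forall hgnn)]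
  calc ∫⁻ p, ENNReal.ofReal (g p)
      = ∫⁻ p in {p | g p ≠ 0}, ENNReal.ofReal (g p) := by
        refine (setLIntegral_eq_of_support_subset ?_).symm
        intro p hp h
        simp [h] at hp
    _ ≤ ∫⁻ p, ENNReal.ofReal (g p) ∂((μHE[d].restrict S).map P) := by
        refine lintegral_mono' ?_ le_rfl
        rw [volume_orthogonal_eq hd hv]
        refine euclideanHausdorffMeasure_restrict_le_map hP d ?_
        intro p hp
        obtain ⟨z, hz, hz0, h⟩ := hg0 p hp
        exact ⟨z, ⟨hz, hz0⟩, h⟩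
    _ = ∫⁻ x in S, ENNReal.ofReal (g (P x)) ∂μHE[d] :=
        lintegral_map hgm.measurable.ennreal_ofReal hP.continuous.measurable
    _ = ∫⁻ x in S, ENNReal.ofReal (φ x) ∂μHE[d] :=
        setLIntegral_congr_fun hS fun x hx => by simp only [P, hgS x hx.1 hx.2]

omit hd hS in
theorem setIntegral_fderiv_nonneg : 0 ≤ ∫ x in U, fderiv ℝ φ x v := by
  obtain ⟨g, -, -, hgU, hgS, hg0⟩ := exists_slice_function hv hU hW hψ hmono hUW hφ hc hφW
  rw [hgU]
  refine integral_nonneg fun p => ?_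
  by_cases h : g p = 0
  · exact h.ge
  · obtain ⟨z, hz, hz0, rfl⟩ := hg0 p h
    rw [hgS z hz hz0]
    exact hφ0 z

/-- The converse of `ofReal_setIntegral_fderiv_le`, at the price of `K ^ d`, when the level set is a
Lipschitz graph over the hyperplane orthogonal to `v`. -/
theorem lintegral_le_ofReal_setIntegral_fderiv {K : ℝ≥0}
    (hK : ∀ x ∈ {z ∈ W | ψ z = 0}, ∀ y ∈ {z ∈ W | ψ z = 0}, dist x y ≤
      K * dist ((ℝ ∙ v)ᗮ.orthogonalProjectionOnto x) ((ℝ ∙ v)ᗮ.orthogonalProjectionOnto y)) :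
    ∫⁻ x in {z ∈ W | ψ z = 0}, ENNReal.ofReal (φ x) ∂μHE[d] ≤
      (K : ℝ≥0∞) ^ d * ENNReal.ofReal (∫ x in U, fderiv ℝ φ x v) := by
  obtain ⟨g, hgm, hgi, hgU, hgS, hg0⟩ := exists_slice_function hv hU hW hψ hmono hUW hφ hc hφW
  set S := {z ∈ W | ψ z = 0}
  let P := (ℝ ∙ v)ᗮ.orthogonalProjectionOnto
  have hgnn : ∀ p, 0 ≤ g p := by
    intro p
    by_cases h : g p = 0
    · exact h.ge
    · obtain ⟨z, hz, hz0, rfl⟩ := hg0 p h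
      rw [hgS z hz hz0]
      exact hφ0 z
  rw [hgU, ofReal_integral_eq_lintegral_ofReal hgi (Eventually.of_forall hgnn)]
  calc ∫⁻ x in S, ENNReal.ofReal (φ x) ∂μHE[d]
      = ∫⁻ x in S, ENNReal.ofReal (g (P x)) ∂μHE[d] :=
        setLIntegral_congr_fun hS fun x hx => by simp only [P, hgS x hx.1 hx.2]
    _ = ∫⁻ p, ENNReal.ofReal (g p) ∂((μHE[d].restrict S).map P) :=
        (lintegral_map hgm.measurable.ennreal_ofReal P.continuous.measurable).symm
    _ ≤ ∫⁻ p, ENNReal.ofReal (g p) ∂((K : ℝ≥0∞) ^ d • (volume : Measure (ℝ ∙ v)ᗮ)) := by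
        refine lintegral_mono' ?_ le_rfl
        rw [volume_orthogonal_eq hd hv]
        exact map_euclideanHausdorffMeasure_restrict_le P.continuous.measurable d hK
    _ = _ := by rw [lintegral_smul_measure, smul_eq_mul]

end
end Slices

/-! ### The local Gauss-Green estimate -/

section LocalEstimate

variable {H : Type*} [NormedAddCommGroup H] [InnerProductSpace ℝ H]

/-- A linear functional that is almost maximal at the unit vector `n` and dominated by `h` times
the norm near `n` is close to `h` times the inner product with `n`. -/
theorem abs_sub_inner_mul_le {ℓ : H →ₗ[ℝ] ℝ} {n : H} (hn : ‖n‖ = 1) {h θ : ℝ} (hh : 0 ≤ h)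
    (hθ : 0 < θ) (hθ1 : θ ≤ 1) (hcone : ∀ u, ‖u‖ / 2 ≤ inner ℝ n u → ℓ u ≤ ‖u‖ * h)
    (hlow : (1 - θ ^ 2) * h ≤ ℓ n) (u : H) :
    |ℓ u - inner ℝ n u * h| ≤ 3 * θ * ‖u‖ * h := by
  have hnn : inner ℝ n n = (1 : ℝ) := by rw [real_inner_self_eq_norm_sq, hn, one_pow]
  -- The cone bound is tested at `n + θ • w` with `w` tangential: its norm exceeds 1 by at most `θ ^
  -- 2 / 2`, and `ℓ n` falls short of `h` by at most `θ ^ 2 * h`. Dividing by `θ` leaves `3 / 2 * θ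
  -- * h`.
  have htan : ∀ w : H, inner ℝ n w = (0 : ℝ) → ‖w‖ ≤ 1 → ℓ w ≤ 3 / 2 * θ * h := by
    intro w hw hw1
    have hsq : ‖n + θ • w‖ ^ 2 ≤ (1 + θ ^ 2 / 2) ^ 2 := by
      rw [norm_add_sq_real, inner_smul_right, hw, hn, norm_smul, Real.norm_of_nonneg hθ.le]
      have : (θ * ‖w‖) ^ 2 ≤ θ ^ 2 := by
        rw [mul_pow]
        exact mul_le_of_le_one_right (by positivity) (pow_le_one₀ (norm_nonneg _) hw1)
      nlinarith [sq_nonneg (θ ^ 2)]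
    have hnorm : ‖n + θ • w‖ ≤ 1 + θ ^ 2 / 2 := le_of_sq_le_sq hsq (by positivity)
    have hc := hcone (n + θ • w) (by
      rw [inner_add_right, inner_smul_right, hw, hnn]
      nlinarith)
    rw [map_add, map_smul, smul_eq_mul] at hc
    have h1 : ‖n + θ • w‖ * h ≤ (1 + θ ^ 2 / 2) * h := mul_le_mul_of_nonneg_right hnorm hh
    have h2 : θ * ℓ w ≤ θ * (3 / 2 * θ * h) := by nlinarith
    exact le_of_mul_le_mul_left h2 hθ
  have hunit : ∀ u : H, ‖u‖ = 1 → |ℓ u - inner ℝ n u * h| ≤ 3 * θ * h := by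
    intro u hu
    set a : ℝ := inner ℝ n u
    set w := u - a • n with hw
    have hwn : inner ℝ n w = (0 : ℝ) := by
      rw [hw, inner_sub_right, inner_smul_right, hnn, mul_one, sub_self]
    have ha : |a| ≤ 1 := by
      have := abs_real_inner_le_norm n u
      rwa [hn, hu, one_mul] at this
    have hw1 : ‖w‖ ≤ 1 := by
      have h1 : ‖u‖ ^ 2 = a ^ 2 + ‖w‖ ^ 2 := by
        have : u = a • n + w := by rw [hw]; abel
        rw [this, norm_add_sq_real, inner_smul_left, hwn, norm_smul, hn]
        simp
      rw [hu] at h1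
      nlinarith [sq_nonneg a, norm_nonneg w]
    have h1 := htan w hwn hw1
    have h2 := htan (-w) (by rw [inner_neg_right, hwn, neg_zero]) (by rwa [norm_neg])
    rw [map_neg] at h2
    have h3 := hcone n (by rw [hn, hnn]; norm_num)
    rw [hn, one_mul] at h3
    have hu' : ℓ u - a * h = a * (ℓ n - h) + ℓ w := by
      have : u = a • n + w := by rw [hw]; abel
      rw [this, map_add, map_smul, smul_eq_mul]
      ring
    rw [hu']
    have h4 : |a * (ℓ n - h)| ≤ θ ^ 2 * h := by
      rw [abs_mul]
      have : |ℓ n - h| ≤ θ ^ 2 * h := abs_le.2 ⟨by nlinarith, by nlinarith⟩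
      nlinarith [abs_nonneg a, abs_nonneg (ℓ n - h)]
    have h5 : |ℓ w| ≤ 3 / 2 * θ * h := abs_le.2 ⟨by linarith, h1⟩
    have h6 : θ ^ 2 * h ≤ θ * h := by
      have : θ ^ 2 ≤ θ := by nlinarith
      exact mul_le_mul_of_nonneg_right this hh
    have : 0 ≤ θ * h := by positivity
    calc _ ≤ |a * (ℓ n - h)| + |ℓ w| := abs_add_le _ _
      _ ≤ _ := by linarith
  by_cases hu : u = 0
  · simp [hu]
  have hpos : 0 < ‖u‖ := norm_pos_iff.2 hu
  have := hunit (‖u‖⁻¹ • u) (by rw [norm_smul, norm_inv, norm_norm, inv_mul_cancel₀ hpos.ne'])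
  rw [map_smul, inner_smul_right, smul_eq_mul, mul_assoc, ← mul_sub, abs_mul,
    abs_of_pos (inv_pos.2 hpos), inv_mul_le_iff₀ hpos] at this
  linarith

variable [FiniteDimensional ℝ H] [MeasurableSpace H] [BorelSpace H]

/-- This is `abs_sub_inner_mul_le` for the functional sending `u` to the integral of `∂φ/∂u` over
`U`. The cone bound is the contraction of area by projections. For the bound at `n`, flatness makes
the projection along `n` invertible on the level set with Lipschitz constant `(1 - δ)⁻¹`, and
Bernoulli's inequality with `d * δ ≤ θ ^ 2` bounds `(1 - δ) ^ d` below. -/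
theorem abs_setIntegral_fderiv_sub_le {d : ℕ} (hd : Module.finrank ℝ H = d + 1) {U W : Set H}
    (hU : IsOpen U) (hW : Convex ℝ W) {ψ : H → ℝ} (hψ : ContinuousOn ψ W)
    (hUW : ∀ z ∈ W, z ∈ U ↔ ψ z < 0) (hS : MeasurableSet {z ∈ W | ψ z = 0})
    (hfin : μHE[d] {z ∈ W | ψ z = 0} ≠ ⊤) {n : H} (hn : ‖n‖ = 1) {δ θ : ℝ}
    (hδ4 : δ ≤ 1 / 4) (hθ : 0 < θ) (hθ1 : θ ≤ 1) (hδθ : d * δ ≤ θ ^ 2)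
    (hflat : ∀ z ∈ W, ∀ z' ∈ W, |ψ z - ψ z' - inner ℝ n (z - z')| ≤ δ * ‖z - z'‖)
    {φ : H → ℝ} (hφ : ContDiff ℝ 1 φ) (hc : HasCompactSupport φ) (hφW : tsupport φ ⊆ W)
    (hφ0 : ∀ x, 0 ≤ φ x) (u : H) :
    |(∫ x in U, fderiv ℝ φ x u) - inner ℝ n u * ∫ x in {z ∈ W | ψ z = 0}, φ x ∂μHE[d]| ≤
      3 * θ * ‖u‖ * ∫ x in {z ∈ W | ψ z = 0}, φ x ∂μHE[d] := by
  set S := {z ∈ W | ψ z = 0}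
  have hfinS : IsFiniteMeasure ((μHE[d] : Measure H).restrict S) :=
    ⟨by simpa using hfin.lt_top⟩
  set h := ∫ x in S, φ x ∂μHE[d]
  have hφi : Integrable φ ((μHE[d] : Measure H).restrict S) := by
    obtain ⟨C, hC⟩ := hc.exists_bound_of_continuous hφ.continuous
    exact Integrable.of_bound hφ.continuous.aestronglyMeasurable C (Eventually.of_forall hC)
  have hh : 0 ≤ h := integral_nonneg hφ0
  have hlint : ∫⁻ x in S, ENNReal.ofReal (φ x) ∂μHE[d] = ENNReal.ofReal h :=
    (ofReal_integral_eq_lintegral_ofReal hφi (Eventually.of_forall hφ0)).symm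
  -- The slope of `ψ` along `v` is at least `1 / 2 - δ`, positive because `δ ≤ 1 / 4`.
  have hmono : ∀ v : H, ‖v‖ = 1 → 1 / 2 ≤ (inner ℝ n v : ℝ) →
      ∀ z ∈ W, ∀ t : ℝ, 0 < t → z + t • v ∈ W → ψ z < ψ (z + t • v) := by
    intro v hv hnv z hz t ht hzt
    have := hflat _ hzt z hz
    rw [add_sub_cancel_left, norm_smul, hv, mul_one, Real.norm_of_nonneg ht.le,
      inner_smul_right] at this
    have := (abs_le.1 this).1
    nlinarith
  let ℓ : H →ₗ[ℝ] ℝ :=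
    { toFun := fun u => ∫ x in U, fderiv ℝ φ x u
      map_add' := fun a b => by
        simp only [map_add]
        exact integral_add (integrable_fderiv_apply hφ hc a).integrableOn
          (integrable_fderiv_apply hφ hc b).integrableOn
      map_smul' := fun c a => by
        simp only [map_smul, RingHom.id_apply]
        exact integral_smul c _ }
  refine abs_sub_inner_mul_le (ℓ := ℓ) hn hh hθ hθ1 ?_ ?_ u
  · have hunit : ∀ v : H, ‖v‖ = 1 → 1 / 2 ≤ (inner ℝ n v : ℝ) → ℓ v ≤ h := by
      intro v hv hnv
      have := ofReal_setIntegral_fderiv_le hd hv hU hW hψ (hmono v hv hnv) hUW hφ hc hφW hφ0 hS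
      rw [hlint, ENNReal.ofReal_le_ofReal_iff hh] at this
      exact this
    intro u hu
    by_cases hu0 : u = 0
    · simp [hu0]
    have hpos : 0 < ‖u‖ := norm_pos_iff.2 hu0
    have := hunit (‖u‖⁻¹ • u)
      (by rw [norm_smul, norm_inv, norm_norm, inv_mul_cancel₀ hpos.ne']) (by
        rw [inner_smul_right, ← div_eq_inv_mul, le_div_iff₀ hpos]
        linarith)
    rwa [map_smul, smul_eq_mul, inv_mul_le_iff₀ hpos] at this
  · have hnn : (1 : ℝ) / 2 ≤ inner ℝ n n := by
      rw [real_inner_self_eq_norm_sq, hn]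
      norm_num
    have hδ1 : 0 < 1 - δ := by linarith
    have hnonneg : 0 ≤ ∫ x in U, fderiv ℝ φ x n :=
      setIntegral_fderiv_nonneg hn hU hW hψ (hmono n hn hnn) hUW hφ hc hφW hφ0
    have key := lintegral_le_ofReal_setIntegral_fderiv hd hn hU hW hψ (hmono n hn hnn) hUW hφ hc
      hφW hφ0 hS (K := Real.toNNReal (1 - δ)⁻¹) (by
        intro x hx y hy
        rw [Real.coe_toNNReal _ (inv_nonneg.2 hδ1.le), inv_mul_eq_div, le_div_iff₀ hδ1,
          dist_eq_norm, dist_eq_norm, ← map_sub]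
        have h1 := hflat x hx.1 y hy.1
        rw [hx.2, hy.2, sub_zero, zero_sub, abs_neg] at h1
        have h2 : ‖x - y‖ ≤ ‖(ℝ ∙ n)ᗮ.orthogonalProjectionOnto (x - y)‖ +
            |inner ℝ n (x - y)| := by
          conv_lhs => rw [← orthogonalProjectionOnto_add_inner_smul hn (x - y)]
          refine (norm_add_le _ _).trans ?_
          rw [norm_smul, hn, mul_one, Real.norm_eq_abs]
          rfl
        linarith)
    rw [hlint, ← ENNReal.ofReal, ← ENNReal.ofReal_pow (inv_nonneg.2 hδ1.le),
      ← ENNReal.ofReal_mul (pow_nonneg (inv_nonneg.2 hδ1.le) d), ENNReal.ofReal_le_ofReal_iff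
        (mul_nonneg (pow_nonneg (inv_nonneg.2 hδ1.le) d) hnonneg), inv_pow, inv_mul_eq_div,
      le_div_iff₀ (pow_pos hδ1 d)] at key
    have hb : 1 - θ ^ 2 ≤ (1 - δ) ^ d := by
      have := one_add_mul_le_pow (a := -δ) (by linarith) d
      rw [← sub_eq_add_neg] at this
      linarith
    calc (1 - θ ^ 2) * h ≤ (1 - δ) ^ d * h := mul_le_mul_of_nonneg_right hb hh
      _ = h * (1 - δ) ^ d := mul_comm _ _
      _ ≤ ℓ n := key

end LocalEstimate

/-! ### Regular boundary points and the outward normal -/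

section Regular

variable {U : Set ℍ[ℝ]}

theorem hasDerivAt_comp_line {χ : ℍ[ℝ] → ℝ} {z m : ℍ[ℝ]} (h : HasGradientAt χ m z) (u : ℍ[ℝ]) :
    HasDerivAt (fun t : ℝ => χ (z + t • u)) (inner ℝ m u) 0 := by
  have h1 : HasDerivAt (fun t : ℝ => z + t • u) u 0 := by
    simpa using ((hasDerivAt_id (0 : ℝ)).smul_const u).const_add z
  have h2 : HasFDerivAt χ (InnerProductSpace.toDual ℝ ℍ[ℝ] m) (z + (0 : ℝ) • u) := by
    simpa using h.hasFDerivAt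
  have h3 := h2.comp_hasDerivAt (0 : ℝ) h1
  rw [InnerProductSpace.toDual_apply_apply] at h3
  exact h3

/-- `ψ` is a defining function of `U` on `W` whose increments agree with those of the linear
function with gradient `n`, up to the factor `δ`. -/
structure IsFlatChart (U W : Set ℍ[ℝ]) (ψ : ℍ[ℝ] → ℝ) (n : ℍ[ℝ]) (δ : ℝ) : Prop where
  isOpen : IsOpen W
  contDiffOn : ContDiffOn ℝ 1 ψ W
  mem_iff : ∀ z ∈ W, z ∈ U ↔ ψ z < 0
  flat : ∀ z ∈ W, ∀ z' ∈ W, |ψ z - ψ z' - inner ℝ n (z - z')| ≤ δ * ‖z - z'‖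

/-- A `C¹` function is strictly differentiable, which controls increments between any two points of
a small ball and not only those from the centre. -/
theorem IsOutwardUnitNormal.exists_isFlatChart {y n : ℍ[ℝ]} (h : IsOutwardUnitNormal U y n)
    {δ : ℝ} (hδ : 0 < δ) :
    ∃ r > 0, ∃ ψ : ℍ[ℝ] → ℝ, ψ y = 0 ∧ IsFlatChart U (Metric.ball y r) ψ n δ := by
  obtain ⟨-, V, ψ, hV, hyV, hψ, hψy, hUV, hgrad⟩ := h
  have hstrict : HasStrictFDerivAt ψ (InnerProductSpace.toDual ℝ ℍ[ℝ] n) y := by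
    have h1 := (hψ.contDiffAt (hV.mem_nhds hyV)).hasStrictFDerivAt one_ne_zero
    rwa [hgrad.hasFDerivAt.fderiv] at h1
  have h2 := hstrict.isLittleO.def hδ
  rw [nhds_prod_eq] at h2
  obtain ⟨s, hs, hs'⟩ := (Filter.eventually_prod_self_iff (r := fun a b =>
    ‖ψ a - ψ b - InnerProductSpace.toDual ℝ ℍ[ℝ] n (a - b)‖ ≤ δ * ‖a - b‖)).1 h2
  obtain ⟨r, hr, hrs⟩ := Metric.mem_nhds_iff.1 (Filter.inter_mem hs (hV.mem_nhds hyV))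
  refine ⟨r, hr, ψ, hψy, Metric.isOpen_ball, hψ.mono fun z hz => (hrs hz).2, fun z hz => ?_,
    fun z hz z' hz' => ?_⟩
  · have hzV := (hrs hz).2
    constructor
    · intro hzU
      have : z ∈ U ∩ V := ⟨hzU, hzV⟩
      rw [hUV] at this
      exact this.2
    · intro h0
      have : z ∈ {y ∈ V | ψ y < 0} := ⟨hzV, h0⟩
      rw [← hUV] at this
      exact this.1
  · have := hs' z (hrs hz).1 z' (hrs hz').1
    simpa [Real.norm_eq_abs] using this

variable {W : Set ℍ[ℝ]} {ψ : ℍ[ℝ] → ℝ} {n : ℍ[ℝ]} {δ : ℝ}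

/-- Flatness forces `ψ` to decrease in such a direction from every point of the level set. It is
used for `-n`, to reach the closure of `U`, and for the difference of two candidate normals. -/
theorem IsFlatChart.eventually_mem {z u : ℍ[ℝ]} (h : IsFlatChart U W ψ n δ) (hz : z ∈ W)
    (h0 : ψ z = 0) (hu : inner ℝ n u < -(δ * ‖u‖)) : ∀ᶠ t : ℝ in 𝓝[>] 0, z + t • u ∈ U := by
  have hc : Tendsto (fun t : ℝ => z + t • u) (𝓝[>] 0) (𝓝 z) := by
    have : Continuous fun t : ℝ => z + t • u := by fun_prop
    simpa using (this.tendsto 0).mono_left nhdsWithin_le_nhds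
  filter_upwards [hc.eventually (h.isOpen.mem_nhds hz), self_mem_nhdsWithin] with t ht ht0
  rw [h.mem_iff _ ht]
  have h1 := (abs_le.1 (h.flat _ ht z hz)).2
  rw [h0, add_sub_cancel_left, norm_smul, Real.norm_of_nonneg (le_of_lt ht0),
    inner_smul_right] at h1
  have : 0 < t := ht0
  nlinarith

theorem IsFlatChart.frontier_inter (h : IsFlatChart U W ψ n δ) (hU : IsOpen U) (hn : ‖n‖ = 1)
    (hδ : δ < 1) : frontier U ∩ W = {z ∈ W | ψ z = 0} := by
  ext z
  constructor
  · rintro ⟨hz, hzW⟩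
    refine ⟨hzW, le_antisymm ?_ ?_⟩
    · by_contra! hpos
      have hev : ∀ᶠ x in 𝓝 z, x ∈ W ∧ 0 < ψ x :=
        Filter.Eventually.and (h.isOpen.mem_nhds hzW)
          ((h.contDiffOn.continuousOn.continuousAt (h.isOpen.mem_nhds hzW)).eventually
            (lt_mem_nhds hpos))
      obtain ⟨x, hxU, hxW, hx⟩ := ((mem_closure_iff_frequently.1 hz.1).and_eventually hev).exists
      exact lt_asymm hx ((h.mem_iff x hxW).1 hxU)
    · by_contra! hneg
      have := hz.2
      rw [hU.interior_eq] at this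
      exact this ((h.mem_iff z hzW).2 hneg)
  · rintro ⟨hzW, h0⟩
    refine ⟨⟨?_, ?_⟩, hzW⟩
    · have hu : inner ℝ n (-n) < -(δ * ‖-n‖) := by
        rw [inner_neg_right, real_inner_self_eq_norm_sq, norm_neg, hn]
        linarith
      have hev := h.eventually_mem hzW h0 hu
      have hc : Tendsto (fun t : ℝ => z + t • (-n)) (𝓝[>] 0) (𝓝 z) := by
        have : Continuous fun t : ℝ => z + t • (-n) := by fun_prop
        simpa using (this.tendsto 0).mono_left nhdsWithin_le_nhds
      exact mem_closure_of_tendsto hc hev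
    · rw [hU.interior_eq, h.mem_iff z hzW, h0]
      exact lt_irrefl 0

/-- If the two normals were further apart, the direction `n' - n` would enter `U` according to the
chart, its inner product with `n` being `-‖n' - n‖ ^ 2 / 2`, yet leave `U` according to the defining
function with gradient `n'`. Uniqueness and continuity of the normal both follow. -/
theorem IsFlatChart.norm_sub_le {z n' : ℍ[ℝ]} (h : IsFlatChart U W ψ n δ) (hn : ‖n‖ = 1)
    (hδ : 0 ≤ δ) (hz : z ∈ W) (h0 : ψ z = 0) (hn' : IsOutwardUnitNormal U z n') : ‖n' - n‖ ≤ 2 * δ := by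
  by_contra! hlt
  obtain ⟨h1', V, χ, hV, hzV, -, hχz, hUV, hgrad⟩ := hn'
  have hsq : ‖n' - n‖ ^ 2 = 2 - 2 * inner ℝ n n' := by
    rw [norm_sub_sq_real, h1', hn, real_inner_comm]
    ring
  have hne : 0 < ‖n' - n‖ := by linarith
  have hu : inner ℝ n (n' - n) < -(δ * ‖n' - n‖) := by
    rw [inner_sub_right, real_inner_self_eq_norm_sq, hn]
    nlinarith
  have hev := h.eventually_mem hz h0 hu
  have hd : HasDerivAt (fun t : ℝ => χ (z + t • (n' - n))) (inner ℝ n' (n' - n)) 0 :=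
    hasDerivAt_comp_line hgrad _
  have hdpos : 0 < (inner ℝ n' (n' - n) : ℝ) := by
    rw [inner_sub_right, real_inner_self_eq_norm_sq, h1', real_inner_comm]
    nlinarith
  have hev2 : ∀ᶠ t : ℝ in 𝓝[>] 0, z + t • (n' - n) ∈ V := by
    have : Continuous fun t : ℝ => z + t • (n' - n) := by fun_prop
    have hc : Tendsto (fun t : ℝ => z + t • (n' - n)) (𝓝[>] 0) (𝓝 z) := by
      simpa using (this.tendsto 0).mono_left nhdsWithin_le_nhds
    exact hc.eventually (hV.mem_nhds hzV)
  have hev3 := hd.hasDerivWithinAt (s := Ioi 0)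
  rw [hasDerivWithinAt_iff_tendsto_slope' (by simp)] at hev3
  obtain ⟨t, ⟨⟨htU, htV⟩, htpos⟩, ht0⟩ := (((hev.and hev2).and
    (hev3.eventually (lt_mem_nhds hdpos))).and self_mem_nhdsWithin).exists
  have htneg : χ (z + t • (n' - n)) < 0 := by
    have : z + t • (n' - n) ∈ U ∩ V := ⟨htU, htV⟩
    rw [hUV] at this
    exact this.2
  rw [slope_def_field] at htpos
  simp only [zero_smul, add_zero, hχz, sub_zero] at htpos
  have ht0' : 0 < t := ht0
  have := (div_pos_iff_of_pos_right ht0').1 htpos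
  linarith

/-- The slope of `ψ` along `n` is at least `1 - δ > 0`, so its gradient does not vanish and `ψ` can
be rescaled to unit gradient. -/
theorem IsFlatChart.isRegularBoundaryPoint {z : ℍ[ℝ]} (h : IsFlatChart U W ψ n δ) (hn : ‖n‖ = 1)
    (hδ : δ < 1) (hz : z ∈ W) (h0 : ψ z = 0) : IsRegularBoundaryPoint U z := by
  have hdiff : DifferentiableAt ℝ ψ z :=
    ((h.contDiffOn.contDiffAt (h.isOpen.mem_nhds hz)).differentiableAt one_ne_zero)
  set m := gradient ψ z with hm
  have hgrad : HasGradientAt ψ m z := hdiff.hasGradientAt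
  have hm0 : m ≠ 0 := by
    intro hm0
    rw [hm0] at hgrad
    have hd : HasDerivAt (fun t : ℝ => ψ (z + t • n)) 0 0 := by
      simpa using hasDerivAt_comp_line hgrad n
    have hs := hd.hasDerivWithinAt (s := Ioi 0)
    rw [hasDerivWithinAt_iff_tendsto_slope' (by simp)] at hs
    have hev2 : ∀ᶠ t : ℝ in 𝓝[>] 0, z + t • n ∈ W := by
      have : Continuous fun t : ℝ => z + t • n := by fun_prop
      have hc : Tendsto (fun t : ℝ => z + t • n) (𝓝[>] 0) (𝓝 z) := by
        simpa using (this.tendsto 0).mono_left nhdsWithin_le_nhds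
      exact hc.eventually (h.isOpen.mem_nhds hz)
    obtain ⟨t, ⟨htW, htlt⟩, ht0⟩ := ((hev2.and
      (hs.eventually (gt_mem_nhds (sub_pos.2 hδ)))).and self_mem_nhdsWithin).exists
    have ht0' : 0 < t := ht0
    rw [slope_def_field] at htlt
    simp only [zero_smul, add_zero, h0, sub_zero] at htlt
    rw [div_lt_iff₀ ht0'] at htlt
    have h3 := (abs_le.1 (h.flat _ htW z hz)).1
    rw [add_sub_cancel_left, norm_smul, hn, mul_one, Real.norm_of_nonneg ht0'.le,
      inner_smul_right, real_inner_self_eq_norm_sq, hn, h0] at h3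
    nlinarith
  have hpos : 0 < ‖m‖ := norm_pos_iff.2 hm0
  refine ⟨‖m‖⁻¹ • m, ?_, W, fun x => ‖m‖⁻¹ * ψ x, h.isOpen, hz, ?_, by simp [h0], ?_, ?_⟩
  · rw [norm_smul, norm_inv, norm_norm, inv_mul_cancel₀ hpos.ne']
  · exact contDiffOn_const.mul h.contDiffOn
  · ext x
    constructor
    · rintro ⟨hxU, hxW⟩
      exact ⟨hxW, mul_neg_of_pos_of_neg (inv_pos.2 hpos) ((h.mem_iff x hxW).1 hxU)⟩
    · rintro ⟨hxW, hx⟩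
      refine ⟨(h.mem_iff x hxW).2 ?_, hxW⟩
      exact neg_of_mul_neg_right hx (inv_nonneg.2 hpos.le)
  · rw [hasGradientAt_iff_hasFDerivAt, map_smul]
    exact hgrad.hasFDerivAt.const_mul _

theorem outwardNormal_spec {x : ℍ[ℝ]} (h : IsRegularBoundaryPoint U x) :
    IsOutwardUnitNormal U x (outwardNormal U x) := by
  rw [outwardNormal, dif_pos h]
  exact h.choose_spec

theorem norm_outwardNormal_le (x : ℍ[ℝ]) : ‖outwardNormal U x‖ ≤ 1 := by
  by_cases h : IsRegularBoundaryPoint U x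
  · exact (outwardNormal_spec h).1.le
  · simp [outwardNormal, dif_neg h]

/-- The singular part of the boundary. -/
def singularSet (U : Set ℍ[ℝ]) : Set ℍ[ℝ] := {x ∈ frontier U | ¬ IsRegularBoundaryPoint U x}

/-- A flat chart around a regular point contains only regular boundary points, so the regular part
is relatively open in the closed frontier. -/
theorem isClosed_singularSet (hU : IsOpen U) : IsClosed (singularSet U) := by
  have : singularSet U = frontier U ∩ {x | x ∈ frontier U → IsRegularBoundaryPoint U x}ᶜ := by
    ext x
    simp only [singularSet, mem_inter_iff, mem_compl_iff, mem_ofPred_eq]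
    tauto
  rw [this]
  refine isClosed_frontier.inter (isClosed_compl_iff.2 (isOpen_iff_mem_nhds.2 fun x hx => ?_))
  by_cases hxf : x ∈ frontier U
  · have hspec := outwardNormal_spec (hx hxf)
    obtain ⟨r, hr, ψ, -, hch⟩ := hspec.exists_isFlatChart (δ := 1 / 2) (by norm_num)
    filter_upwards [Metric.ball_mem_nhds x hr] with z hz hzf
    have : z ∈ {z ∈ Metric.ball x r | ψ z = 0} := by
      rw [← hch.frontier_inter hU hspec.1 (by norm_num)]
      exact ⟨hzf, hz⟩
    exact hch.isRegularBoundaryPoint hspec.1 (by norm_num) hz this.2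
  · filter_upwards [isClosed_frontier.isOpen_compl.mem_nhds hxf] with z hz hzf
    exact absurd hzf hz

/-- The normal is defined by choice, so its measurability has to come from geometry:
`IsFlatChart.norm_sub_le` pins down every admissible choice in a chart up to `2 * δ`. -/
theorem continuousOn_outwardNormal (hU : IsOpen U) :
    ContinuousOn (outwardNormal U) (frontier U \ singularSet U) := by
  intro y hy
  have hreg : IsRegularBoundaryPoint U y := by
    by_contra h
    exact hy.2 ⟨hy.1, h⟩
  have hspec := outwardNormal_spec hreg
  refine Metric.continuousWithinAt_iff'.2 fun ε hε => ?_
  obtain ⟨r, hr, ψ, -, hch⟩ := hspec.exists_isFlatChart (δ := min (ε / 4) (1 / 2))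
    (by positivity)
  have hδ1 : min (ε / 4) (1 / 2) < 1 := (min_le_right _ _).trans_lt (by norm_num)
  filter_upwards [mem_nhdsWithin_of_mem_nhds (Metric.ball_mem_nhds y hr), self_mem_nhdsWithin]
    with z hz hzf
  have hz0 : z ∈ {z ∈ Metric.ball y r | ψ z = 0} := by
    rw [← hch.frontier_inter hU hspec.1 hδ1]
    exact ⟨hzf.1, hz⟩
  have hzreg : IsRegularBoundaryPoint U z := by
    by_contra h
    exact hzf.2 ⟨hzf.1, h⟩
  have := hch.norm_sub_le hspec.1 (by positivity) hz hz0.2 (outwardNormal_spec hzreg)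
  rw [dist_eq_norm]
  have := min_le_left (ε / 4) (1 / 2)
  linarith

theorem surfaceMeasure_singularSet (hU : HasPiecewiseC1Boundary U) :
    surfaceMeasure U (singularSet U) = 0 :=
  le_antisymm ((Measure.restrict_apply_le _ _).trans hU.2.le) bot_le

theorem isFiniteMeasure_surfaceMeasure (hU : HasPiecewiseC1Boundary U) :
    IsFiniteMeasure (surfaceMeasure U) :=
  ⟨by simpa [surfaceMeasure] using hU.1⟩

theorem ae_mem_frontier : ∀ᵐ x ∂surfaceMeasure U, x ∈ frontier U :=
  ae_restrict_mem isClosed_frontier.measurableSet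

theorem ae_isRegularBoundaryPoint (hU : HasPiecewiseC1Boundary U) :
    ∀ᵐ x ∂surfaceMeasure U, IsRegularBoundaryPoint U x := by
  have h : ∀ᵐ x ∂surfaceMeasure U, x ∉ singularSet U :=
    measure_eq_zero_iff_ae_notMem.1 (surfaceMeasure_singularSet hU)
  filter_upwards [h, ae_mem_frontier] with x hx hxf
  by_contra h'
  exact hx ⟨hxf, h'⟩

theorem aestronglyMeasurable_outwardNormal (hUo : IsOpen U) (hU : HasPiecewiseC1Boundary U) :
    AEStronglyMeasurable (outwardNormal U) (surfaceMeasure U) := by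
  have hm : MeasurableSet (frontier U \ singularSet U) :=
    isClosed_frontier.measurableSet.diff (isClosed_singularSet hUo).measurableSet
  have h1 : AEStronglyMeasurable (outwardNormal U)
      ((surfaceMeasure U).restrict (frontier U \ singularSet U)) :=
    (continuousOn_outwardNormal hUo).aestronglyMeasurable hm
  have h2 : (surfaceMeasure U).restrict (frontier U \ singularSet U) = surfaceMeasure U := by
    refine Measure.restrict_eq_self_of_ae_mem ?_
    have h : ∀ᵐ x ∂surfaceMeasure U, x ∉ singularSet U :=
      measure_eq_zero_iff_ae_notMem.1 (surfaceMeasure_singularSet hU)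
    filter_upwards [h, ae_mem_frontier] with x hx hxf using ⟨hxf, hx⟩
  rwa [h2] at h1

end Regular

/-! ### The Gauss-Green formula away from the singular set -/

open scoped Manifold

theorem exists_contDiff_one_nhds {K O : Set ℍ[ℝ]} (hK : IsCompact K) (hO : IsOpen O)
    (hKO : K ⊆ O) :
    ∃ χ : ℍ[ℝ] → ℝ, ContDiff ℝ 1 χ ∧ HasCompactSupport χ ∧ tsupport χ ⊆ O ∧
      (∀ x, χ x ∈ Icc (0 : ℝ) 1) ∧ ∀ᶠ x in 𝓝ˢ K, χ x = 1 := by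
  obtain ⟨L, hL, hKL, hLO⟩ := exists_compact_between hK hO hKO
  obtain ⟨χ, h1, h0, h01⟩ := exists_contMDiffMap_one_nhds_of_subset_interior 𝓘(ℝ, ℍ[ℝ])
    hK.isClosed hKL
  have hts : tsupport χ ⊆ L := by
    refine closure_minimal (fun x hx => ?_) hL.isClosed
    by_contra h
    exact hx (h0 x h)
  exact ⟨χ, χ.contMDiff.contDiff, hL.of_isClosed_subset (isClosed_tsupport _) hts,
    hts.trans hLO, h01, h1⟩

section GaussGreen

variable {U : Set ℍ[ℝ]}

/-- The difference of the two sides in the Gauss-Green formula for `φ` in the direction `u`. -/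
noncomputable def gaussGreenDefect {E : Type*} [NormedAddCommGroup E] [NormedSpace ℝ E]
    (U : Set ℍ[ℝ]) (φ : ℍ[ℝ] → E) (u : ℍ[ℝ]) : E :=
  (∫ x in U, fderiv ℝ φ x u) -
    ∫ x, (inner ℝ (outwardNormal U x) u : ℝ) • φ x ∂surfaceMeasure U

theorem integrable_surfaceMeasure_of_continuousOn {E : Type*} [NormedAddCommGroup E]
    (hUb : Bornology.IsBounded U) (hU : HasPiecewiseC1Boundary U) {φ : ℍ[ℝ] → E}
    (hφ : ContinuousOn φ (frontier U)) : Integrable φ (surfaceMeasure U) := by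
  have hc : IsCompact (frontier U) :=
    Metric.isCompact_of_isClosed_isBounded isClosed_frontier (hUb.closure.subset sdiff_subset)
  have := hφ.integrableOn_of_subset_isCompact hc isClosed_frontier.measurableSet subset_rfl
    (μ := μHE[3]) hU.1.ne
  exact this

theorem integrable_inner_outwardNormal_smul {E : Type*} [NormedAddCommGroup E] [NormedSpace ℝ E]
    (hUo : IsOpen U) (hU : HasPiecewiseC1Boundary U) {φ : ℍ[ℝ] → E}
    (hφ : Integrable φ (surfaceMeasure U)) (u : ℍ[ℝ]) :
    Integrable (fun x => (inner ℝ (outwardNormal U x) u : ℝ) • φ x) (surfaceMeasure U) := by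
  refine Integrable.bdd_smul hφ ‖u‖ ?_ (Eventually.of_forall fun x => ?_)
  · exact (aestronglyMeasurable_outwardNormal hUo hU).inner aestronglyMeasurable_const
  · refine (norm_inner_le_norm _ _).trans ?_
    exact mul_le_of_le_one_left (norm_nonneg _) (norm_outwardNormal_le x)

theorem gaussGreenDefect_sum (hUo : IsOpen U) (hUb : Bornology.IsBounded U)
    (hU : HasPiecewiseC1Boundary U) {ι : Type*} (s : Finset ι) (φ : ι → ℍ[ℝ] → ℝ)
    (hφ : ∀ i ∈ s, ContDiff ℝ 1 (φ i)) (hc : ∀ i ∈ s, HasCompactSupport (φ i)) (u : ℍ[ℝ]) :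
    gaussGreenDefect U (fun x => ∑ i ∈ s, φ i x) u = ∑ i ∈ s, gaussGreenDefect U (φ i) u := by
  have h1 : ∀ x, fderiv ℝ (fun x => ∑ i ∈ s, φ i x) x u = ∑ i ∈ s, fderiv ℝ (φ i) x u := by
    intro x
    rw [fderiv_fun_sum fun i hi => (hφ i hi).differentiable one_ne_zero x]
    simp
  simp only [gaussGreenDefect, h1, Finset.smul_sum]
  rw [integral_finsetSum _ fun i hi => (integrable_fderiv_apply (hφ i hi) (hc i hi) u).integrableOn,
    integral_finsetSum _ fun i hi => integrable_inner_outwardNormal_smul hUo hU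
      (integrable_surfaceMeasure_of_continuousOn hUb hU (hφ i hi).continuous.continuousOn) u,
    Finset.sum_sub_distrib]

theorem integral_fderiv_eq_zero {φ : ℍ[ℝ] → ℝ} (hφ : ContDiff ℝ 1 φ) (hc : HasCompactSupport φ)
    (u : ℍ[ℝ]) : ∫ x, fderiv ℝ φ x u = 0 := by
  have h := integral_smul_fderiv_eq_neg_fderiv_smul_of_integrable (μ := volume)
    (f := fun _ : ℍ[ℝ] => (1 : ℝ)) (g := φ) (v := u) (by simp)
    (by simpa using integrable_fderiv_apply hφ hc u)
    (by simpa using hφ.continuous.integrable_of_hasCompactSupport hc)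
    (fun x _ => differentiableAt_const _) (fun x _ => hφ.differentiable one_ne_zero x)
  simpa using h

/-- The bound is proportional to the boundary integral of `φ`, which is additive, so summing it over
a partition of unity costs nothing, however many pieces there are. Off the frontier both terms of
the defect vanish for `φ` supported near `y`. -/
theorem exists_abs_gaussGreenDefect_le (hUo : IsOpen U) (hUb : Bornology.IsBounded U)
    (hU : HasPiecewiseC1Boundary U) {y : ℍ[ℝ]} (hy : y ∉ singularSet U) {ε : ℝ} (hε : 0 < ε) :
    ∃ W : Set ℍ[ℝ], IsOpen W ∧ y ∈ W ∧ ∀ φ : ℍ[ℝ] → ℝ, ContDiff ℝ 1 φ → HasCompactSupport φ →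
      tsupport φ ⊆ W → (∀ x, 0 ≤ φ x) → ∀ u : ℍ[ℝ],
      |gaussGreenDefect U φ u| ≤ ε * ‖u‖ * ∫ x, φ x ∂surfaceMeasure U := by
  by_cases hyf : y ∈ frontier U
  · have hreg : IsRegularBoundaryPoint U y := by
      by_contra h
      exact hy ⟨hyf, h⟩
    have hspec := outwardNormal_spec hreg
    set n := outwardNormal U y
    -- With `δ = θ ^ 2 / 4` the local estimate applies in dimension `d = 3` and costs `3 * θ`;
    -- replacing the normal at `y` by the normal at `x` costs `2 * δ`. The sum is at most `5 * θ ≤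
    -- ε`.
    set θ : ℝ := min (ε / 5) 1 with hθdef
    have hθ : 0 < θ := lt_min (by positivity) one_pos
    have hθ1 : θ ≤ 1 := min_le_right _ _
    have hθε : θ ≤ ε / 5 := min_le_left _ _
    set δ : ℝ := θ ^ 2 / 4 with hδdef
    have hδ : 0 < δ := by positivity
    have hδ4 : δ ≤ 1 / 4 := by
      have : θ ^ 2 ≤ 1 := pow_le_one₀ hθ.le hθ1
      linarith
    obtain ⟨r, hr, ψ, -, hch⟩ := hspec.exists_isFlatChart hδ
    refine ⟨Metric.ball y r, Metric.isOpen_ball, Metric.mem_ball_self hr, ?_⟩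
    intro φ hφ hc hφW hφ0 u
    set W := Metric.ball y r
    have hS := hch.frontier_inter hUo hspec.1 (by linarith)
    have hfin : μHE[3] {z ∈ W | ψ z = 0} ≠ ⊤ := by
      rw [← hS]
      exact ((measure_mono inter_subset_left).trans_lt hU.1).ne
    have hSm : MeasurableSet {z ∈ W | ψ z = 0} := by
      rw [← hS]
      exact isClosed_frontier.measurableSet.inter Metric.isOpen_ball.measurableSet
    have hint : ∫ x in {z ∈ W | ψ z = 0}, φ x ∂μHE[3] = ∫ x, φ x ∂surfaceMeasure U := by
      rw [surfaceMeasure, ← hS]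
      refine (setIntegral_eq_of_subset_of_forall_sdiff_eq_zero isClosed_frontier.measurableSet
        inter_subset_left fun x hx => ?_).symm
      by_contra h0
      exact hx.2 ⟨hx.1, hφW (subset_tsupport _ h0)⟩
    have key := abs_setIntegral_fderiv_sub_le (d := 3) Quaternion.finrank_eq_four hUo
      (convex_ball y r) hch.contDiffOn.continuousOn hch.mem_iff hSm hfin hspec.1 hδ4 hθ hθ1
      (by push_cast; linarith [sq_nonneg θ]) hch.flat hφ hc hφW hφ0 u
    rw [hint] at key
    have hφi : Integrable φ (surfaceMeasure U) :=
      integrable_surfaceMeasure_of_continuousOn hUb hU hφ.continuous.continuousOn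
    have hnφ := integrable_inner_outwardNormal_smul hUo hU hφi u
    have hh : 0 ≤ ∫ x, φ x ∂surfaceMeasure U := integral_nonneg hφ0
    have hvar : |inner ℝ n u * (∫ x, φ x ∂surfaceMeasure U) -
        ∫ x, (inner ℝ (outwardNormal U x) u : ℝ) • φ x ∂surfaceMeasure U| ≤
        2 * δ * ‖u‖ * ∫ x, φ x ∂surfaceMeasure U := by
      rw [← integral_const_mul, ← integral_const_mul, ← integral_sub (hφi.const_mul _) hnφ,
        ← Real.norm_eq_abs]
      refine norm_integral_le_of_norm_le (hφi.const_mul _) ?_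
      filter_upwards [ae_isRegularBoundaryPoint hU, ae_mem_frontier] with x hx hxf
      by_cases hxW : x ∈ W
      · have hx0 : x ∈ {z ∈ W | ψ z = 0} := by
          rw [← hS]
          exact ⟨hxf, hxW⟩
        have h1 := hch.norm_sub_le hspec.1 hδ.le hxW hx0.2 (outwardNormal_spec hx)
        rw [norm_sub_rev] at h1
        simp only [smul_eq_mul]
        rw [← sub_mul, ← inner_sub_left, norm_mul, Real.norm_of_nonneg (hφ0 x)]
        refine mul_le_mul_of_nonneg_right ?_ (hφ0 x)
        exact (norm_inner_le_norm _ _).trans (mul_le_mul_of_nonneg_right h1 (norm_nonneg _))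
      · have : φ x = 0 := by
          by_contra h0
          exact hxW (hφW (subset_tsupport _ h0))
        simp [this]
    have hsum : 3 * θ + 2 * δ ≤ ε := by
      have : θ ^ 2 ≤ θ := by nlinarith
      linarith
    rw [gaussGreenDefect]
    set A := ∫ x in U, fderiv ℝ φ x u
    set B := ∫ x, (inner ℝ (outwardNormal U x) u : ℝ) • φ x ∂surfaceMeasure U
    set h := ∫ x, φ x ∂surfaceMeasure U
    calc |A - B| ≤ |A - inner ℝ n u * h| + |inner ℝ n u * h - B| := abs_sub_le _ _ _
      _ ≤ 3 * θ * ‖u‖ * h + 2 * δ * ‖u‖ * h := add_le_add key hvar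
      _ = (3 * θ + 2 * δ) * (‖u‖ * h) := by ring
      _ ≤ ε * (‖u‖ * h) := mul_le_mul_of_nonneg_right hsum (by positivity)
      _ = ε * ‖u‖ * h := by ring
  · have hflux : ∀ φ : ℍ[ℝ] → ℝ, tsupport φ ⊆ (frontier U)ᶜ → ∀ u : ℍ[ℝ],
        ∫ x, (inner ℝ (outwardNormal U x) u : ℝ) • φ x ∂surfaceMeasure U = 0 := by
      intro φ hφ u
      refine integral_eq_zero_of_ae ?_
      filter_upwards [ae_mem_frontier] with x hx
      have : φ x = 0 := by
        by_contra h
        exact hφ (subset_tsupport _ h) hx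
      simp [this]
    have hnonneg : ∀ φ : ℍ[ℝ] → ℝ, (∀ x, 0 ≤ φ x) → ∀ u : ℍ[ℝ],
        0 ≤ ε * ‖u‖ * ∫ x, φ x ∂surfaceMeasure U := fun φ hφ u =>
      mul_nonneg (by positivity) (integral_nonneg hφ)
    have hzero : ∀ φ : ℍ[ℝ] → ℝ, ∀ u x : ℍ[ℝ], x ∉ tsupport φ → fderiv ℝ φ x u = 0 := by
      intro φ u x hx
      have : fderiv ℝ φ x = 0 := by
        by_contra h
        exact hx (support_fderiv_subset ℝ h)
      simp [this]
    by_cases hyU : y ∈ U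
    · refine ⟨U, hUo, hyU, fun φ hφ hc hφU hφ0 u => ?_⟩
      rw [gaussGreenDefect, hflux φ (fun x hx hxf => ?_),
        setIntegral_eq_integral_of_forall_compl_eq_zero fun x hx => hzero φ u x fun h =>
          hx (hφU h), integral_fderiv_eq_zero hφ hc, sub_zero, abs_zero]
      · exact hnonneg φ hφ0 u
      · have := hxf.2
        rw [hUo.interior_eq] at this
        exact this (hφU hx)
    · have hyc : y ∉ closure U := fun h => hyf ⟨h, by rwa [hUo.interior_eq]⟩
      refine ⟨(closure U)ᶜ, isClosed_closure.isOpen_compl, hyc, fun φ hφ hc hφU hφ0 u => ?_⟩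
      rw [gaussGreenDefect, hflux φ (fun x hx hxf => hφU hx hxf.1),
        setIntegral_eq_zero_of_forall_eq_zero fun x hx => hzero φ u x fun h =>
          hφU h (subset_closure hx), sub_zero, abs_zero]
      exact hnonneg φ hφ0 u

/-- The support is covered by the neighbourhoods of `exists_abs_gaussGreenDefect_le`. The local
bounds add up to `ε * ‖u‖` times one fixed integral, and `ε` tends to zero. -/
theorem gaussGreenDefect_eq_zero_of_nonneg (hUo : IsOpen U) (hUb : Bornology.IsBounded U)
    (hU : HasPiecewiseC1Boundary U) {φ : ℍ[ℝ] → ℝ} (hφ : ContDiff ℝ 1 φ)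
    (hc : HasCompactSupport φ) (hφS : Disjoint (tsupport φ) (singularSet U))
    (hφ0 : ∀ x, 0 ≤ φ x) (u : ℍ[ℝ]) : gaussGreenDefect U φ u = 0 := by
  have hφi : ∀ {χ : ℍ[ℝ] → ℝ}, ContDiff ℝ 1 χ → Integrable χ (surfaceMeasure U) := fun h =>
    integrable_surfaceMeasure_of_continuousOn hUb hU h.continuous.continuousOn
  set h := ∫ x, φ x ∂surfaceMeasure U
  have key : ∀ ε > 0, |gaussGreenDefect U φ u| ≤ ε * ‖u‖ * h := by
    intro ε hε
    have hloc : ∀ y : tsupport φ, ∃ W : Set ℍ[ℝ], IsOpen W ∧ (y : ℍ[ℝ]) ∈ W ∧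
        ∀ φ : ℍ[ℝ] → ℝ, ContDiff ℝ 1 φ → HasCompactSupport φ →
        tsupport φ ⊆ W → (∀ x, 0 ≤ φ x) → ∀ u : ℍ[ℝ],
        |gaussGreenDefect U φ u| ≤ ε * ‖u‖ * ∫ x, φ x ∂surfaceMeasure U := fun y =>
      exists_abs_gaussGreenDefect_le hUo hUb hU (disjoint_left.1 hφS y.2) hε
    choose W hWo hyW hW using hloc
    obtain ⟨f, hf⟩ := SmoothPartitionOfUnity.exists_isSubordinate 𝓘(ℝ, ℍ[ℝ])
      (isClosed_tsupport φ) W hWo (fun y hy => mem_iUnion.2 ⟨⟨y, hy⟩, hyW _⟩)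
    have hfin := f.locallyFinite.finite_nonempty_inter_compact hc
    set s := hfin.toFinset
    have hfd : ∀ i, ContDiff ℝ 1 (f i) := fun i =>
      ((f i).contMDiff.contDiff).of_le (by exact_mod_cast le_top)
    have hsum : φ = fun x => ∑ i ∈ s, f i x * φ x := by
      ext x
      by_cases hx : x ∈ tsupport φ
      · rw [← Finset.sum_mul]
        have h1 := f.sum_eq_one hx
        rw [finsum_eq_sum_of_support_subset (s := s)] at h1
        · rw [h1, one_mul]
        · intro i hi
          rw [Finite.coe_toFinset]
          exact ⟨x, hi, hx⟩
      · simp [image_eq_zero_of_notMem_tsupport hx]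
    have hpd : ∀ i, ContDiff ℝ 1 fun x => f i x * φ x := fun i => (hfd i).mul hφ
    have hpc : ∀ i, HasCompactSupport fun x => f i x * φ x := fun i => hc.mul_left
    calc |gaussGreenDefect U φ u| = |∑ i ∈ s, gaussGreenDefect U (fun x => f i x * φ x) u| := by
          conv_lhs => rw [hsum]
          rw [gaussGreenDefect_sum hUo hUb hU s _ (fun i _ => hpd i) fun i _ => hpc i]
      _ ≤ ∑ i ∈ s, |gaussGreenDefect U (fun x => f i x * φ x) u| :=
          Finset.abs_sum_le_sum_abs _ _
      _ ≤ ∑ i ∈ s, ε * ‖u‖ * ∫ x, f i x * φ x ∂surfaceMeasure U := by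
          refine Finset.sum_le_sum fun i _ => hW i _ (hpd i) (hpc i) ?_
            (fun x => mul_nonneg (f.nonneg i x) (hφ0 x)) u
          exact (closure_mono (Function.support_mul_subset_left _ _)).trans (hf i)
      _ = ε * ‖u‖ * h := by
          rw [← Finset.mul_sum, ← integral_finsetSum _ fun i _ => hφi (hpd i)]
          congr 2
          exact hsum.symm
  have hlim : Tendsto (fun ε : ℝ => ε * ‖u‖ * h) (𝓝[>] 0) (𝓝 0) := by
    have : Continuous fun ε : ℝ => ε * ‖u‖ * h := by fun_prop
    simpa using (this.tendsto 0).mono_left nhdsWithin_le_nhds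
  have := ge_of_tendsto hlim (eventually_nhdsWithin_of_forall fun ε hε => key ε hε)
  exact abs_nonpos_iff.1 this

theorem gaussGreenDefect_sub (hUo : IsOpen U) (hUb : Bornology.IsBounded U)
    (hU : HasPiecewiseC1Boundary U) {φ χ : ℍ[ℝ] → ℝ} (hφ : ContDiff ℝ 1 φ)
    (hφc : HasCompactSupport φ) (hχ : ContDiff ℝ 1 χ) (hχc : HasCompactSupport χ) (u : ℍ[ℝ]) :
    gaussGreenDefect U (fun x => φ x - χ x) u =
      gaussGreenDefect U φ u - gaussGreenDefect U χ u := by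
  have h1 : ∀ x, fderiv ℝ (fun x => φ x - χ x) x u = fderiv ℝ φ x u - fderiv ℝ χ x u := by
    intro x
    rw [fderiv_fun_sub (hφ.differentiable one_ne_zero x) (hχ.differentiable one_ne_zero x)]
    simp
  simp only [gaussGreenDefect, h1, smul_sub]
  rw [integral_sub (integrable_fderiv_apply hφ hφc u).integrableOn
      (integrable_fderiv_apply hχ hχc u).integrableOn,
    integral_sub (integrable_inner_outwardNormal_smul hUo hU
      (integrable_surfaceMeasure_of_continuousOn hUb hU hφ.continuous.continuousOn) u)
      (integrable_inner_outwardNormal_smul hUo hU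
      (integrable_surfaceMeasure_of_continuousOn hUb hU hχ.continuous.continuousOn) u)]
  abel

/-- Adding a large multiple of a cutoff equal to 1 on the support makes `φ` nonnegative; the defect
is linear and vanishes for the cutoff as well. -/
theorem gaussGreenDefect_eq_zero_of_disjoint (hUo : IsOpen U) (hUb : Bornology.IsBounded U)
    (hU : HasPiecewiseC1Boundary U) {φ : ℍ[ℝ] → ℝ} (hφ : ContDiff ℝ 1 φ)
    (hc : HasCompactSupport φ) (hφS : Disjoint (tsupport φ) (singularSet U)) (u : ℍ[ℝ]) :
    gaussGreenDefect U φ u = 0 := by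
  obtain ⟨χ, hχ, hχc, hχS, hχ01, hχ1⟩ := exists_contDiff_one_nhds hc
    (isClosed_singularSet hUo).isOpen_compl (subset_compl_iff_disjoint_right.2 hφS)
  obtain ⟨C, hC⟩ := hc.exists_bound_of_continuous hφ.continuous
  have hC0 : 0 ≤ C := (norm_nonneg _).trans (hC 0)
  have hCχ : ContDiff ℝ 1 fun x => C * χ x := contDiff_const.mul hχ
  have hCχc : HasCompactSupport fun x => C * χ x := hχc.mul_left
  have hsub : tsupport (fun x => C * χ x) ⊆ tsupport χ :=
    closure_mono (Function.support_mul_subset_right _ _)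
  have hdisj : Disjoint (tsupport χ) (singularSet U) := subset_compl_iff_disjoint_right.1 hχS
  have h1 : gaussGreenDefect U (fun x => φ x + C * χ x) u = 0 := by
    refine gaussGreenDefect_eq_zero_of_nonneg hUo hUb hU (hφ.add hCχ) (hc.add hCχc) ?_ ?_ u
    · refine Disjoint.mono_left (tsupport_add _ _) ?_
      exact hφS.union_left (hdisj.mono_left hsub)
    · intro x
      by_cases hx : x ∈ tsupport φ
      · rw [hχ1.self_of_nhdsSet x hx, mul_one]
        have := (abs_le.1 (hC x)).1
        linarith
      · rw [image_eq_zero_of_notMem_tsupport hx, zero_add]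
        exact mul_nonneg hC0 (hχ01 x).1
  have h2 : gaussGreenDefect U (fun x => C * χ x) u = 0 :=
    gaussGreenDefect_eq_zero_of_nonneg hUo hUb hU hCχ hCχc (hdisj.mono_left hsub)
      (fun x => mul_nonneg hC0 (hχ01 x).1) u
  have h3 := gaussGreenDefect_sub hUo hUb hU (hφ.add hCχ) (hc.add hCχc) hCχ hCχc u
  simp only [add_sub_cancel_right] at h3
  rw [h3]
  rw [h2, sub_zero]
  exact h1

end GaussGreen

/-! ### Cutoffs around a compact set of zero area -/

section Cutoff

variable {H : Type*} [NormedAddCommGroup H] [InnerProductSpace ℝ H] [FiniteDimensional ℝ H]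
  [MeasurableSpace H] [BorelSpace H]

omit [InnerProductSpace ℝ H] [FiniteDimensional ℝ H] in
-- A null set has countable covers with small sum of cubed diameters. Each piece that meets `S` is
-- replaced by a ball around one of its points in `S`, with radius the diameter plus a positive
-- summable amount `b i`; the balls are open, so finitely many suffice.
theorem exists_finite_ball_cover {S : Set H} (hS : IsCompact S) (h0 : μHE[3] S = 0) {ε : ℝ}
    (hε : 0 < ε) :
    ∃ (t : Finset ℕ) (c : ℕ → H) (r : ℕ → ℝ), (∀ i ∈ t, c i ∈ S) ∧ (∀ i ∈ t, 0 < r i) ∧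
      (∀ i ∈ t, r i ≤ ε) ∧ S ⊆ ⋃ i ∈ t, Metric.ball (c i) (r i) ∧ ∑ i ∈ t, r i ^ 3 ≤ ε := by
  have hH : (μH[(3 : ℕ)] : Measure H) S = 0 := by
    rw [Measure.euclideanHausdorffMeasure_def, Measure.smul_apply, ENNReal.smul_def,
      smul_eq_mul, mul_eq_zero] at h0
    refine h0.resolve_left ?_
    simpa using Measure.addHaarScalarFactor_volume_hausdorffMeasure_ne_zero 3
  -- The final count is `4 * (η + η)`, whence `ε / 8`; `η ≤ 1` gives `b i ≤ 1`, so that the cube of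
  -- `b i` is at most `b i`.
  set η : ℝ := min (ε / 8) 1 with hηdef
  have hη : 0 < η := lt_min (by positivity) one_pos
  rw [Measure.hausdorffMeasure_apply] at hH
  have h1 := (iSup₂_le_iff.1 hH.le) (ENNReal.ofReal (ε / 2)) (by simpa using hε)
  have h2 := h1.trans_lt (ENNReal.ofReal_pos.2 hη)
  simp only [iInf_lt_iff] at h2
  obtain ⟨A, hSA, hAd, hsum⟩ := h2
  obtain ⟨b, hb0, hbsum⟩ := ENNReal.exists_pos_sum_of_countable' (ε := ENNReal.ofReal
    (min η (ε / 2))) (by simpa using ⟨hη, hε⟩) ℕ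
  have hbfin : ∀ i, b i ≤ ENNReal.ofReal (min η (ε / 2)) := fun i =>
    (ENNReal.le_tsum i).trans hbsum.le
  have hbtop : ∀ i, b i ≠ ⊤ := fun i => ((hbfin i).trans_lt ENNReal.ofReal_lt_top).ne
  have hAtop : ∀ i, Metric.ediam (A i) ≠ ⊤ := fun i =>
    ((hAd i).trans_lt ENNReal.ofReal_lt_top).ne
  have hcex : ∀ i, ∃ c, (A i ∩ S).Nonempty → c ∈ A i ∩ S := by
    intro i
    by_cases h : (A i ∩ S).Nonempty
    · exact ⟨h.some, fun _ => h.some_mem⟩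
    · exact ⟨0, fun h' => absurd h' h⟩
  choose c hc using hcex
  set r : ℕ → ℝ := fun i => (Metric.ediam (A i)).toReal + (b i).toReal with hr
  have hbpos : ∀ i, 0 < (b i).toReal := fun i => ENNReal.toReal_pos (hb0 i).ne' (hbtop i)
  have hrpos : ∀ i, 0 < r i := fun i => add_pos_of_nonneg_of_pos ENNReal.toReal_nonneg (hbpos i)
  have hcov : ∀ x ∈ S, ∃ i, (A i ∩ S).Nonempty ∧ x ∈ Metric.ball (c i) (r i) := by
    intro x hx
    obtain ⟨i, hi⟩ := mem_iUnion.1 (hSA hx)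
    have hne : (A i ∩ S).Nonempty := ⟨x, hi, hx⟩
    refine ⟨i, hne, ?_⟩
    rw [Metric.mem_ball]
    have h3 : edist x (c i) ≤ Metric.ediam (A i) := Metric.edist_le_ediam_of_mem hi (hc i hne).1
    have h4 : dist x (c i) ≤ (Metric.ediam (A i)).toReal := by
      rw [dist_edist]
      exact ENNReal.toReal_mono (hAtop i) h3
    have := hbpos i
    simp only [hr]
    linarith
  obtain ⟨t, htsub, htcov⟩ := hS.elim_finite_subcover_image (b := {i | (A i ∩ S).Nonempty})
    (c := fun i => Metric.ball (c i) (r i)) (fun i _ => Metric.isOpen_ball) (by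
      intro x hx
      obtain ⟨i, hi, hxi⟩ := hcov x hx
      exact mem_biUnion hi hxi)
  obtain ⟨htfin, htcov⟩ := htcov
  refine ⟨htfin.toFinset, c, r, ?_, fun i _ => hrpos i, ?_, ?_, ?_⟩
  · intro i hi
    exact (hc i (htsub (by simpa using hi))).2
  · intro i _
    have h3 : (Metric.ediam (A i)).toReal ≤ ε / 2 :=
      ENNReal.toReal_le_of_le_ofReal (by positivity) (hAd i)
    have h4 : (b i).toReal ≤ min η (ε / 2) :=
      ENNReal.toReal_le_of_le_ofReal (by positivity) (hbfin i)
    have := min_le_right η (ε / 2)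
    simp only [hr]
    linarith
  · simpa using htcov
  · have hcube : ∀ i ∈ htfin.toFinset, r i ^ 3 ≤
        4 * ((Metric.ediam (A i)).toReal ^ 3 + (b i).toReal) := by
      intro i _
      have ha : 0 ≤ (Metric.ediam (A i)).toReal := ENNReal.toReal_nonneg
      have hb := (hbpos i).le
      have hb1 : (b i).toReal ≤ 1 := by
        have h4 : (b i).toReal ≤ min η (ε / 2) :=
          ENNReal.toReal_le_of_le_ofReal (by positivity) (hbfin i)
        exact h4.trans ((min_le_left _ _).trans (min_le_right _ _))
      simp only [hr]
      set p := (Metric.ediam (A i)).toReal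
      set q := (b i).toReal
      have h5 : q ^ 3 ≤ q := by
        have : q ^ 2 ≤ 1 := pow_le_one₀ hb hb1
        nlinarith
      -- This rests on `4 * (p ^ 3 + q ^ 3) - (p + q) ^ 3 = 3 * (p + q) * (p - q) ^ 2`.
      nlinarith [mul_nonneg (add_nonneg ha hb) (sq_nonneg (p - q))]
    have hs1 : ∑ i ∈ htfin.toFinset, (Metric.ediam (A i)).toReal ^ 3 ≤ η := by
      rw [← ENNReal.ofReal_le_ofReal_iff hη.le, ENNReal.ofReal_sum_of_nonneg
        fun i _ => by positivity]
      refine le_trans ?_ hsum.le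
      refine le_trans (Finset.sum_le_sum fun i hi => ?_) (ENNReal.sum_le_tsum _)
      have hne : (A i).Nonempty :=
        Nonempty.mono inter_subset_left (htsub (by simpa using hi))
      rw [iSup_pos hne, ENNReal.ofReal_pow ENNReal.toReal_nonneg, ENNReal.ofReal_toReal (hAtop i)]
      simp
    have hs2 : ∑ i ∈ htfin.toFinset, (b i).toReal ≤ η := by
      rw [← ENNReal.ofReal_le_ofReal_iff hη.le, ENNReal.ofReal_sum_of_nonneg
        fun i _ => ENNReal.toReal_nonneg]
      refine le_trans ?_ (hbsum.le.trans (ENNReal.ofReal_le_ofReal (min_le_left _ _)))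
      refine le_trans (Finset.sum_le_sum fun i hi => ?_) (ENNReal.sum_le_tsum _)
      rw [ENNReal.ofReal_toReal (hbtop i)]
    calc ∑ i ∈ htfin.toFinset, r i ^ 3 ≤ _ := Finset.sum_le_sum hcube
      _ = 4 * (∑ i ∈ htfin.toFinset, (Metric.ediam (A i)).toReal ^ 3 +
          ∑ i ∈ htfin.toFinset, (b i).toReal) := by
        rw [← Finset.mul_sum, Finset.sum_add_distrib]
      _ ≤ 4 * (η + η) := by gcongr
      _ ≤ ε := by
        have := min_le_left (ε / 8) 1
        linarith

/-- Bump functions on concentric balls, with the expected integrated gradient. -/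
theorem exists_scaled_bump (hd : Module.finrank ℝ H = 4) :
    ∃ C : ℝ, 0 ≤ C ∧ ∀ (c : H) (r : ℝ), 0 < r → ∃ η : H → ℝ, ContDiff ℝ 1 η ∧
      HasCompactSupport η ∧ (∀ x, 0 ≤ η x) ∧ (∀ x ∈ Metric.ball c r, η x = 1) ∧
      (∀ x, 2 * r ≤ dist x c → η x = 0) ∧ ∫ x, ‖fderiv ℝ η x‖ ≤ C * r ^ 3 := by
  let f : ContDiffBump (0 : H) := ⟨1, 2, one_pos, one_lt_two⟩
  have hf : ContDiff ℝ 1 f := f.contDiff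
  set C := ∫ x, ‖fderiv ℝ f x‖
  refine ⟨C, integral_nonneg_of_ae (Eventually.of_forall fun x =>
    (fderiv ℝ f x).opNorm_nonneg), fun c r hr => ?_⟩
  let g : H → H := fun x => r⁻¹ • (x - c)
  have hg : ContDiff ℝ 1 g := by fun_prop
  have hnorm : ∀ x, dist (g x) 0 = r⁻¹ * dist x c := by
    intro x
    simp only [g]
    rw [dist_zero_right, norm_smul, norm_inv, Real.norm_of_nonneg hr.le, dist_eq_norm]
  have h0 : ∀ x, 2 * r ≤ dist x c → f (g x) = 0 := by
    intro x hx
    refine f.zero_of_le_dist ?_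
    rw [hnorm]
    change (2 : ℝ) ≤ _
    rw [inv_mul_eq_div, le_div_iff₀ hr]
    exact hx
  refine ⟨fun x => f (g x), hf.comp hg, ?_, fun x => f.nonneg, fun x hx => ?_, h0, ?_⟩
  · refine HasCompactSupport.intro (isCompact_closedBall c (2 * r)) fun x hx => h0 x ?_
    rw [Metric.mem_closedBall, not_le] at hx
    exact hx.le
  · refine f.one_of_mem_closedBall ?_
    rw [Metric.mem_closedBall, hnorm]
    change _ ≤ (1 : ℝ)
    rw [inv_mul_eq_div, div_le_one hr]
    exact (Metric.mem_ball.1 hx).le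
  · have hfd : ∀ x, ‖fderiv ℝ (fun x => f (g x)) x‖ = r⁻¹ * ‖fderiv ℝ f (r⁻¹ • (x - c))‖ := by
      intro x
      have hgd : HasFDerivAt g (r⁻¹ • ContinuousLinearMap.id ℝ H) x :=
        ((hasFDerivAt_id x).sub_const c).const_smul r⁻¹
      have := ((hf.differentiable one_ne_zero (g x)).hasFDerivAt.comp x hgd).fderiv
      change fderiv ℝ (fun x => f (g x)) x = _ at this
      rw [this, ContinuousLinearMap.comp_smul, ContinuousLinearMap.comp_id, norm_smul, norm_inv,
        Real.norm_of_nonneg hr.le]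
    -- Dimension four contributes `r ^ 4`, and the chain rule `r⁻¹`: together `r ^ 3`, the scaling
    -- of area.
    have hint : ∫ x, ‖fderiv ℝ f (r⁻¹ • (x - c))‖ = r ^ 4 * C := by
      rw [integral_sub_right_eq_self (fun x => ‖fderiv ℝ f (r⁻¹ • x)‖) c,
        Measure.integral_comp_smul volume (fun x => ‖fderiv ℝ f x‖), hd]
      rw [inv_pow, inv_inv, abs_of_pos (by positivity), smul_eq_mul]
    simp only [hfd]
    rw [integral_const_mul, hint]
    apply le_of_eq
    field_simp

/-- Cutoff functions vanishing near a compact set of zero area, with small integrated gradient. -/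
theorem exists_cutoff (hd : Module.finrank ℝ H = 4) {S : Set H} (hS : IsCompact S) (h0 : μHE[3] S = 0) :
    ∃ C : ℝ, 0 ≤ C ∧ ∀ ε > 0, ∃ χ : H → ℝ, ContDiff ℝ 1 χ ∧ (∀ x, χ x ∈ Icc (0 : ℝ) 1) ∧
      Disjoint (tsupport χ) S ∧ (∀ x, (∀ y ∈ S, 2 * ε ≤ dist x y) → χ x = 1) ∧
      ∀ u : H, Integrable (fun x => fderiv ℝ χ x u) ∧
        ∫ x, ‖fderiv ℝ χ x u‖ ≤ C * ε * ‖u‖ := by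
  obtain ⟨C, hC, hbump⟩ := exists_scaled_bump hd
  -- The sum `σ` of the bumps is at least 1 on the balls and 0 outside their doubles, so `h ∘ σ` is
  -- 0 near `S` and 1 far away. Composing with `h` keeps the values in `[0, 1]` and bounds the
  -- gradient by `M` times the sum of the bump gradients.
  let h : ContDiffBump (0 : ℝ) := ⟨1 / 2, 1, by norm_num, by norm_num⟩
  have hh : ContDiff ℝ 1 h := h.contDiff
  obtain ⟨M, hM⟩ := (h.hasCompactSupport.fderiv (𝕜 := ℝ)).exists_bound_of_continuous
    (hh.continuous_fderiv one_ne_zero)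
  have hM0 : 0 ≤ M := (norm_nonneg _).trans (hM 0)
  refine ⟨M * C, by positivity, fun ε hε => ?_⟩
  obtain ⟨t, c, r, hcS, hr, hrε, hcov, hsum⟩ := exists_finite_ball_cover hS h0 hε
  have hη : ∀ i, ∃ η : H → ℝ, i ∈ t → ContDiff ℝ 1 η ∧
      HasCompactSupport η ∧ (∀ x, 0 ≤ η x) ∧ (∀ x ∈ Metric.ball (c i) (r i), η x = 1) ∧
      (∀ x, 2 * r i ≤ dist x (c i) → η x = 0) ∧ ∫ x, ‖fderiv ℝ η x‖ ≤ C * r i ^ 3 := by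
    intro i
    by_cases hi : i ∈ t
    · obtain ⟨η, hη⟩ := hbump (c i) (r i) (hr i hi)
      exact ⟨η, fun _ => hη⟩
    · exact ⟨0, fun h => absurd h hi⟩
  choose η hη using hη
  let σ : H → ℝ := fun x => ∑ i ∈ t, η i x
  have hσ : ContDiff ℝ 1 σ := ContDiff.sum fun i hi => (hη i hi).1
  have hfd : ∀ x, ‖fderiv ℝ (fun x => h (σ x)) x‖ ≤ M * ∑ i ∈ t, ‖fderiv ℝ (η i) x‖ := by
    intro x
    have h1 : fderiv ℝ (fun x => h (σ x)) x = (fderiv ℝ h (σ x)).comp (fderiv ℝ σ x) :=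
      fderiv_comp x (hh.differentiable one_ne_zero _) (hσ.differentiable one_ne_zero x)
    have h2 : fderiv ℝ σ x = ∑ i ∈ t, fderiv ℝ (η i) x :=
      fderiv_fun_sum fun i hi => (hη i hi).1.differentiable one_ne_zero x
    rw [h1]
    refine (ContinuousLinearMap.opNorm_comp_le _ _).trans ?_
    rw [h2]
    exact mul_le_mul (hM _) (norm_sum_le _ _) (norm_nonneg _) hM0
  have hηi : ∀ i ∈ t, Integrable fun x => ‖fderiv ℝ (η i) x‖ := fun i hi =>
    (((hη i hi).1.continuous_fderiv one_ne_zero).integrable_of_hasCompactSupport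
      ((hη i hi).2.1.fderiv (𝕜 := ℝ))).norm
  have hdom : Integrable fun x => M * ∑ i ∈ t, ‖fderiv ℝ (η i) x‖ :=
    (integrable_finsetSum _ hηi).const_mul M
  have hχ : ContDiff ℝ 1 fun x => h (σ x) := hh.comp hσ
  refine ⟨fun x => h (σ x), hχ, fun x => ⟨h.nonneg, h.le_one⟩, ?_, fun x hx => ?_, fun u => ?_⟩
  · have hO : IsOpen (⋃ i ∈ t, Metric.ball (c i) (r i)) :=
      isOpen_biUnion fun i _ => Metric.isOpen_ball
    refine Disjoint.mono_right hcov (Disjoint.closure_left ?_ hO)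
    rw [disjoint_left]
    intro x hx hxO
    obtain ⟨i, hi, hxi⟩ := mem_iUnion₂.1 hxO
    refine hx (h.zero_of_le_dist ?_)
    change (1 : ℝ) ≤ _
    rw [dist_zero_right]
    refine le_trans ?_ (le_abs_self _)
    rw [← (hη i hi).2.2.2.1 x hxi]
    exact Finset.single_le_sum (f := fun i => η i x) (fun j hj => (hη j hj).2.2.1 x) hi
  · have : σ x = 0 := Finset.sum_eq_zero fun i hi => (hη i hi).2.2.2.2.1 x
      (le_trans (by linarith [hrε i hi]) (hx _ (hcS i hi)))
    refine h.one_of_mem_closedBall ?_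
    rw [this]
    exact Metric.mem_closedBall_self h.rIn_pos.le
  · have hfu : ∀ x, ‖fderiv ℝ (fun x => h (σ x)) x u‖ ≤
        (M * ∑ i ∈ t, ‖fderiv ℝ (η i) x‖) * ‖u‖ := fun x =>
      ((fderiv ℝ (fun x => h (σ x)) x).le_opNorm u).trans
        (mul_le_mul_of_nonneg_right (hfd x) (norm_nonneg u))
    have hint : Integrable fun x => fderiv ℝ (fun x => h (σ x)) x u :=
      (hdom.mul_const ‖u‖).mono' ((hχ.continuous_fderiv one_ne_zero).clm_apply
        continuous_const).aestronglyMeasurable (Eventually.of_forall hfu)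
    refine ⟨hint, ?_⟩
    calc ∫ x, ‖fderiv ℝ (fun x => h (σ x)) x u‖
        ≤ ∫ x, (M * ∑ i ∈ t, ‖fderiv ℝ (η i) x‖) * ‖u‖ :=
        integral_mono hint.norm (hdom.mul_const _) hfu
      _ = M * (∑ i ∈ t, ∫ x, ‖fderiv ℝ (η i) x‖) * ‖u‖ := by
        rw [integral_mul_const, integral_const_mul, integral_finsetSum _ hηi]
      _ ≤ M * (∑ i ∈ t, C * r i ^ 3) * ‖u‖ := by
        gcongr with i hi
        exact (hη i hi).2.2.2.2.2
      _ = M * (C * ∑ i ∈ t, r i ^ 3) * ‖u‖ := by rw [← Finset.mul_sum]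
      _ ≤ M * (C * ε) * ‖u‖ := by gcongr
      _ = M * C * ε * ‖u‖ := by ring

end Cutoff

/-! ### The Gauss-Green formula across the singular set -/

section GaussGreen

variable {U : Set ℍ[ℝ]}

/-- The formula holds for `χ k * φ`, supported off the singular set. The extra term with the
derivative of `χ k` tends to zero by `exists_cutoff`. In the other two dominated convergence
applies: the singular set is disjoint from the open set `U` and null for surface measure. -/
theorem gaussGreenDefect_eq_zero_of_hasCompactSupport (hUo : IsOpen U)
    (hUb : Bornology.IsBounded U) (hU : HasPiecewiseC1Boundary U) {φ : ℍ[ℝ] → ℝ}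
    (hφ : ContDiff ℝ 1 φ) (hc : HasCompactSupport φ) (u : ℍ[ℝ]) :
    gaussGreenDefect U φ u = 0 := by
  have hSc : IsCompact (singularSet U) := by
    refine Metric.isCompact_of_isClosed_isBounded (isClosed_singularSet hUo)
      (hUb.closure.subset fun x hx => hx.1.1)
  obtain ⟨C, hC, hcut⟩ := exists_cutoff Quaternion.finrank_eq_four hSc hU.2
  have hpos : ∀ k : ℕ, (0 : ℝ) < 1 / ((k : ℝ) + 1) := fun k => by positivity
  choose χ hχ hχ01 hχS hχ1 hχi using fun k : ℕ => hcut (1 / ((k : ℝ) + 1)) (hpos k)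
  have htends : ∀ x ∉ singularSet U, Tendsto (fun k => χ k x) atTop (𝓝 1) := by
    intro x hx
    obtain ⟨ρ, hρ, hρS⟩ := Metric.isOpen_iff.1 (isClosed_singularSet hUo).isOpen_compl x hx
    have hlim : Tendsto (fun k : ℕ => 2 * (1 / ((k : ℝ) + 1))) atTop (𝓝 0) := by
      simpa using (tendsto_one_div_add_atTop_nhds_zero_nat (𝕜 := ℝ)).const_mul 2
    refine tendsto_const_nhds.congr' ?_
    filter_upwards [hlim.eventually (gt_mem_nhds hρ)] with k hk
    refine (hχ1 k x fun y hy => ?_).symm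
    by_contra! hlt
    exact hρS (Metric.mem_ball'.2 (hlt.trans hk)) hy
  obtain ⟨M, hM⟩ := hc.exists_bound_of_continuous hφ.continuous
  have hM0 : 0 ≤ M := (norm_nonneg _).trans (hM 0)
  have hφi := integrable_fderiv_apply hφ hc u
  have hsplit : ∀ k x, fderiv ℝ (fun x => χ k x * φ x) x u =
      χ k x * fderiv ℝ φ x u + φ x * fderiv ℝ (χ k) x u := by
    intro k x
    rw [fderiv_fun_mul ((hχ k).differentiable one_ne_zero x)
      (hφ.differentiable one_ne_zero x)]
    simp
  have hdef : ∀ k, (∫ x in U, χ k x * fderiv ℝ φ x u) + (∫ x in U, φ x * fderiv ℝ (χ k) x u) -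
      ∫ x, (inner ℝ (outwardNormal U x) u : ℝ) • (χ k x * φ x) ∂surfaceMeasure U = 0 := by
    intro k
    have hd : Disjoint (tsupport fun x => χ k x * φ x) (singularSet U) :=
      (hχS k).mono_left (closure_mono (Function.support_mul_subset_left _ _))
    have := gaussGreenDefect_eq_zero_of_disjoint hUo hUb hU ((hχ k).mul hφ) hc.mul_left hd u
    rw [gaussGreenDefect] at this
    simp only [hsplit] at this
    rw [integral_add] at this
    · exact this
    · refine (Integrable.bdd_mul (c := 1) hφi (hχ k).continuous.aestronglyMeasurable
        (Eventually.of_forall fun x => ?_)).integrableOn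
      rw [Real.norm_of_nonneg (hχ01 k x).1]
      exact (hχ01 k x).2
    · refine (Continuous.integrable_of_hasCompactSupport ?_ hc.mul_right).integrableOn
      exact hφ.continuous.mul
        (((hχ k).continuous_fderiv one_ne_zero).clm_apply continuous_const)
  have hlim1 : Tendsto (fun k => ∫ x in U, χ k x * fderiv ℝ φ x u) atTop
      (𝓝 (∫ x in U, fderiv ℝ φ x u)) := by
    refine tendsto_integral_of_dominated_convergence (fun x => ‖fderiv ℝ φ x u‖)
      (fun k => ((hχ k).continuous.mul
        ((hφ.continuous_fderiv one_ne_zero).clm_apply continuous_const)).aestronglyMeasurable)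
      hφi.norm.integrableOn (fun k => Eventually.of_forall fun x => ?_) ?_
    · rw [norm_mul, Real.norm_of_nonneg (hχ01 k x).1]
      exact mul_le_of_le_one_left (norm_nonneg _) (hχ01 k x).2
    · filter_upwards [ae_restrict_mem hUo.measurableSet] with x hx
      have hxS : x ∉ singularSet U := by
        intro h
        have := h.1.2
        rw [hUo.interior_eq] at this
        exact this hx
      simpa using (htends x hxS).mul_const (fderiv ℝ φ x u)
  have hlim2 : Tendsto (fun k => ∫ x in U, φ x * fderiv ℝ (χ k) x u) atTop (𝓝 0) := by
    refine squeeze_zero_norm (a := fun k : ℕ => M * (C * (1 / ((k : ℝ) + 1)) * ‖u‖))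
      (fun k => ?_) ?_
    · have hi : Integrable fun x => M * ‖fderiv ℝ (χ k) x u‖ := (hχi k u).1.norm.const_mul _
      refine (norm_integral_le_of_norm_le hi.integrableOn (Eventually.of_forall fun x => ?_)).trans
        ((setIntegral_le_integral hi (Eventually.of_forall fun x => ?_)).trans ?_)
      · rw [norm_mul]
        exact mul_le_mul_of_nonneg_right (hM x) (norm_nonneg _)
      · exact mul_nonneg hM0 (norm_nonneg _)
      · rw [integral_const_mul]
        exact mul_le_mul_of_nonneg_left (hχi k u).2 hM0
    · simpa using (((tendsto_one_div_add_atTop_nhds_zero_nat (𝕜 := ℝ)).const_mul C).mul_const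
        ‖u‖).const_mul M
  have hφs := integrable_inner_outwardNormal_smul hUo hU
    (integrable_surfaceMeasure_of_continuousOn hUb hU hφ.continuous.continuousOn) u
  have hlim3 : Tendsto (fun k => ∫ x, (inner ℝ (outwardNormal U x) u : ℝ) • (χ k x * φ x)
      ∂surfaceMeasure U) atTop
      (𝓝 (∫ x, (inner ℝ (outwardNormal U x) u : ℝ) • φ x ∂surfaceMeasure U)) := by
    refine tendsto_integral_of_dominated_convergence
      (fun x => ‖(inner ℝ (outwardNormal U x) u : ℝ) • φ x‖) (fun k => ?_)
      hφs.norm (fun k => Eventually.of_forall fun x => ?_) ?_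
    · exact (integrable_inner_outwardNormal_smul hUo hU (integrable_surfaceMeasure_of_continuousOn
        hUb hU ((hχ k).mul hφ).continuous.continuousOn) u).aestronglyMeasurable
    · rw [norm_smul, norm_smul, norm_mul, Real.norm_of_nonneg (hχ01 k x).1]
      refine mul_le_mul_of_nonneg_left ?_ (norm_nonneg _)
      exact mul_le_of_le_one_left (norm_nonneg _) (hχ01 k x).2
    · have h : ∀ᵐ x ∂surfaceMeasure U, x ∉ singularSet U :=
        measure_eq_zero_iff_ae_notMem.1 (surfaceMeasure_singularSet hU)
      filter_upwards [h] with x hx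
      simpa using ((htends x hx).mul_const (φ x)).const_smul
        (inner ℝ (outwardNormal U x) u : ℝ)
  have hlim := (hlim1.add hlim2).sub hlim3
  simp only [hdef, add_zero] at hlim
  exact (tendsto_nhds_unique hlim tendsto_const_nhds)

variable {E : Type*} [NormedAddCommGroup E] [NormedSpace ℝ E]

omit [NormedSpace ℝ E] in
theorem integrableOn_of_continuousOn_closure (hUb : Bornology.IsBounded U) {φ : ℍ[ℝ] → E}
    (hφ : ContinuousOn φ (closure U)) : IntegrableOn φ U := by
  have hc : IsCompact (closure U) :=
    Metric.isCompact_of_isClosed_isBounded isClosed_closure hUb.closure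
  exact (hφ.integrableOn_compact hc).mono_set subset_closure

/-- The **Gauss-Green formula** on a bounded open set with piecewise `C¹` boundary. -/
theorem setIntegral_fderiv_eq_integral_surfaceMeasure [CompleteSpace E] (hUo : IsOpen U)
    (hUb : Bornology.IsBounded U) (hU : HasPiecewiseC1Boundary U) {V : Set ℍ[ℝ]} (hV : IsOpen V)
    (hUV : closure U ⊆ V) {φ : ℍ[ℝ] → E} (hφ : ContDiffOn ℝ 1 φ V) (u : ℍ[ℝ]) :
    ∫ x in U, fderiv ℝ φ x u =
      ∫ x, (inner ℝ (outwardNormal U x) u : ℝ) • φ x ∂surfaceMeasure U := by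
  have hc : IsCompact (closure U) :=
    Metric.isCompact_of_isClosed_isBounded isClosed_closure hUb.closure
  have hcd : ContinuousOn (fun x => fderiv ℝ φ x u) V :=
    (hφ.continuousOn_fderiv_of_isOpen hV le_rfl).clm_apply continuousOn_const
  have hUi : IntegrableOn (fun x => fderiv ℝ φ x u) U :=
    integrableOn_of_continuousOn_closure hUb (hcd.mono hUV)
  have hsi : Integrable (fun x => (inner ℝ (outwardNormal U x) u : ℝ) • φ x)
      (surfaceMeasure U) := integrable_inner_outwardNormal_smul hUo hU
    (integrable_surfaceMeasure_of_continuousOn hUb hU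
      (hφ.continuousOn.mono (frontier_subset_closure.trans hUV))) u
  obtain ⟨χ, hχ, hχc, hχV, -, hχ1⟩ := exists_contDiff_one_nhds hc hV hUV
  refine (SeparatingDual.eq_iff_forall_dual_eq (R := ℝ)).2 fun L => ?_
  rw [← L.integral_comp_comm hUi, ← L.integral_comp_comm hsi]
  -- The cutoff extends `L ∘ φ` by zero from `V` to the whole space without changing it near
  -- `closure U`.
  let ω : ℍ[ℝ] → ℝ := fun x => χ x * L (φ x)
  have hω : ContDiff ℝ 1 ω := by
    rw [contDiff_iff_contDiffAt]
    intro x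
    by_cases hx : x ∈ tsupport χ
    · exact hχ.contDiffAt.mul
        (L.contDiff.contDiffAt.comp x (hφ.contDiffAt (hV.mem_nhds (hχV hx))))
    · refine (contDiffAt_const (c := (0 : ℝ))).congr_of_eventuallyEq ?_
      filter_upwards [(isClosed_tsupport χ).isOpen_compl.mem_nhds hx] with y hy
      simp [ω, image_eq_zero_of_notMem_tsupport hy]
  have hωeq : ∀ x ∈ closure U, ω =ᶠ[𝓝 x] fun y => L (φ y) := by
    intro x hx
    filter_upwards [hχ1.filter_mono (nhds_le_nhdsSet hx)] with y hy
    simp [ω, hy]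
  have h := gaussGreenDefect_eq_zero_of_hasCompactSupport hUo hUb hU hω hχc.mul_right u
  rw [gaussGreenDefect, sub_eq_zero] at h
  have h1 : ∫ x in U, L (fderiv ℝ φ x u) = ∫ x in U, fderiv ℝ ω x u := by
    refine setIntegral_congr_fun hUo.measurableSet fun x hx => ?_
    have hxc := subset_closure hx
    have hd : DifferentiableAt ℝ φ x :=
      (hφ.contDiffAt (hV.mem_nhds (hUV hxc))).differentiableAt one_ne_zero
    have h2 : HasFDerivAt (fun y => L (φ y)) (L.comp (fderiv ℝ φ x)) x :=
      L.hasFDerivAt.comp x hd.hasFDerivAt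
    simp only [(hωeq x hxc).fderiv_eq, h2.fderiv, ContinuousLinearMap.comp_apply]
  rw [h1, h]
  refine integral_congr_ae ?_
  filter_upwards [ae_mem_frontier] with x hx
  rw [(hωeq x (frontier_subset_closure hx)).self_of_nhds, map_smul]

end GaussGreen

/-! ### Calculus of partial derivatives -/

section Derivatives

variable {H E : Type*} [NormedAddCommGroup H] [NormedSpace ℝ H] [NormedAddCommGroup E]
  [NormedSpace ℝ E]

theorem contDiffOn_fderiv_apply_const {f : H → E} {V : Set H} (hV : IsOpen V) {k : ℕ}
    (hf : ContDiffOn ℝ (k + 1 : ℕ) f V) (w : H) :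
    ContDiffOn ℝ k (fun y => fderiv ℝ f y w) V :=
  (hf.fderiv_of_isOpen hV (by norm_cast)).clm_apply contDiffOn_const

theorem fderiv_fderiv_apply_comm {f : H → E} {V : Set H} (hV : IsOpen V)
    (hf : ContDiffOn ℝ 2 f V) {x : H} (hx : x ∈ V) (v w : H) :
    fderiv ℝ (fun y => fderiv ℝ f y w) x v = fderiv ℝ (fun y => fderiv ℝ f y v) x w := by
  have hc : ContDiffAt ℝ 2 f x := hf.contDiffAt (hV.mem_nhds hx)
  have hd : DifferentiableAt ℝ (fderiv ℝ f) x :=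
    (hc.fderiv_right (m := 1) (by norm_num)).differentiableAt one_ne_zero
  have hsymm : IsSymmSndFDerivAt ℝ f x := hc.isSymmSndFDerivAt (by simp)
  have h : ∀ w, fderiv ℝ (fun y => fderiv ℝ f y w) x = (fderiv ℝ (fderiv ℝ f) x).flip w := by
    intro w
    rw [fderiv_clm_apply hd (differentiableAt_const w)]
    simp
  rw [h, h]
  exact hsymm v w

end Derivatives

section PartialDerivatives

variable {E : Type*} [NormedAddCommGroup E] [NormedSpace ℝ E] {V : Set ℍ[ℝ]} {x : ℍ[ℝ]}

theorem ContDiffOn.pd {f : ℍ[ℝ] → E} (hV : IsOpen V) {k : ℕ} (hf : ContDiffOn ℝ (k + 1 : ℕ) f V)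
    (i : Fin 4) : ContDiffOn ℝ k (pd i f) V :=
  contDiffOn_fderiv_apply_const hV hf (e i)

theorem pd_comm {f : ℍ[ℝ] → E} (hV : IsOpen V) (hf : ContDiffOn ℝ 2 f V) (hx : x ∈ V)
    (i j : Fin 4) : pd i (pd j f) x = pd j (pd i f) x :=
  fderiv_fderiv_apply_comm hV hf hx (e i) (e j)

theorem pd_congr {f g : ℍ[ℝ] → E} (hV : IsOpen V) (h : ∀ y ∈ V, f y = g y) (hx : x ∈ V)
    (i : Fin 4) : pd i f x = pd i g x := by
  have : f =ᶠ[𝓝 x] g := by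
    filter_upwards [hV.mem_nhds hx] with y hy using h y hy
  rw [pd, pd, this.fderiv_eq]

theorem pd_add {f g : ℍ[ℝ] → E} (hf : DifferentiableAt ℝ f x) (hg : DifferentiableAt ℝ g x)
    (i : Fin 4) : pd i (fun y => f y + g y) x = pd i f x + pd i g x := by
  simp only [pd, fderiv_fun_add hf hg]
  rfl

theorem pd_sub {f g : ℍ[ℝ] → E} (hf : DifferentiableAt ℝ f x) (hg : DifferentiableAt ℝ g x)
    (i : Fin 4) : pd i (fun y => f y - g y) x = pd i f x - pd i g x := by
  simp only [pd, fderiv_fun_sub hf hg]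
  rfl

theorem pd_sum {ι : Type*} (s : Finset ι) {f : ι → ℍ[ℝ] → E}
    (hf : ∀ j ∈ s, DifferentiableAt ℝ (f j) x) (i : Fin 4) :
    pd i (fun y => ∑ j ∈ s, f j y) x = ∑ j ∈ s, pd i (f j) x := by
  simp only [pd, fderiv_fun_sum hf]
  simp

theorem pd_const_smul {f : ℍ[ℝ] → E} (hf : DifferentiableAt ℝ f x) (c : ℝ)
    (i : Fin 4) : pd i (fun y => c • f y) x = c • pd i f x := by
  simp only [pd, fderiv_fun_const_smul hf]
  rfl

theorem pd_smul {a : ℍ[ℝ] → ℝ} {f : ℍ[ℝ] → E} (ha : DifferentiableAt ℝ a x)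
    (hf : DifferentiableAt ℝ f x) (i : Fin 4) :
    pd i (fun y => a y • f y) x = a x • pd i f x + pd i a x • f x := by
  simp only [pd, fderiv_fun_smul ha hf]
  rfl

theorem pd_bilin {m : ℍ[ℝ] → E → E} (hb : IsBoundedBilinearMap ℝ fun p : ℍ[ℝ] × E => m p.1 p.2)
    {a : ℍ[ℝ] → ℍ[ℝ]} {f : ℍ[ℝ] → E} (ha : DifferentiableAt ℝ a x)
    (hf : DifferentiableAt ℝ f x) (i : Fin 4) :
    pd i (fun y => m (a y) (f y)) x = m (pd i a x) (f x) + m (a x) (pd i f x) := by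
  have h := (hb.hasFDerivAt (a x, f x)).comp x (ha.hasFDerivAt.prodMk hf.hasFDerivAt)
  have h2 : fderiv ℝ (fun y => m (a y) (f y)) x = _ := h.fderiv
  rw [pd, h2]
  simp only [pd, ContinuousLinearMap.comp_apply, ContinuousLinearMap.prod_apply,
    IsBoundedBilinearMap.deriv_apply]
  rw [add_comm]

end PartialDerivatives

/-! ### Coordinates and the boundary form -/

section Coordinates

theorem re_e (i : Fin 4) : (e i).re = ![1, 0, 0, 0] i := by fin_cases i <;> rfl

theorem imI_e (i : Fin 4) : (e i).imI = ![0, 1, 0, 0] i := by fin_cases i <;> rfl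

theorem imJ_e (i : Fin 4) : (e i).imJ = ![0, 0, 1, 0] i := by fin_cases i <;> rfl

theorem imK_e (i : Fin 4) : (e i).imK = ![0, 0, 0, 1] i := by fin_cases i <;> rfl

theorem coord_eq_inner (i : Fin 4) (q : ℍ[ℝ]) : coord i q = inner ℝ q (e i) := by
  rw [Quaternion.inner_def]
  fin_cases i <;> simp [coord, re_e, imI_e, imJ_e, imK_e]

theorem sum_coord_smul (q : ℍ[ℝ]) : ∑ i, coord i q • e i = q := by
  rw [Fin.sum_univ_four]
  ext <;> simp [coord, re_e, imI_e, imJ_e, imK_e]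

theorem sum_coord_sq (q : ℍ[ℝ]) : ∑ i, coord i q ^ 2 = Quaternion.normSq q := by
  rw [Fin.sum_univ_four, Quaternion.normSq_def']
  simp [coord]

theorem normSq_e (i : Fin 4) : Quaternion.normSq (e i) = 1 := by
  rw [Quaternion.normSq_def']
  fin_cases i <;> simp [re_e, imI_e, imJ_e, imK_e]

theorem coord_e_self (i : Fin 4) : coord i (e i) = 1 := by
  fin_cases i <;> simp [coord, re_e, imI_e, imJ_e, imK_e]

theorem fderiv_apply_eq_sum {E : Type*} [NormedAddCommGroup E] [NormedSpace ℝ E] (f : ℍ[ℝ] → E)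
    (x n : ℍ[ℝ]) : fderiv ℝ f x n = ∑ i, coord i n • pd i f x := by
  conv_lhs => rw [← sum_coord_smul n]
  simp [pd]

/-- On the frame `(n e₁, n e₂, n e₃)` the form `Dx` is a cubic expression in `n`, equal to `N(n) n`.
The first boundary integral thereby becomes a flux, through the expansion of `star n` in the `star
(e i)`. -/
theorem DxPlus_tangentFrame {n : ℍ[ℝ]} (hn : ‖n‖ = 1) : DxPlus (tangentFrame n) = star n := by
  have h : Dx (tangentFrame n) = Quaternion.normSq n • n := by
    rw [Quaternion.normSq_def']
    ext <;> simp [Dx, dx, tangentFrame, coord, re_e, imI_e, imJ_e, imK_e, Matrix.det_fin_three] <;>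
      ring
  rw [DxPlus, h, Quaternion.normSq_eq_norm_mul_self, hn, one_mul, one_smul]

end Coordinates

/-! ### The regularised kernels -/

section Kernels

/-- The regularisation `1 / (N(X - X₀) + s)` of `1 / N(X - X₀)`. -/
noncomputable def regInv (s : ℝ) (X₀ X : ℍ[ℝ]) : ℝ := (Quaternion.normSq (X - X₀) + s)⁻¹

/-- The regularisation `(X - X₀) / (N(X - X₀) + s)` of `kerOne`. -/
noncomputable def regOne (s : ℝ) (X₀ X : ℍ[ℝ]) : ℍ[ℝ] := regInv s X₀ X • (X - X₀)

/-- The regularisation `(X - X₀) / (N(X - X₀) + s)²` of `kerTwo`. -/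
noncomputable def regTwo (s : ℝ) (X₀ X : ℍ[ℝ]) : ℍ[ℝ] := regInv s X₀ X • regOne s X₀ X

/-- The partial derivatives of `regOne`. -/
noncomputable def regOneDeriv (s : ℝ) (X₀ : ℍ[ℝ]) (i : Fin 4) (X : ℍ[ℝ]) : ℍ[ℝ] :=
  regInv s X₀ X • e i - (2 * coord i (X - X₀) * regInv s X₀ X) • regOne s X₀ X

variable {s : ℝ} {X₀ x : ℍ[ℝ]}

theorem contDiff_normSq_sub {n : WithTop ℕ∞} (X₀ : ℍ[ℝ]) :
    ContDiff ℝ n fun x => Quaternion.normSq (x - X₀) := by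
  have : (fun x => Quaternion.normSq (x - X₀)) = fun x => ‖x - X₀‖ ^ 2 := by
    ext x
    rw [Quaternion.normSq_eq_norm_mul_self, sq]
  rw [this]
  exact (contDiff_norm_sq ℝ).comp (contDiff_id.sub contDiff_const)

theorem contDiff_coord_sub {n : WithTop ℕ∞} (X₀ : ℍ[ℝ]) (i : Fin 4) :
    ContDiff ℝ n fun x => coord i (x - X₀) := by
  simp only [coord_eq_inner]
  exact (contDiff_id.sub contDiff_const).inner ℝ contDiff_const

theorem contDiffAt_regInv {n : WithTop ℕ∞} (h : Quaternion.normSq (x - X₀) + s ≠ 0) :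
    ContDiffAt ℝ n (regInv s X₀) x :=
  ((contDiff_normSq_sub X₀).contDiffAt.add contDiffAt_const).inv h

theorem contDiffAt_regOne {n : WithTop ℕ∞} (h : Quaternion.normSq (x - X₀) + s ≠ 0) :
    ContDiffAt ℝ n (regOne s X₀) x :=
  (contDiffAt_regInv h).smul (contDiffAt_id.sub contDiffAt_const)

theorem contDiffAt_regTwo {n : WithTop ℕ∞} (h : Quaternion.normSq (x - X₀) + s ≠ 0) :
    ContDiffAt ℝ n (regTwo s X₀) x :=
  (contDiffAt_regInv h).smul (contDiffAt_regOne h)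

theorem contDiffAt_regOneDeriv {n : WithTop ℕ∞} (h : Quaternion.normSq (x - X₀) + s ≠ 0)
    (i : Fin 4) : ContDiffAt ℝ n (regOneDeriv s X₀ i) x :=
  ((contDiffAt_regInv h).smul contDiffAt_const).sub
    (((contDiffAt_const.mul (contDiff_coord_sub X₀ i).contDiffAt).mul (contDiffAt_regInv h)).smul
      (contDiffAt_regOne h))

theorem pd_sub_const (i : Fin 4) : pd i (fun y => y - X₀) x = e i := by
  simp [pd, fderiv_sub_const]

theorem pd_normSq_sub (i : Fin 4) :
    pd i (fun y => Quaternion.normSq (y - X₀)) x = 2 * coord i (x - X₀) := by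
  have h1 : (fun x => Quaternion.normSq (x - X₀)) = fun x => (inner ℝ (x - X₀) (x - X₀) : ℝ) := rfl
  have hd : DifferentiableAt ℝ (fun y => y - X₀) x := by fun_prop
  rw [pd, h1, fderiv_inner_apply ℝ hd hd]
  have h2 : fderiv ℝ (fun y => y - X₀) x (e i) = e i := pd_sub_const i
  rw [h2, coord_eq_inner, real_inner_comm (x - X₀) (e i)]
  ring

theorem pd_coord_sub (i : Fin 4) : pd i (fun y => coord i (y - X₀)) x = 1 := by
  have hd : DifferentiableAt ℝ (fun y => y - X₀) x := by fun_prop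
  simp only [coord_eq_inner]
  rw [pd, fderiv_inner_apply ℝ hd (differentiableAt_const _)]
  have h2 : fderiv ℝ (fun y => y - X₀) x (e i) = e i := pd_sub_const i
  rw [h2, ← coord_eq_inner, coord_e_self]
  simp

theorem pd_regInv (h : Quaternion.normSq (x - X₀) + s ≠ 0) (i : Fin 4) :
    pd i (regInv s X₀) x = -(2 * coord i (x - X₀) * regInv s X₀ x ^ 2) := by
  have hd : DifferentiableAt ℝ (fun y => Quaternion.normSq (y - X₀)) x :=
    (contDiff_normSq_sub (n := 1) X₀).differentiable one_ne_zero x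
  have h1 : HasFDerivAt (regInv s X₀) _ x :=
    (hasDerivAt_inv h).comp_hasFDerivAt x (hd.hasFDerivAt.add_const s)
  have h2 : fderiv ℝ (fun y => Quaternion.normSq (y - X₀)) x (e i) = 2 * coord i (x - X₀) :=
    pd_normSq_sub i
  rw [pd, h1.fderiv, smul_apply, h2, regInv, smul_eq_mul, inv_pow]
  ring

theorem pd_regOne (h : Quaternion.normSq (x - X₀) + s ≠ 0) (i : Fin 4) :
    pd i (regOne s X₀) x = regOneDeriv s X₀ i x := by
  have h1 := (contDiffAt_regInv (n := 1) h).differentiableAt one_ne_zero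
  have h2 : DifferentiableAt ℝ (fun y => y - X₀) x := by fun_prop
  have := pd_smul h1 h2 i
  rw [pd_sub_const, pd_regInv h] at this
  refine this.trans ?_
  simp only [regOneDeriv, regOne]
  module

theorem pd_regTwo (h : Quaternion.normSq (x - X₀) + s ≠ 0) (i : Fin 4) :
    pd i (regTwo s X₀) x = regInv s X₀ x ^ 2 • e i -
      (4 * coord i (x - X₀) * regInv s X₀ x ^ 3) • (x - X₀) := by
  have := pd_smul ((contDiffAt_regInv (n := 1) h).differentiableAt one_ne_zero)
    ((contDiffAt_regOne (n := 1) h).differentiableAt one_ne_zero) i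
  rw [pd_regOne h, pd_regInv h] at this
  refine this.trans ?_
  simp only [regOneDeriv, regOne]
  module

theorem pd_regOneDeriv (h : Quaternion.normSq (x - X₀) + s ≠ 0) (i : Fin 4) :
    pd i (regOneDeriv s X₀ i) x = -(4 * coord i (x - X₀) * regInv s X₀ x ^ 2) • e i +
      (8 * coord i (x - X₀) ^ 2 * regInv s X₀ x ^ 3 - 2 * regInv s X₀ x ^ 2) • (x - X₀) := by
  have hr := (contDiffAt_regInv (n := 1) h).differentiableAt one_ne_zero
  have ho := (contDiffAt_regOne (n := 1) h).differentiableAt one_ne_zero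
  have hc : DifferentiableAt ℝ (fun y => coord i (y - X₀)) x :=
    (contDiff_coord_sub (n := 1) X₀ i).differentiable one_ne_zero x
  have hcr : DifferentiableAt ℝ (fun y => (2 * coord i (y - X₀)) • regInv s X₀ y) x :=
    (hc.const_mul 2).smul hr
  have hcro : DifferentiableAt ℝ
      (fun y => ((2 * coord i (y - X₀)) • regInv s X₀ y) • regOne s X₀ y) x := hcr.smul ho
  have h1 : pd i (regOneDeriv s X₀ i) x =
      pd i (fun y => regInv s X₀ y • e i -
        ((2 * coord i (y - X₀)) • regInv s X₀ y) • regOne s X₀ y) x := rfl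
  have h2 : pd i (fun y => 2 * coord i (y - X₀)) x = 2 * 1 := by
    rw [← pd_coord_sub (X₀ := X₀) (x := x) i]
    exact pd_const_smul hc 2 i
  have h3 : pd i (fun _ : ℍ[ℝ] => e i) x = 0 := by simp [pd]
  rw [h1, pd_sub (hr.smul_const _) hcro, pd_smul hcr ho,
    pd_smul (hc.const_mul 2) hr, pd_smul hr (differentiableAt_const _), pd_regOne h,
    pd_regInv h, h2, h3]
  simp only [regOneDeriv, regOne, smul_eq_mul]
  module

/-- The term `s * regInv` is the deviation from the unregularised identity, and it is the source of
the mass that concentrates at `X₀`. -/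
theorem normSq_mul_regInv (h : Quaternion.normSq (x - X₀) + s ≠ 0) :
    Quaternion.normSq (x - X₀) * regInv s X₀ x = 1 - s * regInv s X₀ x := by
  rw [regInv]
  field_simp
  ring

/-- For `s = 0` this is `□(u/N) = -4 u/N²`, the identity linking the two kernels; the cubic term is
the effect of the regularisation. -/
theorem sum_pd_regOneDeriv (h : Quaternion.normSq (x - X₀) + s ≠ 0) :
    ∑ i, pd i (regOneDeriv s X₀ i) x =
      -(4 * regInv s X₀ x ^ 2 + 8 * s * regInv s X₀ x ^ 3) • (x - X₀) := by
  simp only [pd_regOneDeriv h]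
  have h1 : ∑ i, -(4 * coord i (x - X₀) * regInv s X₀ x ^ 2) • e i =
      -(4 * regInv s X₀ x ^ 2) • (x - X₀) := by
    conv_rhs => rw [← sum_coord_smul (x - X₀), Finset.smul_sum]
    refine Finset.sum_congr rfl fun i _ => ?_
    rw [smul_smul]
    congr 1
    ring
  rw [Finset.sum_add_distrib, h1, ← Finset.sum_smul, Finset.sum_sub_distrib, ← Finset.sum_mul,
    ← Finset.mul_sum, sum_coord_sq, ← add_smul]
  congr 1
  simp only [Finset.sum_const, Finset.card_univ, Fintype.card_fin, nsmul_eq_mul, Nat.cast_ofNat]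
  linear_combination 8 * regInv s X₀ x ^ 2 * normSq_mul_regInv h

theorem regOne_zero : regOne 0 X₀ = kerOne X₀ := by
  ext1 x
  rw [regOne, regInv, kerOne, add_zero]

theorem regTwo_zero : regTwo 0 X₀ = kerTwo X₀ := by
  ext1 x
  rw [regTwo, regOne, regInv, kerTwo, add_zero, smul_smul, ← mul_inv, sq]

theorem fderiv_kerOne (h : x ≠ X₀) (n : ℍ[ℝ]) :
    fderiv ℝ (kerOne X₀) x n = ∑ i, coord i n • regOneDeriv 0 X₀ i x := by
  rw [fderiv_apply_eq_sum, ← regOne_zero]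
  refine Finset.sum_congr rfl fun i _ => ?_
  rw [pd_regOne]
  rw [add_zero]
  exact Quaternion.normSq_ne_zero.2 (sub_ne_zero.2 h)

end Kernels

/-! ### Quaternions acting on a module, and the operator `∇` -/

section Action

variable {E : Type*} [NormedAddCommGroup E] [NormedSpace ℝ E] {V : Set ℍ[ℝ]} {x : ℍ[ℝ]}

/-- The operator `∇` for an action `m` of the quaternions on `E`. -/
noncomputable def nabla (m : ℍ[ℝ] → E → E) (f : ℍ[ℝ] → E) (x : ℍ[ℝ]) : E :=
  ∑ j, m (star (e j)) (pd j f x)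

variable {m : ℍ[ℝ] → E → E} (hb : IsBoundedBilinearMap ℝ fun p : ℍ[ℝ] × E => m p.1 p.2)
include hb

theorem action_sum_left {ι : Type*} (s : Finset ι) (a : ι → ℍ[ℝ]) (v : E) :
    m (∑ i ∈ s, a i) v = ∑ i ∈ s, m (a i) v :=
  map_sum (⟨⟨fun a => m a v, fun a b => hb.add_left a b v⟩, fun c a => hb.smul_left c a v⟩ :
    ℍ[ℝ] →ₗ[ℝ] E) a s

theorem action_sum_right {ι : Type*} (s : Finset ι) (a : ℍ[ℝ]) (v : ι → E) :
    m a (∑ i ∈ s, v i) = ∑ i ∈ s, m a (v i) :=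
  map_sum (⟨⟨fun v => m a v, fun v w => hb.add_right a v w⟩, fun c v => hb.smul_right c a v⟩ :
    E →ₗ[ℝ] E) v s

theorem action_zero_right (a : ℍ[ℝ]) : m a 0 = 0 := by
  simpa using hb.smul_right 0 a 0

theorem action_zero_left (v : E) : m 0 v = 0 := by
  simpa using hb.smul_left 0 0 v

theorem contDiffOn_nabla (hV : IsOpen V) {k : ℕ} {f : ℍ[ℝ] → E}
    (hf : ContDiffOn ℝ (k + 1 : ℕ) f V) : ContDiffOn ℝ k (nabla m f) V :=
  ContDiffOn.sum fun j _ => hb.contDiff.comp_contDiffOn (contDiffOn_const.prodMk (ContDiffOn.pd hV hf j))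

theorem pd_nabla (hV : IsOpen V) {f : ℍ[ℝ] → E} (hf : ContDiffOn ℝ 2 f V) (hx : x ∈ V)
    (i : Fin 4) : pd i (nabla m f) x = nabla m (pd i f) x := by
  have hd : ∀ j, DifferentiableAt ℝ (pd j f) x := fun j =>
    ((ContDiffOn.pd hV (k := 1) (by exact_mod_cast hf) j).contDiffAt
      (hV.mem_nhds hx)).differentiableAt (by simp)
  have hd' : ∀ j, DifferentiableAt ℝ (fun y => m (star (e j)) (pd j f y)) x := fun j =>
    DifferentiableAt.comp (g := fun p : ℍ[ℝ] × E => m p.1 p.2) x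
      (hb.differentiableAt (star (e j), pd j f x)) ((differentiableAt_const (star (e j))).prodMk (hd j))
  have h1 : pd i (nabla m f) x = pd i (fun y => ∑ j, m (star (e j)) (pd j f y)) x := rfl
  rw [h1, pd_sum _ fun j _ => hd' j, nabla]
  refine Finset.sum_congr rfl fun j _ => ?_
  rw [pd_bilin hb (differentiableAt_const _) (hd j), pd_comm hV hf hx]
  have : pd i (fun _ : ℍ[ℝ] => star (e j)) x = 0 := by simp [pd]
  rw [this, action_zero_left hb, zero_add]

/-- `□∇f = ∇□f`. -/
theorem sum_pd_pd_nabla (hV : IsOpen V) {f : ℍ[ℝ] → E} (hf : ContDiffOn ℝ 3 f V) (hx : x ∈ V) :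
    ∑ i, pd i (pd i (nabla m f)) x = nabla m (box f) x := by
  have hf2 : ContDiffOn ℝ 2 f V := hf.of_le (by norm_num)
  have hpf : ∀ i, ContDiffOn ℝ 2 (pd i f) V := fun i =>
    ContDiffOn.pd hV (k := 2) (by exact_mod_cast hf) i
  have hd : ∀ i, DifferentiableAt ℝ (pd i (pd i f)) x := fun i =>
    ((ContDiffOn.pd hV (k := 1) (by exact_mod_cast hpf i) i).contDiffAt
      (hV.mem_nhds hx)).differentiableAt (by simp)
  have h1 : ∀ i, pd i (pd i (nabla m f)) x = nabla m (pd i (pd i f)) x := fun i => by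
    rw [pd_congr hV (fun y hy => pd_nabla hb hV hf2 hy i) hx, pd_nabla hb hV (hpf i) hx]
  simp only [h1, nabla]
  rw [Finset.sum_comm]
  refine Finset.sum_congr rfl fun j _ => ?_
  rw [← action_sum_right hb]
  congr 1
  exact (pd_sum _ (fun i _ => hd i) j).symm

end Action

/-! ### Divergence of the regularised field -/

section Divergence

variable {E : Type*} [NormedAddCommGroup E] [NormedSpace ℝ E]

/-- The components of the regularised vector field whose flux through the boundary is computed. -/
noncomputable def fluxField (m : ℍ[ℝ] → E → E) (f : ℍ[ℝ] → E) (s : ℝ) (X₀ : ℍ[ℝ]) (i : Fin 4)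
    (x : ℍ[ℝ]) : E :=
  (1 / (2 * Real.pi ^ 2)) • m (regTwo s X₀ x) (m (star (e i)) (f x)) +
    (1 / (8 * Real.pi ^ 2)) • (m (regOneDeriv s X₀ i x) (nabla m f x) -
      m (regOne s X₀ x) (pd i (nabla m f) x))

variable {m : ℍ[ℝ] → E → E} (hb : IsBoundedBilinearMap ℝ fun p : ℍ[ℝ] × E => m p.1 p.2)
  {V : Set ℍ[ℝ]} (hV : IsOpen V) {f : ℍ[ℝ] → E} (hf : ContDiffOn ℝ 3 f V)
include hb hV hf

theorem contDiffAt_fluxField {s : ℝ} {X₀ x : ℍ[ℝ]} (hx : x ∈ V)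
    (h : Quaternion.normSq (x - X₀) + s ≠ 0) (i : Fin 4) :
    ContDiffAt ℝ 1 (fluxField m f s X₀ i) x := by
  have hVx := hV.mem_nhds hx
  have hf1 : ContDiffAt ℝ 1 f x := (hf.contDiffAt hVx).of_le (by norm_num)
  have hN : ContDiffOn ℝ (1 + 1 : ℕ) (nabla m f) V :=
    contDiffOn_nabla hb hV (k := 1 + 1) (by exact_mod_cast hf)
  have hN1 : ContDiffAt ℝ 1 (nabla m f) x := (hN.contDiffAt hVx).of_le (by norm_num)
  have hpN : ContDiffAt ℝ 1 (pd i (nabla m f)) x := by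
    exact_mod_cast (ContDiffOn.pd hV hN i).contDiffAt hVx
  have hm : ∀ {a : ℍ[ℝ] → ℍ[ℝ]} {v : ℍ[ℝ] → E}, ContDiffAt ℝ 1 a x → ContDiffAt ℝ 1 v x →
      ContDiffAt ℝ 1 (fun y => m (a y) (v y)) x := fun ha hv =>
    hb.contDiff.contDiffAt.comp x (ha.prodMk hv)
  exact (contDiffAt_const.smul (hm (contDiffAt_regTwo h) (hm contDiffAt_const hf1))).add
    (contDiffAt_const.smul ((hm (contDiffAt_regOneDeriv h i) hN1).sub
      (hm (contDiffAt_regOne h) hpN)))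

/-- With `r = regInv s X₀ x` and `u = x - X₀`, the coefficient of `m u (∇f)` is `r²/(2π²) - (4r² +
8sr³)/(8π²) = -s r³/π²`, and that of `f x` is `4sr³/(2π²)`. Mixed terms cancel as in Green's second
identity. -/
theorem sum_pd_fluxField (hm : ∀ q v, m q (m (star q) v) = Quaternion.normSq q • v) {s : ℝ}
    {X₀ x : ℍ[ℝ]} (hx : x ∈ V) (h : Quaternion.normSq (x - X₀) + s ≠ 0)
    (hbox : nabla m (box f) x = 0) :
    ∑ i, pd i (fluxField m f s X₀ i) x =
      (2 / Real.pi ^ 2 * s * regInv s X₀ x ^ 3) •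
        (f x - (1 / 2 : ℝ) • m (x - X₀) (nabla m f x)) := by
  have hVx := hV.mem_nhds hx
  have hf1 : DifferentiableAt ℝ f x := (hf.contDiffAt hVx).differentiableAt (by norm_num)
  have hN : ContDiffOn ℝ (1 + 1 : ℕ) (nabla m f) V :=
    contDiffOn_nabla hb hV (k := 1 + 1) (by exact_mod_cast hf)
  have hN1 : DifferentiableAt ℝ (nabla m f) x :=
    (hN.contDiffAt hVx).differentiableAt (by simp)
  have hpN : ∀ i, DifferentiableAt ℝ (pd i (nabla m f)) x := fun i =>
    ((ContDiffOn.pd hV hN i).contDiffAt hVx).differentiableAt (by simp)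
  have hK := (contDiffAt_regTwo (n := 1) h).differentiableAt one_ne_zero
  have hA := (contDiffAt_regOne (n := 1) h).differentiableAt one_ne_zero
  have hdA := fun i => (contDiffAt_regOneDeriv (n := 1) h i).differentiableAt one_ne_zero
  have hmd : ∀ {a : ℍ[ℝ] → ℍ[ℝ]} {v : ℍ[ℝ] → E}, DifferentiableAt ℝ a x →
      DifferentiableAt ℝ v x → DifferentiableAt ℝ (fun y => m (a y) (v y)) x := fun ha hv =>
    DifferentiableAt.comp (g := fun p : ℍ[ℝ] × E => m p.1 p.2) x (hb.differentiableAt _)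
      (ha.prodMk hv)
  have hpd : ∀ i, pd i (fluxField m f s X₀ i) x =
      (1 / (2 * Real.pi ^ 2)) • (m (pd i (regTwo s X₀) x) (m (star (e i)) (f x)) +
        m (regTwo s X₀ x) (m (star (e i)) (pd i f x))) +
      (1 / (8 * Real.pi ^ 2)) • (m (pd i (regOneDeriv s X₀ i) x) (nabla m f x) -
        m (regOne s X₀ x) (pd i (pd i (nabla m f)) x)) := by
    intro i
    have hc : DifferentiableAt ℝ (fun y => m (star (e i)) (f y)) x :=
      hmd (differentiableAt_const _) hf1
    have h1 : pd i (fun _ : ℍ[ℝ] => star (e i)) x = 0 := by simp [pd]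
    have h2 : pd i (fluxField m f s X₀ i) x = pd i (fun x =>
      (1 / (2 * Real.pi ^ 2)) • m (regTwo s X₀ x) (m (star (e i)) (f x)) +
      (1 / (8 * Real.pi ^ 2)) • (m (regOneDeriv s X₀ i x) (nabla m f x) -
        m (regOne s X₀ x) (pd i (nabla m f) x))) x := rfl
    have h3 : DifferentiableAt ℝ (fun y => m (regTwo s X₀ y) (m (star (e i)) (f y))) x := hmd hK hc
    have h4 : DifferentiableAt ℝ (fun y => m (regOneDeriv s X₀ i y) (nabla m f y) -
        m (regOne s X₀ y) (pd i (nabla m f) y)) x := (hmd (hdA i) hN1).sub (hmd hA (hpN i))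
    have h5 : DifferentiableAt ℝ (fun y =>
        (1 / (2 * Real.pi ^ 2)) • m (regTwo s X₀ y) (m (star (e i)) (f y))) x := h3.const_smul _
    have h6 : DifferentiableAt ℝ (fun y =>
        (1 / (8 * Real.pi ^ 2)) • (m (regOneDeriv s X₀ i y) (nabla m f y) -
          m (regOne s X₀ y) (pd i (nabla m f) y))) x := h4.const_smul _
    rw [h2, pd_add h5 h6, pd_const_smul h3, pd_const_smul h4,
      pd_sub (hmd (hdA i) hN1) (hmd hA (hpN i)), pd_bilin hb hK hc,
      pd_bilin hb (differentiableAt_const _) hf1, pd_bilin hb (hdA i) hN1,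
      pd_bilin hb hA (hpN i), h1, action_zero_left hb, zero_add, pd_regOne h]
    congr 2
    abel
  have hsmul : ∀ (c : ℝ) q v, m (c • q) v = c • m q v := fun c q v => hb.smul_left c q v
  have hsmul' : ∀ (c : ℝ) q v, m q (c • v) = c • m q v := fun c q v => hb.smul_right c q v
  have hsub : ∀ p q v, m (p - q) v = m p v - m q v := fun p q v => by
    have := hb.add_left (p - q) q v
    simp only [sub_add_cancel] at this
    exact eq_sub_of_add_eq this.symm
  set r := regInv s X₀ x with hr
  set u := x - X₀ with hu
  set N := nabla m f x with hNdef
  -- Here `hm` is used for `q = e i`, giving `4 r²`, and for `q = u`, giving `4 r³ N(u)`; the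
  -- difference is `4 r² (1 - r N(u)) = 4 s r³`.
  have hS1 : ∑ i, m (pd i (regTwo s X₀) x) (m (star (e i)) (f x)) = (4 * s * r ^ 3) • f x := by
    have : ∀ i, m (pd i (regTwo s X₀) x) (m (star (e i)) (f x)) =
        r ^ 2 • f x - (4 * r ^ 3) • m u (coord i u • m (star (e i)) (f x)) := by
      intro i
      rw [pd_regTwo h, hsub, hsmul, hsmul, hm, normSq_e, one_smul, hsmul', smul_smul]
      congr 2
      ring
    simp only [this]
    have h3 : ∑ i, coord i u • m (star (e i)) (f x) = m (star u) (f x) := by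
      have : star u = ∑ i, coord i u • star (e i) := by
        conv_lhs => rw [← sum_coord_smul u, star_sum]
        simp
      rw [this, action_sum_left hb]
      simp only [hsmul]
    have h4 : ∑ i, (4 * r ^ 3) • m u (coord i u • m (star (e i)) (f x)) =
        (4 * r ^ 3 * Quaternion.normSq u) • f x := by
      rw [← Finset.smul_sum, ← action_sum_right hb, h3, hm, smul_smul]
    have h5 : ∑ _i : Fin 4, r ^ 2 • f x = (4 * r ^ 2) • f x := by
      rw [Finset.sum_const, Finset.card_univ, Fintype.card_fin, ← Nat.cast_smul_eq_nsmul ℝ,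
        smul_smul]
      norm_num
    rw [Finset.sum_sub_distrib, h4, h5, ← sub_smul]
    congr 1
    have := normSq_mul_regInv h
    rw [← hr, ← hu] at this
    linear_combination -4 * r ^ 2 * this
  have hS2 : ∑ i, m (regTwo s X₀ x) (m (star (e i)) (pd i f x)) = r ^ 2 • m u N := by
    rw [← action_sum_right hb]
    have : regTwo s X₀ x = r ^ 2 • u := by
      rw [regTwo, regOne, smul_smul, sq]
    rw [this, hsmul]
    rfl
  have hS3 : ∑ i, m (pd i (regOneDeriv s X₀ i) x) N =
      -(4 * r ^ 2 + 8 * s * r ^ 3) • m u N := by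
    rw [← action_sum_left hb, sum_pd_regOneDeriv h, hsmul]
  have hS4 : ∑ i, m (regOne s X₀ x) (pd i (pd i (nabla m f)) x) = 0 := by
    rw [← action_sum_right hb, sum_pd_pd_nabla hb hV hf hx, hbox, action_zero_right hb]
  simp only [hpd]
  rw [Finset.sum_add_distrib, ← Finset.smul_sum, ← Finset.smul_sum, Finset.sum_add_distrib,
    Finset.sum_sub_distrib, hS1, hS2, hS3, hS4]
  have hpi : (Real.pi ^ 2) ≠ 0 := by positivity
  match_scalars <;> field_simp <;> ring

end Divergence

/-! ### The approximate identity -/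

section ApproximateIdentity

theorem hasDerivAt_sq_div_one_add_sq_sq (x : ℝ) :
    HasDerivAt (fun r : ℝ => (r ^ 2 / (1 + r ^ 2)) ^ 2 / 4) (x ^ 3 * ((1 + x ^ 2) ^ 3)⁻¹) x := by
  have hx : 1 + x ^ 2 ≠ 0 := by positivity
  have h1 : HasDerivAt (fun r : ℝ => r ^ 2) (2 * x) x := by simpa using hasDerivAt_pow 2 x
  refine (((h1.fun_div (h1.const_add 1) hx).fun_pow 2).div_const 4).congr_deriv ?_
  simp only [Nat.add_one_sub_one, pow_one, Nat.cast_ofNat]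
  field_simp
  ring

theorem tendsto_sq_div_one_add_sq_sq :
    Tendsto (fun r : ℝ => (r ^ 2 / (1 + r ^ 2)) ^ 2 / 4) atTop (𝓝 (1 / 4)) := by
  have h1 : Tendsto (fun r : ℝ => (1 + r ^ 2)⁻¹) atTop (𝓝 0) :=
    (tendsto_atTop_add_const_left _ _ (tendsto_pow_atTop two_ne_zero)).inv_tendsto_atTop
  have h2 : Tendsto (fun r : ℝ => (1 - (1 + r ^ 2)⁻¹) ^ 2 / 4) atTop (𝓝 ((1 - 0) ^ 2 / 4)) :=
    ((tendsto_const_nhds.sub h1).pow 2).div_const 4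
  convert h2 using 2 with r
  · have : 1 + r ^ 2 ≠ 0 := by positivity
    field_simp
    ring
  · norm_num

/-- The kernel has no compact support. Decay faster than the inverse fourth power of the norm
controls the contribution far from `X₀` of a function that is only integrable. -/
theorem tendsto_norm_pow_mul_one_add_norm_sq_cube_inv (H : Type*) [NormedAddCommGroup H] :
    Tendsto (fun x : H => ‖x‖ ^ 4 * (2 / Real.pi ^ 2 * ((1 + ‖x‖ ^ 2) ^ 3)⁻¹))
      (Bornology.cobounded H) (𝓝 0) := by
  have h1 : Tendsto (fun r : ℝ => (1 + r ^ 2)⁻¹) atTop (𝓝 0) :=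
    (tendsto_atTop_add_const_left _ _ (tendsto_pow_atTop two_ne_zero)).inv_tendsto_atTop
  have h2 : Tendsto (fun r : ℝ => 2 / Real.pi ^ 2 * (4 * ((r ^ 2 / (1 + r ^ 2)) ^ 2 / 4)) *
      (1 + r ^ 2)⁻¹) atTop (𝓝 (2 / Real.pi ^ 2 * (4 * (1 / 4)) * 0)) :=
    ((tendsto_sq_div_one_add_sq_sq.const_mul 4).const_mul _).mul h1
  rw [mul_zero] at h2
  refine (h2.comp tendsto_norm_cobounded_atTop).congr fun x => ?_
  have : 1 + ‖x‖ ^ 2 ≠ 0 := by positivity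
  simp only [Function.comp_apply]
  field_simp

variable {H : Type*} [NormedAddCommGroup H] [InnerProductSpace ℝ H] [FiniteDimensional ℝ H]
  [MeasurableSpace H] [BorelSpace H]

/-- In polar coordinates the unnormalised integral is four times the volume `π²/2` of the unit ball
times the radial integral `1/4`, which is `π²/2`. -/
theorem integral_one_add_norm_sq_cube_inv (hd : Module.finrank ℝ H = 4) :
    ∫ x : H, 2 / Real.pi ^ 2 * ((1 + ‖x‖ ^ 2) ^ 3)⁻¹ = 1 := by
  have : Nontrivial H := Module.nontrivial_of_finrank_pos (R := ℝ) (by omega)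
  have hball : volume.real (Metric.ball (0 : H) 1) = Real.pi ^ 2 / 2 := by
    rw [Measure.real, InnerProductSpace.volume_ball_of_dim_even (k := 2) (by omega)]
    simp only [ENNReal.ofReal_one, one_pow, one_mul, Nat.factorial_two, Nat.cast_ofNat]
    exact ENNReal.toReal_ofReal (by positivity)
  have h1 : ∫ y in Ioi (0 : ℝ), y ^ 3 * ((1 + y ^ 2) ^ 3)⁻¹ = 1 / 4 := by
    rw [integral_Ioi_of_hasDerivAt_of_nonneg' (fun x _ => hasDerivAt_sq_div_one_add_sq_sq x)
      (fun x hx => ?_) tendsto_sq_div_one_add_sq_sq]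
    · norm_num
    · have : (0 : ℝ) < x := hx
      positivity
  rw [integral_const_mul, integral_fun_norm_addHaar volume fun r => ((1 + r ^ 2) ^ 3)⁻¹, hball, hd]
  simp only [smul_eq_mul, nsmul_eq_mul, Nat.add_one_sub_one]
  rw [h1]
  have := Real.pi_ne_zero
  field_simp
  norm_num

end ApproximateIdentity

/-! ### Removing the regularisation -/

section Limits

variable {E : Type*} [NormedAddCommGroup E] [NormedSpace ℝ E]

/-- For `s = c⁻²` the kernel `s (N + s)⁻³` is the rescaling `c⁴ (1 + c² N)⁻³`. Extending `h` by zero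
treats both positions of `X₀` at once: the extension is continuous there, being locally `h` or
locally zero. -/
theorem tendsto_setIntegral_regInv_cube_smul [CompleteSpace E] {U : Set ℍ[ℝ]} (hUo : IsOpen U)
    {h : ℍ[ℝ] → E} (hh : ContinuousOn h U) (hi : IntegrableOn h U) {X₀ : ℍ[ℝ]}
    (hX₀ : X₀ ∈ U ∨ X₀ ∉ closure U) :
    Tendsto (fun c : ℝ => ∫ x in U, (2 / Real.pi ^ 2 * (c ^ 2)⁻¹ * regInv (c ^ 2)⁻¹ X₀ x ^ 3) • h x)
      atTop (𝓝 (U.indicator h X₀)) := by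
  have hc : ContinuousAt (U.indicator h) X₀ := by
    rcases hX₀ with hX | hX
    · refine (hh.continuousAt (hUo.mem_nhds hX)).congr ?_
      filter_upwards [hUo.mem_nhds hX] with y hy using (indicator_of_mem hy h).symm
    · refine (continuousAt_const (y := (0 : E))).congr ?_
      filter_upwards [isClosed_closure.isOpen_compl.mem_nhds hX] with y hy
      exact (indicator_of_notMem (fun h => hy (subset_closure h)) h).symm
  have := tendsto_integral_comp_smul_smul_of_integrable' (μ := (volume : Measure ℍ[ℝ]))
    (φ := fun x => 2 / Real.pi ^ 2 * ((1 + ‖x‖ ^ 2) ^ 3)⁻¹) (fun x => by positivity)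
    (integral_one_add_norm_sq_cube_inv Quaternion.finrank_eq_four)
    (by rw [Quaternion.finrank_eq_four]; exact tendsto_norm_pow_mul_one_add_norm_sq_cube_inv _)
    (hi.integrable_indicator hUo.measurableSet) hc
  refine this.congr' ?_
  filter_upwards [eventually_gt_atTop 0] with c hc
  rw [← integral_indicator hUo.measurableSet]
  refine integral_congr_ae (Eventually.of_forall fun x => ?_)
  simp only [Quaternion.finrank_eq_four, indicator]
  split_ifs with hx
  · congr 1
    rw [regInv, norm_smul, Real.norm_of_nonneg hc.le, norm_sub_rev,
      Quaternion.normSq_eq_norm_mul_self]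
    have h1 : 1 + (c * ‖x - X₀‖) ^ 2 ≠ 0 := by positivity
    have h2 : ‖x - X₀‖ * ‖x - X₀‖ + (c ^ 2)⁻¹ ≠ 0 := by positivity
    have h3 : (‖x - X₀‖ * ‖x - X₀‖ + (c ^ 2)⁻¹) = (c ^ 2)⁻¹ * (1 + (c * ‖x - X₀‖) ^ 2) := by
      field_simp
      ring
    rw [h3]
    field_simp
  · simp

variable {m : ℍ[ℝ] → E → E} (hb : IsBoundedBilinearMap ℝ fun p : ℍ[ℝ] × E => m p.1 p.2)
  {V : Set ℍ[ℝ]} (hV : IsOpen V) {f : ℍ[ℝ] → E} (hf : ContDiffOn ℝ 3 f V)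
include hb hV hf

/-- Joint continuity up to and including `s = 0` gives, on the compact frontier, a bound uniform in
`s ∈ [0, 1]` for dominated convergence. It holds because `N + s` stays positive off `X₀`. -/
theorem continuousOn_fluxField_prod {K : Set ℍ[ℝ]} (hKV : K ⊆ V) {X₀ : ℍ[ℝ]} (hX₀ : X₀ ∉ K)
    (i : Fin 4) :
    ContinuousOn (fun p : ℝ × ℍ[ℝ] => fluxField m f p.1 X₀ i p.2) (Ici 0 ×ˢ K) := by
  have hN : ContDiffOn ℝ (1 + 1 : ℕ) (nabla m f) V :=
    contDiffOn_nabla hb hV (k := 1 + 1) (by exact_mod_cast hf)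
  have hmaps : MapsTo (Prod.snd : ℝ × ℍ[ℝ] → ℍ[ℝ]) (Ici 0 ×ˢ K) V := fun p hp => hKV hp.2
  have h1 : ContinuousOn (fun p : ℝ × ℍ[ℝ] => f p.2) (Ici 0 ×ˢ K) :=
    hf.continuousOn.comp continuousOn_snd hmaps
  have h2 : ContinuousOn (fun p : ℝ × ℍ[ℝ] => nabla m f p.2) (Ici 0 ×ˢ K) :=
    hN.continuousOn.comp continuousOn_snd hmaps
  have h3 : ContinuousOn (fun p : ℝ × ℍ[ℝ] => pd i (nabla m f) p.2) (Ici 0 ×ˢ K) :=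
    (ContDiffOn.pd hV hN i).continuousOn.comp continuousOn_snd hmaps
  have hr : ContinuousOn (fun p : ℝ × ℍ[ℝ] => regInv p.1 X₀ p.2) (Ici 0 ×ˢ K) := by
    refine ContinuousOn.inv₀ (ContinuousOn.add ?_ continuousOn_fst) fun p hp => ?_
    · exact ((contDiff_normSq_sub (n := 0) X₀).continuous.comp continuous_snd).continuousOn
    · have h4 : 0 < Quaternion.normSq (p.2 - X₀) := by
        refine lt_of_le_of_ne Quaternion.normSq_nonneg (Ne.symm (Quaternion.normSq_ne_zero.2 ?_))
        exact sub_ne_zero.2 fun h => hX₀ (h ▸ hp.2)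
      have h5 : 0 ≤ p.1 := hp.1
      positivity
  have hO : ContinuousOn (fun p : ℝ × ℍ[ℝ] => regOne p.1 X₀ p.2) (Ici 0 ×ˢ K) :=
    hr.smul (continuous_snd.sub continuous_const).continuousOn
  have hT : ContinuousOn (fun p : ℝ × ℍ[ℝ] => regTwo p.1 X₀ p.2) (Ici 0 ×ˢ K) := hr.smul hO
  have hD : ContinuousOn (fun p : ℝ × ℍ[ℝ] => regOneDeriv p.1 X₀ i p.2) (Ici 0 ×ˢ K) := by
    have hc : Continuous fun p : ℝ × ℍ[ℝ] => coord i (p.2 - X₀) :=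
      (contDiff_coord_sub (n := 0) X₀ i).continuous.comp continuous_snd
    exact (hr.smul continuousOn_const).sub
      (((continuousOn_const.mul hc.continuousOn).mul hr).smul hO)
  have hm : ∀ {a : ℝ × ℍ[ℝ] → ℍ[ℝ]} {v : ℝ × ℍ[ℝ] → E}, ContinuousOn a (Ici 0 ×ˢ K) →
      ContinuousOn v (Ici 0 ×ˢ K) → ContinuousOn (fun p => m (a p) (v p)) (Ici 0 ×ˢ K) :=
    fun ha hv => hb.continuous.comp_continuousOn (ha.prodMk hv)
  exact (continuousOn_const.smul (hm hT (hm continuousOn_const h1))).add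
    (continuousOn_const.smul ((hm hD h2).sub (hm hO h3)))

theorem continuousOn_fluxField {K : Set ℍ[ℝ]} (hKV : K ⊆ V) {X₀ : ℍ[ℝ]} (hX₀ : X₀ ∉ K)
    {s : ℝ} (hs : 0 ≤ s) (i : Fin 4) : ContinuousOn (fluxField m f s X₀ i) K :=
  ContinuousOn.comp (g := fun p : ℝ × ℍ[ℝ] => fluxField m f p.1 X₀ i p.2)
    (f := fun x : ℍ[ℝ] => (s, x)) (continuousOn_fluxField_prod hb hV hf hKV hX₀ i)
    (continuousOn_const.prodMk continuousOn_id) fun _ hx => ⟨hs, hx⟩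

theorem tendsto_integral_fluxField {U : Set ℍ[ℝ]} (hUo : IsOpen U) (hUb : Bornology.IsBounded U)
    (hU : HasPiecewiseC1Boundary U) (hUV : closure U ⊆ V) {X₀ : ℍ[ℝ]} (hX₀ : X₀ ∉ frontier U)
    (i : Fin 4) :
    Tendsto (fun c : ℝ => ∫ x, (inner ℝ (outwardNormal U x) (e i) : ℝ) •
        fluxField m f (c ^ 2)⁻¹ X₀ i x ∂surfaceMeasure U) atTop
      (𝓝 (∫ x, (inner ℝ (outwardNormal U x) (e i) : ℝ) •
        fluxField m f 0 X₀ i x ∂surfaceMeasure U)) := by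
  have hKV : frontier U ⊆ V := frontier_subset_closure.trans hUV
  have hprod := continuousOn_fluxField_prod hb hV hf hKV hX₀ i
  have hcpt : IsCompact (frontier U) :=
    Metric.isCompact_of_isClosed_isBounded isClosed_frontier
      (hUb.closure.subset frontier_subset_closure)
  have hsub : Icc (0 : ℝ) 1 ×ˢ frontier U ⊆ Ici 0 ×ˢ frontier U :=
    prod_mono Icc_subset_Ici_self Subset.rfl
  obtain ⟨C, hC⟩ := (isCompact_Icc.prod hcpt).exists_bound_of_continuousOn (hprod.mono hsub)
  have hs0 : Tendsto (fun c : ℝ => (c ^ 2)⁻¹) atTop (𝓝 0) :=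
    (tendsto_pow_atTop two_ne_zero).inv_tendsto_atTop
  have hs1 : ∀ᶠ c : ℝ in atTop, (c ^ 2)⁻¹ ∈ Icc (0 : ℝ) 1 := by
    filter_upwards [eventually_ge_atTop 1] with c hc
    exact ⟨by positivity, inv_le_one_of_one_le₀ (one_le_pow₀ hc)⟩
  have hfin := isFiniteMeasure_surfaceMeasure hU
  refine tendsto_integral_filter_of_dominated_convergence (fun _ => C) ?_ ?_
    (integrable_const C) ?_
  · refine Eventually.of_forall fun c => ?_
    exact (integrable_inner_outwardNormal_smul hUo hU (integrable_surfaceMeasure_of_continuousOn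
      hUb hU (continuousOn_fluxField hb hV hf hKV hX₀ (by positivity) i)) (e i)).aestronglyMeasurable
  · filter_upwards [hs1] with c hc
    filter_upwards [ae_mem_frontier (U := U)] with x hx
    have h1 : ‖(inner ℝ (outwardNormal U x) (e i) : ℝ)‖ ≤ 1 := by
      refine (norm_inner_le_norm _ _).trans ?_
      have h2 : ‖e i‖ = 1 := by
        have := normSq_e i
        rw [Quaternion.normSq_eq_norm_mul_self] at this
        nlinarith [norm_nonneg (e i)]
      rw [h2, mul_one]
      exact norm_outwardNormal_le x
    rw [norm_smul]
    have h3 := hC ((c ^ 2)⁻¹, x) ⟨hc, hx⟩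
    simp only at h3
    calc _ ≤ 1 * ‖fluxField m f (c ^ 2)⁻¹ X₀ i x‖ := by gcongr
      _ ≤ C := by rwa [one_mul]
  · filter_upwards [ae_mem_frontier (U := U)] with x hx
    refine tendsto_const_nhds.smul ?_
    have h1 : ContinuousOn (fun s => fluxField m f s X₀ i x) (Ici 0) :=
      ContinuousOn.comp (g := fun p : ℝ × ℍ[ℝ] => fluxField m f p.1 X₀ i p.2)
        (f := fun s : ℝ => (s, x)) hprod (continuousOn_id.prodMk continuousOn_const)
        fun s hs => ⟨hs, hx⟩
    have h2 : Tendsto (fun c : ℝ => (c ^ 2)⁻¹) atTop (𝓝[Ici 0] 0) :=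
      tendsto_nhdsWithin_iff.2 ⟨hs0, hs1.mono fun c hc => hc.1⟩
    exact (h1 0 self_mem_Ici).tendsto.comp h2

end Limits

/-! ### The integral representation -/

section Representation

variable {E : Type*} [NormedAddCommGroup E] [NormedSpace ℝ E] [CompleteSpace E]
  {m : ℍ[ℝ] → E → E} (hb : IsBoundedBilinearMap ℝ fun p : ℍ[ℝ] × E => m p.1 p.2)
  {U : Set ℍ[ℝ]} (hUo : IsOpen U) (hUb : Bornology.IsBounded U) (hU : HasPiecewiseC1Boundary U)
  {V : Set ℍ[ℝ]} (hV : IsOpen V) (hUV : closure U ⊆ V) {f : ℍ[ℝ] → E}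
  (hf : ContDiffOn ℝ 3 f V) {X₀ : ℍ[ℝ]}

theorem notMem_frontier_of_mem_or_notMem_closure (hUo : IsOpen U) (hX₀ : X₀ ∈ U ∨ X₀ ∉ closure U) :
    X₀ ∉ frontier U := by
  rw [hUo.frontier_eq]
  rintro ⟨h1, h2⟩
  exact hX₀.elim h2 fun h => h h1

include hb hUo hUb hU hV hUV hf

/-- The total flux of the field `fluxField m f 0 X₀` through the boundary of `U`. -/
theorem sum_integral_fluxField_eq_indicator
    (hm : ∀ q v, m q (m (star q) v) = Quaternion.normSq q • v)
    (hbox : ∀ x ∈ V, nabla m (box f) x = 0) (hX₀ : X₀ ∈ U ∨ X₀ ∉ closure U) :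
    ∑ i, ∫ x, (inner ℝ (outwardNormal U x) (e i) : ℝ) • fluxField m f 0 X₀ i x ∂surfaceMeasure U =
      U.indicator f X₀ := by
  have hX : X₀ ∉ frontier U := notMem_frontier_of_mem_or_notMem_closure hUo hX₀
  have hN : ContDiffOn ℝ (1 + 1 : ℕ) (nabla m f) V :=
    contDiffOn_nabla hb hV (k := 1 + 1) (by exact_mod_cast hf)
  have hc : ContinuousOn (fun x => f x - (1 / 2 : ℝ) • m (x - X₀) (nabla m f x)) V :=
    hf.continuousOn.sub (continuousOn_const.smul (hb.continuous.comp_continuousOn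
      ((continuous_id.sub continuous_const).continuousOn.prodMk hN.continuousOn)))
  -- For each `c > 0` the flux and the solid integral agree by Gauss-Green, with `s = c⁻²`. Their
  -- limits, `h1` and `h2`, are the two sides of the claim.
  have h1 := tendsto_finsetSum Finset.univ fun i _ =>
    tendsto_integral_fluxField hb hV hf hUo hUb hU hUV hX i
  have h2 := tendsto_setIntegral_regInv_cube_smul hUo (hc.mono (subset_closure.trans hUV))
    (integrableOn_of_continuousOn_closure hUb (hc.mono hUV)) hX₀
  have h3 : U.indicator (fun x => f x - (1 / 2 : ℝ) • m (x - X₀) (nabla m f x)) X₀ =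
      U.indicator f X₀ := by
    by_cases hXU : X₀ ∈ U
    · rw [indicator_of_mem hXU, indicator_of_mem hXU, sub_self, action_zero_left hb, smul_zero,
        sub_zero]
    · rw [indicator_of_notMem hXU, indicator_of_notMem hXU]
  rw [h3] at h2
  refine tendsto_nhds_unique h1 (h2.congr' ?_)
  filter_upwards [eventually_gt_atTop 0] with c hc0
  have hs : 0 < (c ^ 2)⁻¹ := by positivity
  have hne : ∀ x, Quaternion.normSq (x - X₀) + (c ^ 2)⁻¹ ≠ 0 := fun x =>
    (add_pos_of_nonneg_of_pos Quaternion.normSq_nonneg hs).ne'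
  have hflux : ∀ i, ContDiffOn ℝ (0 + 1 : ℕ) (fluxField m f (c ^ 2)⁻¹ X₀ i) V := fun i x hx =>
    (contDiffAt_fluxField hb hV hf hx (hne x) i).contDiffWithinAt
  have h4 : ∀ i, ∫ x, (inner ℝ (outwardNormal U x) (e i) : ℝ) •
      fluxField m f (c ^ 2)⁻¹ X₀ i x ∂surfaceMeasure U =
        ∫ x in U, pd i (fluxField m f (c ^ 2)⁻¹ X₀ i) x := fun i =>
    (setIntegral_fderiv_eq_integral_surfaceMeasure hUo hUb hU hV hUV (hflux i) (e i)).symm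
  simp only [h4]
  rw [← integral_finsetSum]
  · exact setIntegral_congr_fun hUo.measurableSet fun x hx =>
      (sum_pd_fluxField hb hV hf hm (hUV (subset_closure hx)) (hne x)
        (hbox x (hUV (subset_closure hx)))).symm
  · exact fun i _ => integrableOn_of_continuousOn_closure hUb
      ((ContDiffOn.pd hV (hflux i) i).continuousOn.mono hUV)

theorem representation_of_nabla_box_eq_zero
    (hm : ∀ q v, m q (m (star q) v) = Quaternion.normSq q • v)
    (hbox : ∀ x ∈ V, nabla m (box f) x = 0) (hX₀ : X₀ ∈ U ∨ X₀ ∉ closure U) :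
    Integrable (formDensity U fun X v => m (kerTwo X₀ X) (m (DxPlus v) (f X)))
        (surfaceMeasure U) ∧
      Integrable (fun X => m (normalDeriv U (kerOne X₀) X) (nabla m f X)) (surfaceMeasure U) ∧
      Integrable (fun X => m (kerOne X₀ X) (normalDeriv U (nabla m f) X)) (surfaceMeasure U) ∧
      (1 / (2 * Real.pi ^ 2)) •
          formIntegral U (fun X v => m (kerTwo X₀ X) (m (DxPlus v) (f X))) +
        (1 / (8 * Real.pi ^ 2)) •
          ∫ X, m (normalDeriv U (kerOne X₀) X) (nabla m f X) ∂surfaceMeasure U -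
        (1 / (8 * Real.pi ^ 2)) •
          ∫ X, m (kerOne X₀ X) (normalDeriv U (nabla m f) X) ∂surfaceMeasure U =
      U.indicator f X₀ := by
  have hX : X₀ ∉ frontier U := notMem_frontier_of_mem_or_notMem_closure hUo hX₀
  have hKV : frontier U ⊆ V := frontier_subset_closure.trans hUV
  have hN : ContDiffOn ℝ (1 + 1 : ℕ) (nabla m f) V :=
    contDiffOn_nabla hb hV (k := 1 + 1) (by exact_mod_cast hf)
  have hne : ∀ x ∈ frontier U, Quaternion.normSq (x - X₀) + 0 ≠ 0 := fun x hx => by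
    rw [add_zero]
    exact Quaternion.normSq_ne_zero.2 (sub_ne_zero.2 fun h => hX (h ▸ hx))
  have hsmul : ∀ (c : ℝ) q v, m (c • q) v = c • m q v := fun c q v => hb.smul_left c q v
  have hsmul' : ∀ (c : ℝ) q v, m q (c • v) = c • m q v := fun c q v => hb.smul_right c q v
  have hint : ∀ {φ : Fin 4 → ℍ[ℝ] → E}, (∀ i, ContinuousOn (φ i) (frontier U)) → ∀ i, Integrable
      (fun x => (inner ℝ (outwardNormal U x) (e i) : ℝ) • φ i x) (surfaceMeasure U) :=
    fun hφ i => integrable_inner_outwardNormal_smul hUo hU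
      (integrable_surfaceMeasure_of_continuousOn hUb hU (hφ i)) (e i)
  have hcm : ∀ {a : ℍ[ℝ] → ℍ[ℝ]} {v : ℍ[ℝ] → E}, ContinuousOn a (frontier U) →
      ContinuousOn v (frontier U) → ContinuousOn (fun x => m (a x) (v x)) (frontier U) :=
    fun ha hv => hb.continuous.comp_continuousOn (ha.prodMk hv)
  have hK : ContinuousOn (regTwo 0 X₀) (frontier U) := fun x hx =>
    (contDiffAt_regTwo (n := 0) (hne x hx)).continuousAt.continuousWithinAt
  have hA : ContinuousOn (regOne 0 X₀) (frontier U) := fun x hx =>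
    (contDiffAt_regOne (n := 0) (hne x hx)).continuousAt.continuousWithinAt
  have hD : ∀ i, ContinuousOn (regOneDeriv 0 X₀ i) (frontier U) := fun i x hx =>
    (contDiffAt_regOneDeriv (n := 0) (hne x hx) i).continuousAt.continuousWithinAt
  have hNc : ContinuousOn (nabla m f) (frontier U) := hN.continuousOn.mono hKV
  have hpN : ∀ i, ContinuousOn (pd i (nabla m f)) (frontier U) := fun i =>
    (ContDiffOn.pd hV hN i).continuousOn.mono hKV
  have hI1 := hint (φ := fun i x => m (regTwo 0 X₀ x) (m (star (e i)) (f x))) fun i =>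
    hcm hK (hcm continuousOn_const (hf.continuousOn.mono hKV))
  have hI2 := hint (φ := fun i x => m (regOneDeriv 0 X₀ i x) (nabla m f x)) fun i => hcm (hD i) hNc
  have hI3 := hint (φ := fun i x => m (regOne 0 X₀ x) (pd i (nabla m f) x)) fun i => hcm hA (hpN i)
  -- Only almost everywhere: at singular points `outwardNormal` takes its default value `0`, and
  -- `DxPlus_tangentFrame` needs a unit vector.
  have hE1 : (fun x => ∑ i, (inner ℝ (outwardNormal U x) (e i) : ℝ) •
      m (regTwo 0 X₀ x) (m (star (e i)) (f x))) =ᵐ[surfaceMeasure U]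
      formDensity U fun X v => m (kerTwo X₀ X) (m (DxPlus v) (f X)) := by
    filter_upwards [ae_isRegularBoundaryPoint hU] with x hx
    have h1 : star (outwardNormal U x) =
        ∑ i, (inner ℝ (outwardNormal U x) (e i) : ℝ) • star (e i) := by
      conv_lhs => rw [← sum_coord_smul (outwardNormal U x), star_sum]
      simp [coord_eq_inner]
    rw [formDensity, DxPlus_tangentFrame (outwardNormal_spec hx).1, h1, action_sum_left hb,
      action_sum_right hb, regTwo_zero]
    simp only [hsmul, hsmul']
  have hE2 : (fun x => ∑ i, (inner ℝ (outwardNormal U x) (e i) : ℝ) •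
      m (regOneDeriv 0 X₀ i x) (nabla m f x)) =ᵐ[surfaceMeasure U]
      fun X => m (normalDeriv U (kerOne X₀) X) (nabla m f X) := by
    filter_upwards [ae_mem_frontier (U := U)] with x hx
    have hxX : x ≠ X₀ := fun h => hX (h ▸ hx)
    rw [normalDeriv, fderiv_kerOne hxX, action_sum_left hb]
    simp only [hsmul, coord_eq_inner]
  have hE3 : (fun x => ∑ i, (inner ℝ (outwardNormal U x) (e i) : ℝ) •
      m (regOne 0 X₀ x) (pd i (nabla m f) x)) =ᵐ[surfaceMeasure U]
      fun X => m (kerOne X₀ X) (normalDeriv U (nabla m f) X) := by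
    refine Eventually.of_forall fun x => ?_
    simp only [normalDeriv]
    rw [fderiv_apply_eq_sum, action_sum_right hb, regOne_zero]
    simp only [hsmul', coord_eq_inner]
  refine ⟨(integrable_finsetSum _ fun i _ => hI1 i).congr hE1,
    (integrable_finsetSum _ fun i _ => hI2 i).congr hE2,
    (integrable_finsetSum _ fun i _ => hI3 i).congr hE3, ?_⟩
  rw [formIntegral, ← integral_congr_ae hE1, ← integral_congr_ae hE2, ← integral_congr_ae hE3,
    integral_finsetSum _ fun i _ => hI1 i, integral_finsetSum _ fun i _ => hI2 i,
    integral_finsetSum _ fun i _ => hI3 i,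
    ← sum_integral_fluxField_eq_indicator hb hUo hUb hU hV hUV hf hm hbox hX₀,
    Finset.smul_sum, Finset.smul_sum, Finset.smul_sum, ← Finset.sum_add_distrib,
    ← Finset.sum_sub_distrib]
  refine Finset.sum_congr rfl fun i _ => ?_
  have hJ1 : Integrable (fun x => (1 / (2 * Real.pi ^ 2)) •
      (inner ℝ (outwardNormal U x) (e i) : ℝ) • m (regTwo 0 X₀ x) (m (star (e i)) (f x)))
      (surfaceMeasure U) := (hI1 i).smul _
  have hJ2 : Integrable (fun x => (1 / (8 * Real.pi ^ 2)) •
      (inner ℝ (outwardNormal U x) (e i) : ℝ) • m (regOneDeriv 0 X₀ i x) (nabla m f x))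
      (surfaceMeasure U) := (hI2 i).smul _
  have hJ3 : Integrable (fun x => (1 / (8 * Real.pi ^ 2)) •
      (inner ℝ (outwardNormal U x) (e i) : ℝ) • m (regOne 0 X₀ x) (pd i (nabla m f) x))
      (surfaceMeasure U) := (hI3 i).smul _
  rw [← integral_smul, ← integral_smul, ← integral_smul, ← integral_add hJ1 hJ2]
  refine (integral_sub (hJ1.add hJ2) hJ3).symm.trans ?_
  refine integral_congr_ae (Eventually.of_forall fun x => ?_)
  simp only [fluxField, Pi.add_apply]
  module

end Representation

/-! ### Columns and rows as instances of the action -/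

section SpinorActions

theorem isBoundedBilinearMap_lact :
    IsBoundedBilinearMap ℝ fun p : ℍ[ℝ] × Spinor => lact p.1 p.2 := by
  let B : ℍ[ℝ] →ₗ[ℝ] Spinor →ₗ[ℝ] Spinor := LinearMap.mk₂ ℝ lact
    (fun a b v => by simp [lact, Matrix.add_mulVec])
    (fun c a v => by simp [lact, Matrix.smul_mulVec])
    (fun a v w => by simp [lact, Matrix.mulVec_add])
    (fun c a v => by simp [lact, Matrix.mulVec_smul])
  exact (LinearMap.toContinuousLinearMap
    (LinearMap.toContinuousLinearMap.toLinearMap ∘ₗ B)).isBoundedBilinearMap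

theorem isBoundedBilinearMap_ract :
    IsBoundedBilinearMap ℝ fun p : ℍ[ℝ] × CoSpinor => ract p.2 p.1 := by
  let B : ℍ[ℝ] →ₗ[ℝ] CoSpinor →ₗ[ℝ] CoSpinor := LinearMap.mk₂ ℝ (fun q s => ract s q)
    (fun a b v => by simp [ract, Matrix.vecMul_add])
    (fun c a v => by simp [ract, Matrix.vecMul_smul])
    (fun a v w => by simp [ract, Matrix.add_vecMul])
    (fun c a v => by simp [ract, Matrix.smul_vecMul])
  exact (LinearMap.toContinuousLinearMap
    (LinearMap.toContinuousLinearMap.toLinearMap ∘ₗ B)).isBoundedBilinearMap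

theorem lact_lact_star (q : ℍ[ℝ]) (v : Spinor) :
    lact q (lact (star q) v) = Quaternion.normSq q • v := by
  rw [lact, lact, Matrix.mulVec_mulVec, ← map_mul, Quaternion.self_mul_star,
    ← Quaternion.algebraMap_def, AlgHom.commutes, Algebra.algebraMap_eq_smul_one,
    Matrix.smul_mulVec, Matrix.one_mulVec]

theorem ract_ract_star (q : ℍ[ℝ]) (v : CoSpinor) :
    ract (ract v (star q)) q = Quaternion.normSq q • v := by
  rw [ract, ract, Matrix.vecMul_vecMul, ← map_mul, Quaternion.star_mul_self,
    ← Quaternion.algebraMap_def, AlgHom.commutes, Algebra.algebraMap_eq_smul_one,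
    Matrix.vecMul_smul, Matrix.vecMul_one]

theorem star_e (i : Fin 4) : star (e i) = if i = 0 then e i else -e i := by
  fin_cases i <;> ext <;> simp [re_e, imI_e, imJ_e, imK_e]

/-- The signs in `∇` are those of quaternionic conjugation on the units. -/
theorem nabla_lact (f : ℍ[ℝ] → Spinor) : nabla lact f = nablaLeft f := by
  ext1 x
  simp only [nabla, nablaLeft, Fin.sum_univ_four, star_e]
  simp [lact, Matrix.neg_mulVec, sub_eq_add_neg]

theorem nabla_ract (g : ℍ[ℝ] → CoSpinor) : nabla (fun q s => ract s q) g = nablaRight g := by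
  ext1 x
  simp only [nabla, nablaRight, Fin.sum_univ_four, star_e]
  simp [ract, Matrix.vecMul_neg, sub_eq_add_neg]

end SpinorActions

end QuasiRegular

theorem theorem3p2 (U : Set ℍ[ℝ]) (hUo : IsOpen U) (hUb : Bornology.IsBounded U)
    (hU : QuasiRegular.HasPiecewiseC1Boundary U) :
    -- the value on the right is `f X₀` for `X₀ ∈ U` and `0` for `X₀ ∉ closure U`
    -- quasi left anti regular functions
    (∀ (V : Set ℍ[ℝ]) (f : ℍ[ℝ] → QuasiRegular.Spinor), IsOpen V → closure U ⊆ V →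
      QuasiRegular.IsQLAR V f →
      ∀ X₀ : ℍ[ℝ], X₀ ∈ U ∨ X₀ ∉ closure U →
        Integrable (QuasiRegular.formDensity U (QuasiRegular.leftForm f X₀))
          (QuasiRegular.surfaceMeasure U) ∧
        Integrable (QuasiRegular.leftTermA U f X₀) (QuasiRegular.surfaceMeasure U) ∧
        Integrable (QuasiRegular.leftTermB U f X₀) (QuasiRegular.surfaceMeasure U) ∧
        (1 / (2 * Real.pi ^ 2)) •
            QuasiRegular.formIntegral U (QuasiRegular.leftForm f X₀)
          + (1 / (8 * Real.pi ^ 2)) •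
            ∫ X, QuasiRegular.leftTermA U f X₀ X ∂(QuasiRegular.surfaceMeasure U)
          - (1 / (8 * Real.pi ^ 2)) •
            ∫ X, QuasiRegular.leftTermB U f X₀ X ∂(QuasiRegular.surfaceMeasure U)
          = U.indicator f X₀) ∧
    -- quasi right anti regular functions
    (∀ (V : Set ℍ[ℝ]) (g : ℍ[ℝ] → QuasiRegular.CoSpinor), IsOpen V → closure U ⊆ V →
      QuasiRegular.IsQRAR V g →
      ∀ X₀ : ℍ[ℝ], X₀ ∈ U ∨ X₀ ∉ closure U →
        Integrable (QuasiRegular.formDensity U (QuasiRegular.rightForm g X₀))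
          (QuasiRegular.surfaceMeasure U) ∧
        Integrable (QuasiRegular.rightTermA U g X₀) (QuasiRegular.surfaceMeasure U) ∧
        Integrable (QuasiRegular.rightTermB U g X₀) (QuasiRegular.surfaceMeasure U) ∧
        (1 / (2 * Real.pi ^ 2)) •
            QuasiRegular.formIntegral U (QuasiRegular.rightForm g X₀)
          + (1 / (8 * Real.pi ^ 2)) •
            ∫ X, QuasiRegular.rightTermA U g X₀ X ∂(QuasiRegular.surfaceMeasure U)
          - (1 / (8 * Real.pi ^ 2)) •
            ∫ X, QuasiRegular.rightTermB U g X₀ X ∂(QuasiRegular.surfaceMeasure U)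
          = U.indicator g X₀) := by
  refine ⟨fun V f hV hUV hf X₀ hX₀ => ?_, fun V g hV hUV hg X₀ hX₀ => ?_⟩
  · have h := QuasiRegular.representation_of_nabla_box_eq_zero
      QuasiRegular.isBoundedBilinearMap_lact hUo hUb hU hV hUV hf.1 QuasiRegular.lact_lact_star
      (fun x hx => by rw [QuasiRegular.nabla_lact]; exact hf.2 x hx) hX₀
    rw [QuasiRegular.nabla_lact] at h
    exact h
  · have h := QuasiRegular.representation_of_nabla_box_eq_zero
      QuasiRegular.isBoundedBilinearMap_ract hUo hUb hU hV hUV hg.1 QuasiRegular.ract_ract_star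
      (fun x hx => by rw [QuasiRegular.nabla_ract]; exact hg.2 x hx) hX₀
    rw [QuasiRegular.nabla_ract] at h
    exact h
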